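/- Let $\mathbb F\in\{\mathbb R,\mathbb C\}$. **Definitions.** Let $(\Omega,\Sigma,\mu)$ be a $\sigma$-finite measure space. A *variable exponent* is a measurable function $P\colon\Omega\to(0,\infty]$. Its *essential range* $R(P)\subseteq[0,\infty]$ is the support of the image measure $P(\mu)$, i.e. the set of all $p\in[0,\infty]$ with $\mu(P^{-1}(V))>0$ for every neighbourhood $V$ of $p$; put $P^-=\min R(P)$ and $P^+=\max R(P)$. With the convention that $t^\infty=0$ for $0\le t\le 1$ and $t^\infty=\infty$ for $t>1$, $L_P(\mu)$ is the space of all (classes of a.e. equal) measurable $f\colon\Omega\to\mathbb F$ such that $\int_\Omega |tf(\omega)|^{P(\omega)}\,d\mu(\omega)<\infty$ for some $t>0$, endowed with $\|f\|_P=\inf\{t>0:\int_\Omega |f(\omega)/t|^{P(\omega)}\,d\mu(\omega)<1\}$ (a quasi-norm if $P^->0$). An *Orlicz function* is a nondecreasing left-continuous function $F\colon[0,\infty)\to[0,\infty]$ with $\lim_{t\to0^+}F(t)=0$ and $\lim_{t\to\infty}F(t)>0$. The space $\ell_F$ consists of all $x=(x_n)\in\mathbb F^{\mathbb N}$ with $\sum_n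 F(t|x_n|)<\infty$ for some $t>0$, with the vector topology for which the sets $u\{x:\sum_nF(|x_n|)<\varepsilon\}$, $u,\varepsilon>0$, are a neighbourhood basis at the origin. For $R\subseteq(0,\infty]$ nonempty, let $\mathcal K(R)$ be the closed convex hull in $\mathcal C([0,1])$ of the functions $\psi_p(t)=t^p/p$, $p\in R$ (with $\psi_\infty=0$). Let $\mathcal O(R)$ be the set of all Orlicz functions $F$ for which there are $0<c\le1$, $\varphi\in\mathcal K(R)$ and constants $a,b>0$ with $a\varphi(t)\le F(t)\le b\varphi(t)$ for all $0\le t\le c$. A *sequence space* is a quasi-Banach lattice $S\subseteq\mathbb F^{\mathbb N}$ (with the coordinatewise modulus: if $y\in S$ and $|x_n|\le|y_n|$ for all $n$, then $x\in S$ and $\|x\|_S\le\|y\|_S$), with continuous inclusion into $\mathbb F^{\mathbb N}$, containing all finitely supported sequences, and for which there is a constant $C$ such that, whenever $x^{(k)}\in S$ converge coordinatewise to $x$ and $A:=\limsup_k\|x^{(k)}\|_S<\infty$, then $x\in S$ and $\|x\|_S\le CA$. It is *subsymmetric* if for every strictly increasing $\pi\colon\mathbb N\to\mathbb N$ the map $(a_n)_n\mapsto(a_{\pi(n)})_n$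 is an isometry from $\{f\in S:\operatorname{supp} f\subseteq\pi(\mathbb N)\}$ onto $S$. It *embeds* into $L_P(\mu)$ if there is a linear map $T\colon S\to L_P(\mu)$ that is an isomorphism onto its image, i.e. there are $a,b>0$ with $a\|x\|_S\le\|Tx\|_P\le b\|x\|_S$ for all $x\in S$. Equalities $S=\ell_2$, $S=\ell_F$ mean that the two spaces consist of the same sequences and have the same topology (for $\ell_2$: equivalent quasi-norms). **Theorem.** Let $P$ be a variable exponent over a nonzero nonatomic $\sigma$-finite measure space $(\Omega,\Sigma,\mu)$, and suppose that $P^-\ge2$ and $P^+<\infty$. Let $S$ be a subsymmetric sequence space. Then $S$ embeds into $L_P(\mu)$ if and only if $S=\ell_2$ or $S=\ell_F$ for some $F\in\mathcal O(R(P))$. -/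

import Mathlib

open MeasureTheory Filter Topology
open scoped NNReal ENNReal

noncomputable section

namespace VarExp

/-! ### Orlicz and Musielak-Orlicz functions -/

/-- Orlicz functions: nondecreasing left-continuous maps `F : [0,∞) → [0,∞]` with
`F(t) → 0` as `t → 0⁺` and `F(∞) > 0` (by monotonicity: `F` takes a positive value). -/
structure IsOrlicz (F : ℝ≥0 → ℝ≥0∞) : Prop where
  mono : Monotone F
  leftCont : ∀ t, ContinuousWithinAt F (Set.Iic t) t
  tendsto_zero : Tendsto F (𝓝[>] 0) (𝓝 0)
  pos_infty : ∃ t, 0 < F t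

/-- The power function `t ↦ t ^ p`, `p ∈ (0,∞]`; for `p = ∞` it is `∞ · 1_{(1,∞)}`. -/
def potential (p : ℝ≥0∞) (t : ℝ≥0) : ℝ≥0∞ :=
  if p = ⊤ then (if t ≤ 1 then 0 else ⊤) else (t : ℝ≥0∞) ^ p.toReal

section Spaces

variable {Ω : Type*} [MeasurableSpace Ω]

/-- The modular `ρ_M(g) = ∫ M(ω, g(ω)) dμ(ω)` of a nonnegative function `g`. -/
def modular (μ : Measure Ω) (M : Ω → ℝ≥0 → ℝ≥0∞) (g : Ω → ℝ≥0) : ℝ≥0∞ :=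
  ∫⁻ ω, M ω (g ω) ∂μ

/-- The Luxemburg functional `inf {t ∈ (0,∞) : ρ_M(g / t) < 1}`; it is `∞` if there is no
such `t`. -/
def luxemburg (μ : Measure Ω) (M : Ω → ℝ≥0 → ℝ≥0∞) (g : Ω → ℝ≥0) : ℝ≥0∞ :=
  sInf ((fun t : ℝ≥0 => (t : ℝ≥0∞)) '' {t | 0 < t ∧ modular μ M (fun ω => g ω / t) < 1})

/-- The Musielak-Orlicz function `M_P(ω, t) = t ^ P(ω)` of a variable exponent `P`. -/
def expFun (P : Ω → ℝ≥0∞) (ω : Ω) (t : ℝ≥0) : ℝ≥0∞ := potential (P ω) t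

/-- The variable exponent Lebesgue space `L_P(μ)`, as a set of classes of a.e. equal
measurable functions with values in `𝕜`. -/
def varLebesgue (𝕜 : Type*) [RCLike 𝕜] (μ : Measure Ω) (P : Ω → ℝ≥0∞) : Set (Ω →ₘ[μ] 𝕜) :=
  {f | ∃ t : ℝ≥0, 0 < t ∧ modular μ (expFun P) (fun ω => t * ‖f ω‖₊) < ⊤}

/-- The quasi-norm `‖f‖_P` of `L_P(μ)`. -/
def varNorm {𝕜 : Type*} [RCLike 𝕜] (μ : Measure Ω) (P : Ω → ℝ≥0∞) (f : Ω →ₘ[μ] 𝕜) : ℝ≥0∞ :=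
  luxemburg μ (expFun P) (fun ω => ‖f ω‖₊)

/-- The essential range of `P`: the support in `[0,∞]` of the image measure `P(μ)`. -/
def essRange (μ : Measure Ω) (P : Ω → ℝ≥0∞) : Set ℝ≥0∞ := (μ.map P).support

/-- `P⁻`, the minimum of the essential range. -/
def expInf (μ : Measure Ω) (P : Ω → ℝ≥0∞) : ℝ≥0∞ := sInf (essRange μ P)

/-- `P⁺`, the maximum of the essential range. -/
def expSup (μ : Measure Ω) (P : Ω → ℝ≥0∞) : ℝ≥0∞ := sSup (essRange μ P)

/-- `μ` is nonatomic: every measurable set of positive measure splits into two measurable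
sets of positive measure. -/
def Nonatomic (μ : Measure Ω) : Prop :=
  ∀ A, MeasurableSet A → 0 < μ A →
    ∃ B, B ⊆ A ∧ MeasurableSet B ∧ 0 < μ B ∧ 0 < μ (A \ B)

end Spaces

/-! ### Orlicz functions generated near zero by power functions -/

/-- `ψ_p(t) = t ^ p / p` on `[0,1]`, with `ψ_∞ = 0`, as an element of `C([0,1])`. -/
def psi (p : ℝ≥0∞) : C(unitInterval, ℝ) where
  toFun t := if p = ⊤ then 0 else (t : ℝ) ^ p.toReal / p.toReal
  continuous_toFun := by
    split_ifs
    · exact continuous_const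
    · exact ((Real.continuous_rpow_const ENNReal.toReal_nonneg).comp
        continuous_subtype_val).div_const _

/-- `𝒦(R)`: the closed convex hull in `C([0,1])` of `{ψ_p : p ∈ R}`. -/
def KSet (R : Set ℝ≥0∞) : Set C(unitInterval, ℝ) := closedConvexHull ℝ (psi '' R)

/-- `𝒪(R)`: the Orlicz functions `F` for which there are `0 < c ≤ 1` and `φ ∈ 𝒦(R)` with
`F ≈ φ` on `[0,c]`, that is, `a φ ≤ F ≤ b φ` there for some constants `a, b > 0`. -/
def OSet (R : Set ℝ≥0∞) : Set (ℝ≥0 → ℝ≥0∞) :=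
  {F | IsOrlicz F ∧ ∃ c : ℝ, 0 < c ∧ c ≤ 1 ∧ ∃ φ ∈ KSet R, ∃ a b : ℝ, 0 < a ∧ 0 < b ∧
    ∀ t : unitInterval, (t : ℝ) ≤ c →
      ENNReal.ofReal (a * φ t) ≤ F (Real.toNNReal t) ∧
      F (Real.toNNReal t) ≤ ENNReal.ofReal (b * φ t)}

/-! ### Sequence spaces -/

/-- A sequence space: a quasi-Banach lattice of scalar sequences, continuously included in the
space of all sequences, containing the finitely supported ones, and with the weak Fatou
property. It is given by its quasi-norm, put equal to `∞` outside the space, so that the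
space itself is `{x : qnorm x < ∞}`. -/
structure SequenceSpace (𝕜 : Type*) [RCLike 𝕜] where
  qnorm : (ℕ → 𝕜) → ℝ≥0∞
  eq_zero : ∀ x, qnorm x = 0 → x = 0
  smul : ∀ (a : 𝕜) (x : ℕ → 𝕜), qnorm (a • x) = ‖a‖ₑ * qnorm x
  quasi_triangle : ∃ κ : ℝ≥0, ∀ x y, qnorm (x + y) ≤ κ * (qnorm x + qnorm y)
  lattice : ∀ x y : ℕ → 𝕜, (∀ n, ‖x n‖ ≤ ‖y n‖) → qnorm x ≤ qnorm y
  complete : ∀ x : ℕ → ℕ → 𝕜, (∀ k, qnorm (x k) < ⊤) →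
    Tendsto (fun p : ℕ × ℕ => qnorm (x p.1 - x p.2)) atTop (𝓝 0) →
    ∃ y, qnorm y < ⊤ ∧ Tendsto (fun k => qnorm (x k - y)) atTop (𝓝 0)
  continuous_coord : ∀ n, ∃ C : ℝ≥0, ∀ x, ‖x n‖ₑ ≤ C * qnorm x
  unit_mem : ∀ n, qnorm (Pi.single n 1) < ⊤
  fatou : ∃ C : ℝ≥0, ∀ (x : ℕ → ℕ → 𝕜) (y : ℕ → 𝕜),
    (∀ n, Tendsto (fun k => x k n) atTop (𝓝 (y n))) →
    qnorm y ≤ C * limsup (fun k => qnorm (x k)) atTop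

namespace SequenceSpace

variable {𝕜 : Type*} [RCLike 𝕜] (S : SequenceSpace 𝕜)

/-- The vector space of the members of a sequence space. -/
def carrier : Submodule 𝕜 (ℕ → 𝕜) where
  carrier := {x | S.qnorm x < ⊤}
  zero_mem' := by
    have h := S.smul 0 0
    simp only [zero_smul, enorm_zero, zero_mul] at h
    simp [h]
  add_mem' := by
    intro x y hx hy
    obtain ⟨κ, h⟩ := S.quasi_triangle
    exact (h x y).trans_lt (ENNReal.mul_lt_top ENNReal.coe_lt_top (ENNReal.add_lt_top.2 ⟨hx, hy⟩))
  smul_mem' := by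
    intro a x hx
    change S.qnorm (a • x) < ⊤
    rw [S.smul]
    exact ENNReal.mul_lt_top enorm_lt_top hx

/-- Subsymmetry: for every increasing `π : ℕ → ℕ`, the map `(a_n) ↦ (a_{π(n)})` is an isometry
from `{f ∈ S : supp f ⊆ π(ℕ)}` onto `S`. (Every sequence is `f ∘ π` for a unique `f` vanishing
off `π(ℕ)`, and the quasi-norm is `∞` exactly off `S`, so both "into" and "onto" are part of
the equality below.) -/
def Subsymmetric : Prop :=
  ∀ π : ℕ → ℕ, StrictMono π → ∀ f : ℕ → 𝕜, Function.support f ⊆ Set.range π →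
    S.qnorm (f ∘ π) = S.qnorm f

/-- `S = ℓ_p`: the same sequences, with equivalent quasi-norms. -/
def EqLp (p : ℝ≥0∞) : Prop :=
  ∃ a b : ℝ≥0, 0 < a ∧ 0 < b ∧ ∀ x : ℕ → 𝕜,
    a * eLpNorm x p Measure.count ≤ S.qnorm x ∧ S.qnorm x ≤ b * eLpNorm x p Measure.count

/-- `S = ℓ_F`: the same sequences and the same topology. The space `ℓ_F` consists of the `x`
with `∑ F(t |x_n|) < ∞` for some `t > 0`, and the sets `u • {x : ∑ F(|x_n|) < ε}`, `u, ε > 0`,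
form a neighbourhood basis at zero; the two filters are those of the neighbourhoods of zero. -/
def EqOrlicz (F : ℝ≥0 → ℝ≥0∞) : Prop :=
  (∀ x : ℕ → 𝕜, x ∈ S.carrier ↔
    ∃ t : ℝ≥0, 0 < t ∧ modular Measure.count (fun _ => F) (fun n => t * ‖x n‖₊) < ⊤) ∧
  comap S.qnorm (𝓝 0) =
    ⨅ t ∈ Set.Ioi (0 : ℝ≥0),
      comap (fun x : ℕ → 𝕜 => modular Measure.count (fun _ => F) (fun n => t * ‖x n‖₊)) (𝓝 0)

/-- `S` embeds into `L_P(μ)`: there is a linear map from `S` into `L_P(μ)` that is an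
isomorphism onto its image. -/
def EmbedsInto {Ω : Type*} [MeasurableSpace Ω] (μ : Measure Ω) (P : Ω → ℝ≥0∞) : Prop :=
  ∃ T : S.carrier →ₗ[𝕜] (Ω →ₘ[μ] 𝕜), (∀ x, T x ∈ varLebesgue 𝕜 μ P) ∧
    ∃ a b : ℝ≥0, 0 < a ∧ 0 < b ∧
      ∀ x : S.carrier, a * S.qnorm x ≤ varNorm μ P (T x) ∧ varNorm μ P (T x) ≤ b * S.qnorm x

end SequenceSpace

end VarExp

end

/-! Up to null sets `P` is a real function `p` with `2 ≤ p ≤ N`. Contracting a function by `σ ≤ 1`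
multiplies its modular by at most `σ ^ 2`, so embeddings can be tested on modulars alone
(`embedsInto_of_modular`, `modular_of_embedsInto`).

Necessity. Let `T` embed `S` and put `f n = T (e n)`, `u n = |f n| ^ 2`. The quasi-norm of `∑ ± x j
• e (π j)` depends neither on the signs nor on the increasing map `π`. Averaging over the signs and
applying Khintchine's inequality at each `ω`, with constants uniform in `p ≤ N`, replaces the sums
by the square functions `(∑ |x j| ^ 2 * u (π j)) ^ (1/2)` (`exists_sqMod`). Fix a finite measure `ν
≤ μ` with the same null sets. If `∫ u n dν` does not tend to zero, a subsequence gives a lower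
`ℓ_2`-estimate because `p ≥ 2`, Jensen's inequality gives the upper one, and `S = ℓ_2`
(`SqControl.eqLp_two`). If it does, a subsequence of `u` tends to zero almost everywhere, and a
Brezis-Lieb argument thins it out until its terms are almost disjoint: the modular of the square
function is then the sum of the modulars of its terms, up to a bounded error. The modular of a
single term is `m n * φ n (|x j|)`, where `φ n ∈ 𝒦(R)` is an average of the functions `ψ_p` and `m
n` stays between two positive constants. By compactness of `𝒦(R)` the `φ n` may be replaced by a
limit, which generates `S` as an Orlicz space (`SqControl.eqOrlicz`).

Sufficiency. For `ℓ_2`, a nonatomic measure carries a Rademacher sequence on a set of finite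
measure, and its square summable combinations are controlled both in `L_2` and in the modular. For
`ℓ_F`, split `Ω` into countably many parts on each of which `P` comes close to every point of its
essential range (`exists_label`). The functions `s ↦ ∫ s ^ p * g` approximate all of `𝒦(R)` on each
part, since their uniform limits form a closed convex set containing every `ψ_p`
(`KSet_subset_realizable`). Choosing `g n` on the `n`-th part with summable errors, the map sending
`x` to `x n * g n ^ (1/p)` on that part is an embedding. -/

open MeasureTheory Filter Topology
open scoped NNReal ENNReal

noncomputable section

namespace VarExp

/-! ### Reduction to bounded real exponents. -/

section Exponents

variable {Ω : Type*} [MeasurableSpace Ω] {μ : Measure Ω}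

/-- A variable exponent with essential range in `[2,∞)` agrees almost everywhere with a real
function with values in some `[2,N]`. -/
theorem exists_real_exponent {P : Ω → ℝ≥0∞} (hP : Measurable P)
    (hinf : 2 ≤ expInf μ P) (hsup : expSup μ P < ⊤) :
    ∃ (p : Ω → ℝ) (N : ℕ), Measurable p ∧ (∀ ω, 2 ≤ p ω) ∧ (∀ ω, p ω ≤ N) ∧
      (∀ᵐ ω ∂μ, P ω = ENNReal.ofReal (p ω)) ∧ (∀ᵐ ω ∂μ, P ω ∈ essRange μ P) ∧
      ∀ r ∈ essRange μ P, ∃ s : ℝ, 2 ≤ s ∧ s ≤ N ∧ r = ENNReal.ofReal s := by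
  obtain ⟨N, hN⟩ := exists_nat_ge (max 2 (expSup μ P).toReal)
  have hR : ∀ r ∈ essRange μ P, ∃ s : ℝ, 2 ≤ s ∧ s ≤ N ∧ r = ENNReal.ofReal s := by
    intro r hr
    have h1 : 2 ≤ r := hinf.trans (sInf_le hr)
    have h2 : r ≤ expSup μ P := le_sSup hr
    have h3 : r ≠ ⊤ := (h2.trans_lt hsup).ne
    refine ⟨r.toReal, ?_, ?_, (ENNReal.ofReal_toReal h3).symm⟩
    · simpa using (ENNReal.toReal_le_toReal (by simp) h3).2 h1
    · exact ((ENNReal.toReal_le_toReal h3 hsup.ne).2 h2).trans ((le_max_right _ _).trans hN)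
  have hmem : ∀ᵐ ω ∂μ, P ω ∈ essRange μ P :=
    ae_of_ae_map hP.aemeasurable Measure.support_mem_ae
  -- Clipping makes the bounds hold at every point, not only almost everywhere; where `P` lies in
  -- its essential range it changes nothing.
  refine ⟨fun ω => max 2 (min N (P ω).toReal), N, by fun_prop, fun ω => le_max_left _ _,
    fun ω => max_le ((le_max_left _ _).trans hN) (min_le_left _ _), ?_, hmem, hR⟩
  filter_upwards [hmem] with ω hω
  obtain ⟨s, h2, hs, hr⟩ := hR _ hω
  rw [hr, ENNReal.toReal_ofReal (by linarith), min_eq_right hs, max_eq_right h2]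

theorem modular_expFun {P : Ω → ℝ≥0∞} {p : Ω → ℝ} (hp : ∀ ω, 2 ≤ p ω)
    (hPp : ∀ᵐ ω ∂μ, P ω = ENNReal.ofReal (p ω)) (g : Ω → ℝ≥0) :
    modular μ (expFun P) g = ∫⁻ ω, (g ω : ℝ≥0∞) ^ p ω ∂μ := by
  refine lintegral_congr_ae ?_
  filter_upwards [hPp] with ω hω
  simp [expFun, potential, hω, ENNReal.toReal_ofReal (zero_le_two.trans (hp ω))]

theorem luxemburg_le {M : Ω → ℝ≥0 → ℝ≥0∞} {g : Ω → ℝ≥0} {t : ℝ≥0} (ht : 0 < t)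
    (h : modular μ M (fun ω => g ω / t) < 1) : luxemburg μ M g ≤ t :=
  sInf_le ⟨t, ⟨ht, h⟩, rfl⟩

theorem exists_of_luxemburg_lt {M : Ω → ℝ≥0 → ℝ≥0∞} {g : Ω → ℝ≥0} {s : ℝ≥0∞}
    (h : luxemburg μ M g < s) :
    ∃ t : ℝ≥0, 0 < t ∧ (t : ℝ≥0∞) < s ∧ modular μ M (fun ω => g ω / t) < 1 := by
  obtain ⟨_, ⟨t, ht, rfl⟩, hts⟩ := sInf_lt_iff.1 h
  exact ⟨t, ht.1, hts, ht.2⟩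

/-- For exponents at least `2`, a contraction factor comes out of the power squared. -/
theorem mul_rpow_le_sq_mul {c y : ℝ≥0∞} (hc : c ≤ 1) {q : ℝ} (hq : 2 ≤ q) :
    (c * y) ^ q ≤ c ^ 2 * y ^ q := by
  rw [ENNReal.mul_rpow_of_nonneg _ _ (by linarith)]
  gcongr
  rw [← ENNReal.rpow_two]
  exact ENNReal.rpow_le_rpow_of_exponent_ge hc hq

end Exponents

/-! ### Embeddings in terms of the modular. -/

section Embedding

variable {𝕜 : Type*} [RCLike 𝕜] {Ω : Type*} [MeasurableSpace Ω] {μ : Measure Ω}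

theorem SequenceSpace.qnorm_nnreal_smul (S : SequenceSpace 𝕜) (t : ℝ≥0) (x : ℕ → 𝕜) :
    S.qnorm (((t : ℝ) : 𝕜) • x) = t * S.qnorm x := by
  rw [S.smul]
  congr 1
  rw [← ofReal_norm]
  simp

theorem lintegral_enorm_smul {p : Ω → ℝ} (t : ℝ≥0) (f : Ω →ₘ[μ] 𝕜) :
    ∫⁻ ω, ‖(((t : ℝ) : 𝕜) • f) ω‖ₑ ^ p ω ∂μ = ∫⁻ ω, (t * ‖f ω‖ₑ) ^ p ω ∂μ := by
  refine lintegral_congr_ae ?_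
  filter_upwards [AEEqFun.coeFn_smul ((t : ℝ) : 𝕜) f] with ω hω
  rw [hω, Pi.smul_apply, enorm_smul]
  congr 2
  rw [← ofReal_norm]
  simp

/-- An embedding criterion in terms of the modular. -/
theorem SequenceSpace.embedsInto_of_modular (S : SequenceSpace 𝕜) {P : Ω → ℝ≥0∞} {p : Ω → ℝ}
    (hp : ∀ ω, 2 ≤ p ω) (hPp : ∀ᵐ ω ∂μ, P ω = ENNReal.ofReal (p ω))
    (T : S.carrier →ₗ[𝕜] (Ω →ₘ[μ] 𝕜)) {δ C D : ℝ≥0} (hδ : 0 < δ)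
    (hi : ∀ x : S.carrier, S.qnorm x < δ → ∫⁻ ω, ‖T x ω‖ₑ ^ p ω ∂μ ≤ C)
    (hii : ∀ x : S.carrier, ∫⁻ ω, ‖T x ω‖ₑ ^ p ω ∂μ < 1 → S.qnorm x ≤ D) :
    S.EmbedsInto μ P := by
  have scale : ∀ (t : ℝ≥0) (x : S.carrier), 0 < t →
      ∫⁻ ω, ‖T (((t : ℝ) : 𝕜) • x) ω‖ₑ ^ p ω ∂μ
        = modular μ (expFun P) (fun ω => t * ‖T x ω‖₊) := by
    intro t x ht
    rw [map_smul, lintegral_enorm_smul, modular_expFun hp hPp]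
    simp [enorm_eq_nnnorm]
  have hq : ∀ (t : ℝ≥0) (x : S.carrier), S.qnorm ((((t : ℝ) : 𝕜) • x : S.carrier) : ℕ → 𝕜)
      = t * S.qnorm x := fun t x => S.qnorm_nnreal_smul t x
  have small : ∀ x : S.carrier, ∀ s : ℝ≥0, S.qnorm x / δ < s →
      modular μ (expFun P) (fun ω => s⁻¹ * ‖T x ω‖₊) ≤ C := by
    intro x s hs
    have hs0 : 0 < s := by
      by_contra h
      simp [le_antisymm (not_lt.1 h) bot_le] at hs
    rw [← scale _ _ (inv_pos.2 hs0)]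
    apply hi
    rw [hq, ENNReal.coe_inv hs0.ne']
    have := (ENNReal.div_lt_iff (Or.inl (by simpa using hδ.ne')) (Or.inl (by simp))).1 hs
    rw [mul_comm, ← div_eq_mul_inv]
    exact ENNReal.div_lt_of_lt_mul (by rwa [mul_comm])
  -- The summand `1` keeps the constants positive when `C` or `D` vanishes. In the upper estimate it
  -- also gives `C < (C + 1) ^ 2`, so that a modular at most `C` drops below `1` after division of
  -- the function by `C + 1`.
  refine ⟨T, ?_, (D + 1)⁻¹, (C + 1) / δ, by positivity, by positivity, fun x => ⟨?_, ?_⟩⟩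
  · intro x
    have hx : S.qnorm x / δ < ⊤ := ENNReal.div_lt_top x.2.ne (by simpa using hδ.ne')
    obtain ⟨s, hs, -⟩ := ENNReal.lt_iff_exists_nnreal_btwn.1 hx
    have hs0 : 0 < s := by
      by_contra h
      simp [le_antisymm (not_lt.1 h) bot_le] at hs
    exact ⟨s⁻¹, inv_pos.2 hs0, (small x s hs).trans_lt ENNReal.coe_lt_top⟩
  · refine le_of_forall_gt fun s hs => ?_
    obtain ⟨t, ht, hts, hm⟩ := exists_of_luxemburg_lt hs
    refine lt_of_le_of_lt ?_ hts
    have h1 := hii ((((t⁻¹ : ℝ≥0) : ℝ) : 𝕜) • x) (by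
      rw [scale _ _ (inv_pos.2 ht)]
      convert hm using 3
      rw [mul_comm, div_eq_mul_inv])
    rw [hq, ENNReal.coe_inv ht.ne'] at h1
    rw [ENNReal.coe_inv (by positivity), mul_comm, ← div_eq_mul_inv]
    refine ENNReal.div_le_of_le_mul ?_
    calc S.qnorm x = t * ((t : ℝ≥0∞)⁻¹ * S.qnorm x) := by
          rw [← mul_assoc, ENNReal.mul_inv_cancel (by simpa using ht.ne') (by simp), one_mul]
      _ ≤ t * (D + 1 : ℝ≥0) := by
          gcongr
          exact h1.trans (by simp)
  · have : (((C + 1) / δ : ℝ≥0) : ℝ≥0∞) * S.qnorm x = (C + 1) * (S.qnorm x / δ) := by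
      rw [ENNReal.coe_div hδ.ne']
      simp only [div_eq_mul_inv, ENNReal.coe_add, ENNReal.coe_one]
      ring
    rw [this]
    have hx : S.qnorm x / δ ≠ ⊤ := (ENNReal.div_lt_top x.2.ne (by simpa using hδ.ne')).ne
    refine ENNReal.le_of_forall_pos_le_add fun ε hε _ => ?_
    set s : ℝ≥0 := (S.qnorm x / δ).toNNReal + ε / (C + 1) with hsdef
    have hs : S.qnorm x / δ < s := by
      rw [hsdef, ENNReal.coe_add, ENNReal.coe_toNNReal hx]
      exact ENNReal.lt_add_right hx (by simpa using (by positivity : ε / (C + 1) ≠ 0))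
    have hs0 : 0 < s := by positivity
    have key : varNorm μ P (T x) ≤ ((C + 1) * s : ℝ≥0) := by
      refine luxemburg_le (by positivity) ?_
      have h1 := small x s hs
      rw [modular_expFun hp hPp] at h1 ⊢
      have hle : ∀ ω, ((‖T x ω‖₊ / ((C + 1) * s) : ℝ≥0) : ℝ≥0∞) ^ p ω
          ≤ ((C + 1 : ℝ≥0)⁻¹ : ℝ≥0) ^ 2 * ((s⁻¹ * ‖T x ω‖₊ : ℝ≥0) : ℝ≥0∞) ^ p ω := by
        intro ω
        have e : ‖T x ω‖₊ / ((C + 1) * s) = (C + 1)⁻¹ * (s⁻¹ * ‖T x ω‖₊) := by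
          field_simp
        rw [e, ENNReal.coe_mul]
        refine mul_rpow_le_sq_mul ?_ (hp ω)
        exact_mod_cast inv_le_one_of_one_le₀ (by simp)
      calc _ ≤ ∫⁻ ω, ((C + 1 : ℝ≥0)⁻¹ : ℝ≥0) ^ 2 * ((s⁻¹ * ‖T x ω‖₊ : ℝ≥0) : ℝ≥0∞) ^ p ω ∂μ :=
            lintegral_mono hle
        _ = ((C + 1 : ℝ≥0)⁻¹ : ℝ≥0) ^ 2 * ∫⁻ ω, ((s⁻¹ * ‖T x ω‖₊ : ℝ≥0) : ℝ≥0∞) ^ p ω ∂μ :=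
            lintegral_const_mul' _ _ (by simp)
        _ ≤ ((C + 1 : ℝ≥0)⁻¹ : ℝ≥0) ^ 2 * (C : ℝ≥0∞) := by gcongr
        _ < 1 := by
            rw [← ENNReal.coe_pow, ← ENNReal.coe_mul, ENNReal.coe_lt_one_iff, inv_pow,
              inv_mul_lt_iff₀ (by positivity)]
            calc C < C + 1 := by simp
              _ ≤ (C + 1) ^ 2 * 1 := by
                rw [mul_one]; exact le_self_pow₀ (by simp) (by simp)
    refine key.trans ?_
    rw [hsdef, mul_add, mul_div_cancel₀ _ (by positivity : (C + 1) ≠ 0)]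
    push_cast
    rw [ENNReal.coe_toNNReal hx]

/-- What an embedding says about the modular. -/
theorem SequenceSpace.modular_of_embedsInto (S : SequenceSpace 𝕜) {P : Ω → ℝ≥0∞} {p : Ω → ℝ}
    (hp : ∀ ω, 2 ≤ p ω) (hPp : ∀ᵐ ω ∂μ, P ω = ENNReal.ofReal (p ω)) (h : S.EmbedsInto μ P) :
    ∃ (T : S.carrier →ₗ[𝕜] (Ω →ₘ[μ] 𝕜)) (δ D : ℝ≥0), 0 < δ ∧
      (∀ x : S.carrier, S.qnorm x < δ → ∫⁻ ω, ‖T x ω‖ₑ ^ p ω ∂μ ≤ 1) ∧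
      ∀ x : S.carrier, ∫⁻ ω, ‖T x ω‖ₑ ^ p ω ∂μ < 1 → S.qnorm x ≤ D := by
  obtain ⟨T, -, a, b, ha, hb, hT⟩ := h
  refine ⟨T, b⁻¹, a⁻¹, by positivity, fun x hx => ?_, fun x hx => ?_⟩
  · have h1 : varNorm μ P (T x) < 1 := by
      refine (hT x).2.trans_lt ?_
      rw [ENNReal.coe_inv hb.ne'] at hx
      calc (b : ℝ≥0∞) * S.qnorm x < b * (b : ℝ≥0∞)⁻¹ :=
            ENNReal.mul_lt_mul_right (by simpa using hb.ne') (by simp) hx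
        _ = 1 := ENNReal.mul_inv_cancel (by simpa using hb.ne') (by simp)
    obtain ⟨t, ht, ht1, hm⟩ := exists_of_luxemburg_lt h1
    rw [modular_expFun hp hPp] at hm
    refine le_trans (lintegral_mono fun ω => ?_) hm.le
    refine ENNReal.rpow_le_rpow ?_ (by linarith [hp ω])
    rw [enorm_eq_nnnorm, ENNReal.coe_le_coe]
    exact le_div_self (by simp) ht (by exact_mod_cast ht1.le)
  · have h1 : varNorm μ P (T x) ≤ (1 : ℝ≥0) := by
      refine luxemburg_le one_pos ?_
      rw [modular_expFun hp hPp]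
      simpa [enorm_eq_nnnorm] using hx
    have h2 := (hT x).1.trans h1
    rw [ENNReal.coe_inv ha.ne', ← one_div]
    rw [ENNReal.le_div_iff_mul_le (Or.inl (by simpa using ha.ne')) (Or.inl (by simp)), mul_comm]
    simpa using h2

end Embedding

/-! ### The compact convex set `𝒦(R)`. -/

section Generated

/-- The functions `t ^ q / q` on `[0,1]`, as a continuous path in `C([0,1])` for `q ≥ 2`
(and constant in `q` below `2`). -/
def psiPath : C(ℝ, C(unitInterval, ℝ)) :=
  ContinuousMap.curry ⟨fun x : ℝ × unitInterval => (x.2 : ℝ) ^ max x.1 2 / max x.1 2, by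
    refine Continuous.div ?_ (by fun_prop) fun x => by positivity
    rw [continuous_iff_continuousAt]
    intro x
    exact ContinuousAt.rpow (f := fun x : ℝ × unitInterval => (x.2 : ℝ))
      (g := fun x : ℝ × unitInterval => max x.1 2) (by fun_prop) (by fun_prop)
      (Or.inr (by positivity))⟩

theorem psiPath_apply {q : ℝ} (hq : 2 ≤ q) (t : unitInterval) :
    psiPath q t = (t : ℝ) ^ q / q := by
  simp [psiPath, max_eq_left hq]

theorem psi_ofReal {q : ℝ} (hq : 2 ≤ q) : psi (ENNReal.ofReal q) = psiPath q := by
  ext t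
  rw [psiPath_apply hq]
  simp [psi, ENNReal.toReal_ofReal (zero_le_two.trans hq)]

/-- A linear inequality between two values passes from the power functions to `𝒦(R)`. -/
theorem KSet_linear {R : Set ℝ≥0∞} {A B c : ℝ} {s t : unitInterval}
    (h : ∀ r ∈ R, A * psi r s + c ≤ B * psi r t) {φ : C(unitInterval, ℝ)} (hφ : φ ∈ KSet R) :
    A * φ s + c ≤ B * φ t := by
  have : KSet R ⊆ {φ | A * φ s + c ≤ B * φ t} := by
    refine closedConvexHull_min ?_ ?_ ?_
    · rintro _ ⟨r, hr, rfl⟩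
      exact h r hr
    · intro f hf g hg a b ha hb hab
      simp only [Set.mem_ofPred_eq, ContinuousMap.add_apply, ContinuousMap.smul_apply,
        smul_eq_mul] at *
      have e : c = a * c + b * c := by rw [← add_mul, hab, one_mul]
      rw [e]
      nlinarith [mul_le_mul_of_nonneg_left hf ha, mul_le_mul_of_nonneg_left hg hb]
    · exact isClosed_le (by fun_prop) (by fun_prop)
  exact this hφ

variable {R : Set ℝ≥0∞} {N : ℕ}
  (hR : ∀ r ∈ R, ∃ s : ℝ, 2 ≤ s ∧ s ≤ N ∧ r = ENNReal.ofReal s)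

include hR

theorem KSet_mono {φ : C(unitInterval, ℝ)} (hφ : φ ∈ KSet R) : Monotone φ := by
  intro s t hst
  have := KSet_linear (A := 1) (B := 1) (c := 0) (s := s) (t := t) (fun r hr => by
    obtain ⟨q, h2, -, rfl⟩ := hR r hr
    rw [psi_ofReal h2, psiPath_apply h2, psiPath_apply h2, one_mul, one_mul, add_zero]
    have := s.2.1
    gcongr) hφ
  simpa using this

/-- On `[0,1]` the function `t ^ q / q` decreases in `q`. The bound shows that members of `𝒦(R)`
vanish only at `0`, even after passing to limits. -/
theorem KSet_lower {φ : C(unitInterval, ℝ)} (hφ : φ ∈ KSet R) (t : unitInterval) :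
    (t : ℝ) ^ N / N ≤ φ t := by
  have := KSet_linear (A := 0) (B := 1) (c := (t : ℝ) ^ N / N) (s := t) (t := t) (fun r hr => by
    obtain ⟨q, h2, hN, rfl⟩ := hR r hr
    rw [psi_ofReal h2, psiPath_apply h2, one_mul, zero_mul, zero_add]
    have h0 := t.2.1
    rw [← Real.rpow_natCast]
    refine div_le_div₀ (by positivity) ?_ (by linarith) hN
    rcases h0.eq_or_lt with h | h
    · rw [← h, Real.zero_rpow (by linarith), Real.zero_rpow (by linarith)]
    · exact Real.rpow_le_rpow_of_exponent_ge h t.2.2 hN) hφ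
  simpa using this

/-- Each `ψ_q` satisfies `ψ_q (σ t) = σ ^ q * ψ_q t` with `q ≥ 2`. This scaling is what turns
bounded modulars into small ones. -/
theorem KSet_mul_le {φ : C(unitInterval, ℝ)} (hφ : φ ∈ KSet R) (σ t : unitInterval) :
    φ (σ * t) ≤ (σ : ℝ) ^ 2 * φ t := by
  have := KSet_linear (A := 1) (B := (σ : ℝ) ^ 2) (c := 0) (s := σ * t) (t := t) (fun r hr => by
    obtain ⟨q, h2, -, rfl⟩ := hR r hr
    rw [psi_ofReal h2, psiPath_apply h2, psiPath_apply h2, one_mul, add_zero, ← mul_div_assoc]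
    have h0 := t.2.1
    have h1 := σ.2.1
    rw [Set.Icc.coe_mul, Real.mul_rpow h1 h0]
    gcongr
    rcases h1.eq_or_lt with h | h
    · rw [← h, Real.zero_rpow (by linarith)]; norm_num
    · rw [← Real.rpow_two]
      exact Real.rpow_le_rpow_of_exponent_ge h σ.2.2 h2) hφ
  simpa using this

/-- Sequences in `𝒦(R)` have uniformly convergent subsequences, with limits in `𝒦(R)`. -/
theorem KSet_subseq {φ : ℕ → C(unitInterval, ℝ)} (hφ : ∀ n, φ n ∈ KSet R) :
    ∃ φ₀ ∈ KSet R, ∃ π : ℕ → ℕ, StrictMono π ∧ Tendsto (φ ∘ π) atTop (𝓝 φ₀) := by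
  have hsub : psi '' R ⊆ psiPath '' Set.Icc 2 (N : ℝ) := by
    rintro _ ⟨r, hr, rfl⟩
    obtain ⟨q, h2, hN, rfl⟩ := hR r hr
    exact ⟨q, ⟨h2, hN⟩, (psi_ofReal h2).symm⟩
  -- The generators lie on the compact arc `psiPath '' [2,N]`, and in a Banach space the closed
  -- convex hull of a totally bounded set is compact.
  have hc : IsCompact (KSet R) := by
    have h1 : TotallyBounded (psi '' R) :=
      (isCompact_Icc.image psiPath.continuous).totallyBounded.subset hsub
    have h2 : KSet R = closure (convexHull ℝ (psi '' R)) := closedConvexHull_eq_closure_convexHull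
    rw [h2]
    exact h1.convexHull.closure.isCompact_of_isClosed isClosed_closure
  obtain ⟨φ₀, h0, π, hπ, hl⟩ := hc.tendsto_subseq hφ
  exact ⟨φ₀, h0, π, hπ, hl⟩

omit hR

/-- A function on `[0,1]`, continued as a constant to `[0,∞)`. -/
def extFun (φ : C(unitInterval, ℝ)) (s : ℝ≥0) : ℝ≥0∞ :=
  ENNReal.ofReal (φ (Set.projIcc 0 1 zero_le_one (s : ℝ)))

theorem extFun_of_le (φ : C(unitInterval, ℝ)) {s : ℝ≥0} (hs : s ≤ 1) :
    extFun φ s = ENNReal.ofReal (φ ⟨s, s.coe_nonneg, by exact_mod_cast hs⟩) := by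
  rw [extFun, Set.projIcc_of_mem zero_le_one ⟨s.coe_nonneg, by exact_mod_cast hs⟩]

theorem extFun_coe (φ : C(unitInterval, ℝ)) (t : unitInterval) :
    extFun φ (Real.toNNReal t) = ENNReal.ofReal (φ t) := by
  rw [extFun, Real.coe_toNNReal _ t.2.1, Set.projIcc_val]

theorem continuous_extFun (φ : C(unitInterval, ℝ)) : Continuous (extFun φ) := by
  unfold extFun
  exact ENNReal.continuous_ofReal.comp
    (φ.continuous.comp (continuous_projIcc.comp NNReal.continuous_coe))

include hR

theorem extFun_mono {φ : C(unitInterval, ℝ)} (hφ : φ ∈ KSet R) : Monotone (extFun φ) :=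
  fun _ _ h => ENNReal.ofReal_le_ofReal (KSet_mono hR hφ (Set.monotone_projIcc _ (by exact_mod_cast h)))

theorem extFun_mul_le {φ : C(unitInterval, ℝ)} (hφ : φ ∈ KSet R) {σ s : ℝ≥0} (hσ : σ ≤ 1)
    (hs : s ≤ 1) : extFun φ (σ * s) ≤ σ ^ 2 * extFun φ s := by
  rw [extFun_of_le φ hs, extFun_of_le φ (mul_le_one' hσ hs)]
  have h := KSet_mul_le hR hφ ⟨σ, σ.coe_nonneg, by exact_mod_cast hσ⟩ ⟨s, s.coe_nonneg, by exact_mod_cast hs⟩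
  refine (ENNReal.ofReal_le_ofReal h).trans ?_
  rw [ENNReal.ofReal_mul (by positivity), ENNReal.ofReal_pow (by simp)]
  simp

theorem extFun_zero {φ : C(unitInterval, ℝ)} (hφ : φ ∈ KSet R) : extFun φ 0 = 0 := by
  simpa using extFun_mul_le hR hφ (σ := 0) (s := 0) (by simp) (by simp)

theorem extFun_pos {φ : C(unitInterval, ℝ)} (hφ : φ ∈ KSet R) (hN : 0 < N) {s : ℝ≥0}
    (hs : 0 < s) : 0 < extFun φ s := by
  refine ENNReal.ofReal_pos.2 (lt_of_lt_of_le ?_ (KSet_lower hR hφ _))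
  have : 0 < ((Set.projIcc (0 : ℝ) 1 zero_le_one (s : ℝ) : unitInterval) : ℝ) := by
    rw [Set.coe_projIcc]
    simpa using hs
  positivity

end Generated

/-! ### Khintchine's inequality with constants uniform in the exponent. -/

section Khintchine

open Finset

variable {𝕜 : Type*} [RCLike 𝕜]

/-- The sign `1` on the set `A` and `-1` off it. -/
def sgn (𝕜 : Type*) [RCLike 𝕜] (A : Finset ℕ) (n : ℕ) : 𝕜 := if n ∈ A then 1 else -1

theorem norm_sgn (A : Finset ℕ) (n : ℕ) : ‖sgn 𝕜 A n‖ = 1 := by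
  unfold sgn; split_ifs <;> simp

theorem sum_sgn_insert {s : Finset ℕ} {m : ℕ} (hm : m ∉ s) {A : Finset ℕ} (hA : A ⊆ s)
    (b : ℕ → 𝕜) :
    (∑ n ∈ insert m s, sgn 𝕜 A n * b n = ∑ n ∈ s, sgn 𝕜 A n * b n - b m) ∧
      ∑ n ∈ insert m s, sgn 𝕜 (insert m A) n * b n = ∑ n ∈ s, sgn 𝕜 A n * b n + b m := by
  have h1 : m ∉ A := fun h => hm (hA h)
  constructor
  · rw [sum_insert hm, sgn, if_neg h1]; ring
  · rw [sum_insert hm, sgn, if_pos (mem_insert_self _ _), add_comm, one_mul]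
    congr 1
    refine sum_congr rfl fun n hn => ?_
    have : n ≠ m := fun h => hm (h ▸ hn)
    simp [sgn, this]

/-- Induction on `s`: the two signs of a new term are combined by the parallelogram law. -/
theorem sum_powerset_sq (s : Finset ℕ) (b : ℕ → 𝕜) :
    ∑ A ∈ s.powerset, ‖∑ n ∈ s, sgn 𝕜 A n * b n‖ ^ 2 = 2 ^ #s * ∑ n ∈ s, ‖b n‖ ^ 2 := by
  induction s using Finset.induction_on with
  | empty => simp
  | insert m s hm ih =>
    rw [sum_powerset_insert hm, ← sum_add_distrib]
    have : ∀ A ∈ s.powerset, ‖∑ n ∈ insert m s, sgn 𝕜 A n * b n‖ ^ 2 +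
        ‖∑ n ∈ insert m s, sgn 𝕜 (insert m A) n * b n‖ ^ 2 =
        2 * (‖∑ n ∈ s, sgn 𝕜 A n * b n‖ ^ 2) + 2 * ‖b m‖ ^ 2 := by
      intro A hA
      obtain ⟨h1, h2⟩ := sum_sgn_insert hm (mem_powerset.1 hA) b
      rw [h1, h2]
      have := parallelogram_law_with_norm 𝕜 (∑ n ∈ s, sgn 𝕜 A n * b n) (b m)
      linarith
    rw [sum_congr rfl this, sum_add_distrib, ← mul_sum, ih, sum_const, card_powerset,
      card_insert_of_notMem hm, sum_insert hm]
    simp only [nsmul_eq_mul]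
    push_cast
    ring

/-- The sum factors into the product of the `2 * cosh (c n)`, and `cosh t ≤ exp (t ^ 2 / 2)`. -/
theorem sum_powerset_exp (s : Finset ℕ) (c : ℕ → ℝ) :
    ∑ A ∈ s.powerset, Real.exp (∑ n ∈ s, sgn ℝ A n * c n)
      ≤ 2 ^ #s * Real.exp ((∑ n ∈ s, c n ^ 2) / 2) := by
  induction s using Finset.induction_on with
  | empty => simp
  | insert m s hm ih =>
    rw [sum_powerset_insert hm, ← sum_add_distrib]
    have : ∀ A ∈ s.powerset, Real.exp (∑ n ∈ insert m s, sgn ℝ A n * c n) +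
        Real.exp (∑ n ∈ insert m s, sgn ℝ (insert m A) n * c n) =
        Real.exp (∑ n ∈ s, sgn ℝ A n * c n) * (2 * Real.cosh (c m)) := by
      intro A hA
      obtain ⟨h1, h2⟩ := sum_sgn_insert hm (mem_powerset.1 hA) c
      rw [h1, h2, Real.cosh_eq, sub_eq_add_neg, Real.exp_add, Real.exp_add]
      ring
    rw [sum_congr rfl this, ← sum_mul, card_insert_of_notMem hm, sum_insert hm, add_div,
      Real.exp_add]
    calc _ ≤ (2 ^ #s * Real.exp ((∑ n ∈ s, c n ^ 2) / 2)) * (2 * Real.exp (c m ^ 2 / 2)) := by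
          gcongr
          exact Real.cosh_le_exp_half_sq _
      _ = _ := by ring

/-- Since `‖z‖ ≤ |re z| + |im z|`, one of the four terms already dominates. This reduces complex
sums to real ones. -/
theorem exp_norm_le (z : 𝕜) : Real.exp ‖z‖ ≤
    Real.exp (RCLike.re z + RCLike.im z) + Real.exp (RCLike.re z - RCLike.im z) +
    (Real.exp (-(RCLike.re z + RCLike.im z)) + Real.exp (-(RCLike.re z - RCLike.im z))) := by
  have h1 : ‖z‖ ≤ |RCLike.re z| + |RCLike.im z| := by
    refine (pow_le_pow_iff_left₀ (norm_nonneg _) (by positivity) two_ne_zero).1 ?_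
    rw [← RCLike.normSq_eq_def', RCLike.normSq_apply]
    nlinarith [sq_abs (RCLike.re z), sq_abs (RCLike.im z), abs_nonneg (RCLike.re z),
      abs_nonneg (RCLike.im z), mul_nonneg (abs_nonneg (RCLike.re z)) (abs_nonneg (RCLike.im z))]
  set a := RCLike.re z
  set b := RCLike.im z
  have h2 := Real.exp_le_exp.2 h1
  have p1 := Real.exp_pos (a + b)
  have p2 := Real.exp_pos (a - b)
  have p3 := Real.exp_pos (-(a + b))
  have p4 := Real.exp_pos (-(a - b))
  rcases abs_cases a with ⟨ha, -⟩ | ⟨ha, -⟩ <;> rcases abs_cases b with ⟨hb, -⟩ | ⟨hb, -⟩ <;>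
    rw [ha, hb] at h2
  · linarith
  · rw [← sub_eq_add_neg] at h2; linarith
  · rw [show -a + b = -(a - b) by ring] at h2; linarith
  · rw [show -a + -b = -(a + b) by ring] at h2; linarith

/-- Apply the real estimate to the four coefficient sequences `± re b ± im b`, whose squares are at
most `2 * ‖b‖ ^ 2`. -/
theorem sum_powerset_exp_norm (s : Finset ℕ) (b : ℕ → 𝕜) :
    ∑ A ∈ s.powerset, Real.exp ‖∑ n ∈ s, sgn 𝕜 A n * b n‖
      ≤ 2 ^ #s * (4 * Real.exp (∑ n ∈ s, ‖b n‖ ^ 2)) := by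
  have key : ∀ c : ℕ → ℝ, (∀ n, c n ^ 2 / 2 ≤ ‖b n‖ ^ 2) →
      ∑ A ∈ s.powerset, Real.exp (∑ n ∈ s, sgn ℝ A n * c n)
        ≤ 2 ^ #s * Real.exp (∑ n ∈ s, ‖b n‖ ^ 2) := by
    intro c hc
    refine (sum_powerset_exp s c).trans ?_
    gcongr
    rw [sum_div]
    exact sum_le_sum fun n _ => hc n
  have hn : ∀ n, ‖b n‖ ^ 2 = RCLike.re (b n) ^ 2 + RCLike.im (b n) ^ 2 := fun n => by
    rw [← RCLike.normSq_eq_def', RCLike.normSq_apply]; ring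
  have hs : ∀ A n, RCLike.re (sgn 𝕜 A n * b n) = sgn ℝ A n * RCLike.re (b n) ∧
      RCLike.im (sgn 𝕜 A n * b n) = sgn ℝ A n * RCLike.im (b n) := by
    intro A n
    unfold sgn
    split_ifs <;> simp
  have h1 := key (fun n => RCLike.re (b n) + RCLike.im (b n)) fun n => by
    rw [hn]; nlinarith [sq_nonneg (RCLike.re (b n) - RCLike.im (b n))]
  have h2 := key (fun n => RCLike.re (b n) - RCLike.im (b n)) fun n => by
    rw [hn]; nlinarith [sq_nonneg (RCLike.re (b n) + RCLike.im (b n))]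
  have h3 := key (fun n => -(RCLike.re (b n) + RCLike.im (b n))) fun n => by
    rw [hn]; nlinarith [sq_nonneg (RCLike.re (b n) - RCLike.im (b n))]
  have h4 := key (fun n => -(RCLike.re (b n) - RCLike.im (b n))) fun n => by
    rw [hn]; nlinarith [sq_nonneg (RCLike.re (b n) + RCLike.im (b n))]
  have h5 := sum_le_sum fun A (_ : A ∈ s.powerset) => exp_norm_le (∑ n ∈ s, sgn 𝕜 A n * b n)
  simp only [sum_add_distrib, map_sum, hs, ← sum_sub_distrib, ← mul_sub,
    ← sum_neg_distrib, ← mul_neg] at h5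
  simp only [← sum_add_distrib, ← mul_add,
    ← sum_neg_distrib, ← mul_neg] at h5
  simp only [sum_add_distrib] at h5
  linarith

/-- From `x ^ N / N! ≤ exp x` for `x ≥ 1`. The right side does not involve `p`, as a variable
exponent requires. -/
theorem rpow_le_factorial_mul_exp {x p : ℝ} {N : ℕ} (hx : 0 ≤ x) (hp : 0 ≤ p) (hN : p ≤ N) :
    x ^ p ≤ N.factorial * Real.exp x := by
  have h1 : (1 : ℝ) ≤ N.factorial := by exact_mod_cast N.factorial_pos
  rcases le_total x 1 with h | h
  · exact (Real.rpow_le_one hx h hp).trans (one_le_mul_of_one_le_of_one_le h1 (Real.one_le_exp hx))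
  · refine (Real.rpow_le_rpow_of_exponent_le h hN).trans ?_
    rw [Real.rpow_natCast, ← div_le_iff₀' (by positivity)]
    exact Real.pow_div_factorial_le_exp x hx N

/-- Khintchine's inequality, lower estimate for exponents at least `2`. -/
theorem khintchine_lower (s : Finset ℕ) (b : ℕ → 𝕜) {p : ℝ} (hp : 2 ≤ p) :
    2 ^ #s * (∑ n ∈ s, ‖b n‖ₑ ^ 2) ^ (p / 2)
      ≤ ∑ A ∈ s.powerset, ‖∑ n ∈ s, sgn 𝕜 A n * b n‖ₑ ^ p := by
  have hsq : ∑ A ∈ s.powerset, ‖∑ n ∈ s, sgn 𝕜 A n * b n‖ₑ ^ 2 = 2 ^ #s * ∑ n ∈ s, ‖b n‖ₑ ^ 2 := by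
    have h := congrArg ENNReal.ofReal (sum_powerset_sq s b)
    rw [ENNReal.ofReal_mul (by positivity), ENNReal.ofReal_sum_of_nonneg (fun _ _ => by positivity),
      ENNReal.ofReal_sum_of_nonneg (fun _ _ => by positivity)] at h
    simpa [ENNReal.ofReal_pow] using h
  have h2 : (2 ^ #s : ℝ≥0∞) ≠ 0 := by simp
  have h2' : (2 ^ #s : ℝ≥0∞) ≠ ⊤ := by simp
  -- Jensen's inequality for `t ↦ t ^ (p / 2)`, applied to the squares, whose mean over the signs is
  -- known exactly from `hsq`.
  have hJ := ENNReal.rpow_arith_mean_le_arith_mean_rpow s.powerset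
    (fun _ => ((2 ^ #s : ℝ≥0∞))⁻¹) (fun A => ‖∑ n ∈ s, sgn 𝕜 A n * b n‖ₑ ^ 2) (by
      rw [sum_const, card_powerset, nsmul_eq_mul]
      push_cast
      exact ENNReal.mul_inv_cancel h2 h2') (p := p / 2) (by linarith)
  rw [← mul_sum, hsq, ← mul_assoc, ENNReal.inv_mul_cancel h2 h2', one_mul, ← mul_sum] at hJ
  calc _ ≤ 2 ^ #s * ((2 ^ #s)⁻¹ * ∑ A ∈ s.powerset,
        (‖∑ n ∈ s, sgn 𝕜 A n * b n‖ₑ ^ 2) ^ (p / 2)) := by gcongr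
    _ = _ := by
      rw [← mul_assoc, ENNReal.mul_inv_cancel h2 h2', one_mul]
      refine sum_congr rfl fun A _ => ?_
      rw [← ENNReal.rpow_two, ← ENNReal.rpow_mul]
      congr 1
      ring

/-- The constant in Khintchine's inequality. -/
def khConst (N : ℕ) : ℝ≥0 := N.factorial * (4 * Real.toNNReal (Real.exp 1))

theorem sum_powerset_rpow_le (s : Finset ℕ) (b : ℕ → 𝕜) {p : ℝ} {N : ℕ} (hp : 0 ≤ p)
    (hN : p ≤ N) (hb : ∑ n ∈ s, ‖b n‖ ^ 2 ≤ 1) :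
    ∑ A ∈ s.powerset, ‖∑ n ∈ s, sgn 𝕜 A n * b n‖ ^ p ≤ 2 ^ #s * khConst N := by
  calc _ ≤ ∑ A ∈ s.powerset, N.factorial * Real.exp ‖∑ n ∈ s, sgn 𝕜 A n * b n‖ :=
        sum_le_sum fun A _ => rpow_le_factorial_mul_exp (norm_nonneg _) hp hN
    _ ≤ N.factorial * (2 ^ #s * (4 * Real.exp (∑ n ∈ s, ‖b n‖ ^ 2))) := by
        rw [← mul_sum]
        gcongr
        exact sum_powerset_exp_norm s b
    _ ≤ N.factorial * (2 ^ #s * (4 * Real.exp 1)) := by gcongr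
    _ = _ := by
        simp only [khConst, NNReal.coe_mul, NNReal.coe_natCast, NNReal.coe_ofNat,
          Real.coe_toNNReal _ (Real.exp_pos 1).le]
        ring

/-- Khintchine's inequality, upper estimate. -/
theorem khintchine_upper (s : Finset ℕ) (b : ℕ → 𝕜) {p : ℝ} {N : ℕ} (hp : 2 ≤ p) (hN : p ≤ N) :
    ∑ A ∈ s.powerset, ‖∑ n ∈ s, sgn 𝕜 A n * b n‖ₑ ^ p
      ≤ 2 ^ #s * khConst N * (∑ n ∈ s, ‖b n‖ₑ ^ 2) ^ (p / 2) := by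
  have hp0 : 0 ≤ p := by linarith
  have main : ∑ A ∈ s.powerset, ‖∑ n ∈ s, sgn 𝕜 A n * b n‖ ^ p
      ≤ 2 ^ #s * khConst N * (∑ n ∈ s, ‖b n‖ ^ 2) ^ (p / 2) := by
    set σ := ∑ n ∈ s, ‖b n‖ ^ 2 with hσ
    have hσ0 : 0 ≤ σ := sum_nonneg fun _ _ => by positivity
    rcases hσ0.eq_or_lt with h | h
    · have hb : ∀ n ∈ s, b n = 0 := fun n hn => by
        have := (sum_eq_zero_iff_of_nonneg (fun n _ => by positivity)).1 (hσ ▸ h.symm) n hn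
        simpa using this
      have hz : ∀ A : Finset ℕ, ∑ n ∈ s, sgn 𝕜 A n * b n = 0 := fun A =>
        sum_eq_zero fun n hn => by rw [hb n hn, mul_zero]
      simp only [hz, norm_zero, Real.zero_rpow (by linarith : p ≠ 0), sum_const_zero]
      positivity
    · have hr : 0 < √σ := Real.sqrt_pos.2 h
      -- Homogeneity: division by `√σ` reduces to square sum `1`.
      have h1 := sum_powerset_rpow_le s (fun n => ((√σ)⁻¹ : ℝ) • b n) hp0 hN (by
        simp only [norm_smul, norm_inv, Real.norm_eq_abs, abs_of_pos hr, mul_pow, ← mul_sum,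
          inv_pow, Real.sq_sqrt hσ0]
        rw [← hσ, inv_mul_cancel₀ h.ne'])
      simp only [mul_smul_comm, ← smul_sum, norm_smul, norm_inv, Real.norm_eq_abs,
        abs_of_pos hr] at h1
      have h2 : ∀ A : Finset ℕ, ((√σ)⁻¹ * ‖∑ n ∈ s, sgn 𝕜 A n * b n‖) ^ p
          = (σ ^ (p / 2))⁻¹ * ‖∑ n ∈ s, sgn 𝕜 A n * b n‖ ^ p := by
        intro A
        rw [Real.mul_rpow (by positivity) (norm_nonneg _), Real.inv_rpow hr.le, Real.sqrt_eq_rpow,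
          ← Real.rpow_mul hσ0]
        congr 3
        ring
      simp only [h2, ← mul_sum] at h1
      rwa [inv_mul_le_iff₀ (by positivity), mul_comm (σ ^ (p / 2))] at h1
  have h := ENNReal.ofReal_le_ofReal main
  rw [ENNReal.ofReal_mul (by positivity), ENNReal.ofReal_mul (by positivity),
    ENNReal.ofReal_sum_of_nonneg (fun _ _ => by positivity),
    ← ENNReal.ofReal_rpow_of_nonneg (sum_nonneg fun _ _ => by positivity) (by positivity),
    ENNReal.ofReal_sum_of_nonneg (fun _ _ => by positivity)] at h
  simp only [← ENNReal.ofReal_rpow_of_nonneg (norm_nonneg _) hp0] at h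
  simpa [ENNReal.ofReal_pow] using h

end Khintchine

/-! ### From an embedding to square functions. -/

section SquareFunction

open Finset

variable {𝕜 : Type*} [RCLike 𝕜] {Ω : Type*} [MeasurableSpace Ω] {μ : Measure Ω}

/-- The sequence that agrees with `x` on `{0, …, k - 1}` and vanishes beyond. -/
def trunc (k : ℕ) (x : ℕ → 𝕜) (n : ℕ) : 𝕜 := if n < k then x n else 0

theorem coeFn_sum_smul {ι : Type*} (s : Finset ι) (c : ι → 𝕜) (f : ι → Ω →ₘ[μ] 𝕜) :
    ⇑(∑ i ∈ s, c i • f i) =ᵐ[μ] fun ω => ∑ i ∈ s, c i * f i ω := by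
  classical
  induction s using Finset.induction_on with
  | empty =>
    simp only [sum_empty]
    exact AEEqFun.coeFn_zero
  | insert i s hi ih =>
    rw [sum_insert hi]
    filter_upwards [ih, AEEqFun.coeFn_add (c i • f i) (∑ i ∈ s, c i • f i),
      AEEqFun.coeFn_smul (c i) (f i)] with ω h1 h2 h3
    rw [h2, Pi.add_apply, h1, h3, sum_insert hi, Pi.smul_apply, smul_eq_mul]

/-- The modular of the square function `(∑ |x_j|² u_j)^{1/2}`. -/
def sqMod (μ : Measure Ω) (p : Ω → ℝ) (u : ℕ → Ω → ℝ≥0) (k : ℕ) (x : ℕ → 𝕜) : ℝ≥0∞ :=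
  ∫⁻ ω, (∑ j ∈ range k, ‖x j‖ₑ ^ 2 * u j ω) ^ (p ω / 2) ∂μ

/-- The quasi-norm of a subsymmetric sequence space embedded in `L_P` is equivalent to one that
is given by square functions. -/
theorem SequenceSpace.exists_sqMod (S : SequenceSpace 𝕜) (hS : S.Subsymmetric) {P : Ω → ℝ≥0∞}
    {p : Ω → ℝ} {N : ℕ} (hpm : Measurable p) (hp : ∀ ω, 2 ≤ p ω) (hN : ∀ ω, p ω ≤ N)
    (hPp : ∀ᵐ ω ∂μ, P ω = ENNReal.ofReal (p ω)) (h : S.EmbedsInto μ P) :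
    ∃ (u : ℕ → Ω → ℝ≥0) (δ c D : ℝ≥0), (∀ n, Measurable (u n)) ∧ 0 < δ ∧ 0 < c ∧
      ∀ π : ℕ → ℕ, StrictMono π → ∀ (k : ℕ) (x : ℕ → 𝕜),
        (S.qnorm (trunc k x) < δ → sqMod μ p (fun n => u (π n)) k x ≤ 1) ∧
        (sqMod μ p (fun n => u (π n)) k x ≤ c → S.qnorm (trunc k x) ≤ D) := by
  obtain ⟨T, δ, D, hδ, hi, hii⟩ := S.modular_of_embedsInto hp hPp h
  let e : ℕ → S.carrier := fun n => ⟨Pi.single n 1, S.unit_mem n⟩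
  let f : ℕ → Ω →ₘ[μ] 𝕜 := fun n => T (e n)
  have hf : ∀ n, Measurable (f n) := fun n => (AEEqFun.stronglyMeasurable (f n)).measurable
  refine ⟨fun n ω => ‖f n ω‖₊ ^ 2, δ, (khConst N + 1)⁻¹, D, fun n => (hf n).nnnorm.pow_const 2,
    hδ, by positivity, fun π hπ k x => ?_⟩
  let y : Finset ℕ → S.carrier := fun A => ∑ j ∈ range k, (sgn 𝕜 A j * x j) • e (π j)
  have hyc : ∀ A n, (y A : ℕ → 𝕜) n
      = ∑ j ∈ range k, (sgn 𝕜 A j * x j) * (Pi.single (π j) 1 : ℕ → 𝕜) n := by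
    intro A n
    simp [y, e]
  -- Subsymmetry removes `π`, and the lattice property removes the signs.
  have hyq : ∀ A, S.qnorm (y A) = S.qnorm (trunc k x) := by
    intro A
    have h1 : ∀ i, (y A : ℕ → 𝕜) (π i) = sgn 𝕜 A i * trunc k x i := by
      intro i
      rw [hyc]
      simp only [Pi.single_apply, hπ.injective.eq_iff, mul_ite, mul_one, mul_zero, sum_ite_eq,
        mem_range, trunc]
    have h2 : Function.support (y A : ℕ → 𝕜) ⊆ Set.range π := by
      intro n hn
      by_contra hc
      refine hn ?_
      rw [hyc]
      refine sum_eq_zero fun j _ => ?_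
      rw [Pi.single_apply, if_neg (fun h => hc ⟨j, h.symm⟩), mul_zero]
    rw [← hS π hπ _ h2]
    refine le_antisymm (S.lattice _ _ fun n => ?_) (S.lattice _ _ fun n => ?_) <;>
      simp [h1, norm_sgn]
  have hT : ∀ A, ∫⁻ ω, ‖T (y A) ω‖ₑ ^ p ω ∂μ
      = ∫⁻ ω, ‖∑ j ∈ range k, sgn 𝕜 A j * (x j * f (π j) ω)‖ₑ ^ p ω ∂μ := by
    intro A
    refine lintegral_congr_ae ?_
    have : T (y A) = ∑ j ∈ range k, (sgn 𝕜 A j * x j) • f (π j) := by simp [y, f]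
    rw [this]
    filter_upwards [coeFn_sum_smul (range k) (fun j => sgn 𝕜 A j * x j) (fun j => f (π j))]
      with ω hω
    simp only [hω, mul_assoc]
  have hm : ∀ A : Finset ℕ, Measurable
      fun ω => ‖∑ j ∈ range k, sgn 𝕜 A j * (x j * f (π j) ω)‖ₑ ^ p ω := by
    intro A
    have := fun j => hf (π j)
    fun_prop
  have hsq : ∀ ω, ∑ j ∈ range k, ‖x j * f (π j) ω‖ₑ ^ 2
      = ∑ j ∈ range k, ‖x j‖ₑ ^ 2 * ((‖f (π j) ω‖₊ ^ 2 : ℝ≥0) : ℝ≥0∞) := by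
    intro ω
    refine sum_congr rfl fun j _ => ?_
    rw [enorm_mul, mul_pow]
    simp [enorm_eq_nnnorm]
  have h2 : (2 ^ k : ℝ≥0∞) ≠ 0 := by simp
  have h2' : (2 ^ k : ℝ≥0∞) ≠ ⊤ := by simp
  have hsum : ∑ A ∈ (range k).powerset, ∫⁻ ω, ‖T (y A) ω‖ₑ ^ p ω ∂μ
      = ∫⁻ ω, ∑ A ∈ (range k).powerset,
        ‖∑ j ∈ range k, sgn 𝕜 A j * (x j * f (π j) ω)‖ₑ ^ p ω ∂μ := by
    rw [lintegral_finsetSum _ fun A _ => hm A]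
    exact sum_congr rfl fun A _ => hT A
  unfold sqMod
  simp only [← hsq]
  constructor
  · intro hq
    have h3 : 2 ^ k * ∫⁻ ω, (∑ j ∈ range k, ‖x j * f (π j) ω‖ₑ ^ 2) ^ (p ω / 2) ∂μ
        ≤ 2 ^ k * 1 := by
      rw [← lintegral_const_mul' _ _ h2']
      calc _ ≤ ∫⁻ ω, ∑ A ∈ (range k).powerset,
            ‖∑ j ∈ range k, sgn 𝕜 A j * (x j * f (π j) ω)‖ₑ ^ p ω ∂μ := by
            refine lintegral_mono fun ω => ?_
            simpa using khintchine_lower (range k) (fun j => x j * f (π j) ω) (hp ω)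
        _ = ∑ A ∈ (range k).powerset, ∫⁻ ω, ‖T (y A) ω‖ₑ ^ p ω ∂μ := hsum.symm
        _ ≤ ∑ A ∈ (range k).powerset, 1 := sum_le_sum fun A _ => hi _ (by rwa [hyq])
        _ = 2 ^ k * 1 := by simp
    exact (ENNReal.mul_le_mul_iff_right h2 h2').1 h3
  · intro hc
    by_contra hD
    have h3 : ∀ A, 1 ≤ ∫⁻ ω, ‖T (y A) ω‖ₑ ^ p ω ∂μ := by
      intro A
      by_contra hlt
      exact hD (hyq A ▸ hii (y A) (not_le.1 hlt))
    -- If the quasi-norm exceeds `D`, every choice of signs has modular at least `1`. The average is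
    -- at most `khConst N * c`, and `c = (khConst N + 1)⁻¹` makes this less than `1`.
    have h4 : (2 ^ k : ℝ≥0∞) * 1 ≤ 2 ^ k * (khConst N * ((khConst N + 1)⁻¹ : ℝ≥0)) := by
      calc (2 ^ k : ℝ≥0∞) * 1 = ∑ A ∈ (range k).powerset, 1 := by simp
        _ ≤ ∑ A ∈ (range k).powerset, ∫⁻ ω, ‖T (y A) ω‖ₑ ^ p ω ∂μ := sum_le_sum fun A _ => h3 A
        _ ≤ ∫⁻ ω, 2 ^ k * khConst N *
              (∑ j ∈ range k, ‖x j * f (π j) ω‖ₑ ^ 2) ^ (p ω / 2) ∂μ := by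
            rw [hsum]
            refine lintegral_mono fun ω => ?_
            simpa using khintchine_upper (range k) (fun j => x j * f (π j) ω) (hp ω) (hN ω)
        _ = 2 ^ k * khConst N *
              ∫⁻ ω, (∑ j ∈ range k, ‖x j * f (π j) ω‖ₑ ^ 2) ^ (p ω / 2) ∂μ :=
            lintegral_const_mul' _ _ (ENNReal.mul_ne_top h2' (by simp))
        _ ≤ 2 ^ k * khConst N * ((khConst N + 1)⁻¹ : ℝ≥0) := by gcongr
        _ = _ := mul_assoc _ _ _
    have h5 := (ENNReal.mul_le_mul_iff_right h2 h2').1 h4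
    rw [← ENNReal.coe_mul, ENNReal.one_le_coe_iff, ← div_eq_mul_inv, one_le_div₀ (by positivity)]
      at h5
    exact absurd h5 (by simp)

end SquareFunction

/-! ### Elementary properties of sequence spaces. -/

section SequenceSpaces

variable {𝕜 : Type*} [RCLike 𝕜]

/-- Rescale `x` into the ball of radius `δ`. With `C + 1` instead of `C` the factor is nonzero, so
the inequality survives `q₁ x = ∞`, where `0 * ∞ = 0` would spoil it. -/
theorem le_mul_of_homogeneous {q₁ q₂ : (ℕ → 𝕜) → ℝ≥0∞}
    (h₁ : ∀ (t : ℝ≥0) (x : ℕ → 𝕜), q₁ (((t : ℝ) : 𝕜) • x) = t * q₁ x)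
    (h₂ : ∀ (t : ℝ≥0) (x : ℕ → 𝕜), q₂ (((t : ℝ) : 𝕜) • x) = t * q₂ x) {δ C : ℝ≥0}
    (hδ : 0 < δ) (h : ∀ x, q₁ x < δ → q₂ x ≤ C) (x : ℕ → 𝕜) :
    q₂ x ≤ ((C + 1) / δ : ℝ≥0) * q₁ x := by
  have e : (((C + 1) / δ : ℝ≥0) : ℝ≥0∞) * q₁ x = (C + 1 : ℝ≥0) * (q₁ x / δ) := by
    rw [ENNReal.coe_div hδ.ne']
    simp only [div_eq_mul_inv]
    ring
  have hC : ((C + 1 : ℝ≥0) : ℝ≥0∞) ≠ 0 := by simp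
  rw [e, mul_comm, ← ENNReal.div_le_iff_le_mul (Or.inl hC) (Or.inl (by simp))]
  refine le_of_forall_gt_imp_ge_of_dense fun s hs => ?_
  induction s with
  | top => exact le_top
  | coe s =>
    have hs0 : s ≠ 0 := by
      rintro rfl
      simp at hs
    have h3 := h ((((s⁻¹ : ℝ≥0) : ℝ) : 𝕜) • x) (by
      rw [h₁, ENNReal.coe_inv hs0, mul_comm, ← div_eq_mul_inv]
      rw [ENNReal.div_lt_iff (Or.inl (by simpa using hδ.ne')) (Or.inl (by simp))] at hs
      exact ENNReal.div_lt_of_lt_mul (by rwa [mul_comm]))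
    rw [h₂] at h3
    refine ENNReal.div_le_of_le_mul ?_
    calc q₂ x = s * ((s⁻¹ : ℝ≥0) * q₂ x) := by
          rw [← mul_assoc, ← ENNReal.coe_mul, mul_inv_cancel₀ hs0, ENNReal.coe_one, one_mul]
      _ ≤ s * (C + 1 : ℝ≥0) := by
          gcongr
          exact h3.trans (by simp)

theorem trunc_smul (k : ℕ) (a : 𝕜) (x : ℕ → 𝕜) : trunc k (a • x) = a • trunc k x := by
  ext n
  simp [trunc]

namespace SequenceSpace

variable (S : SequenceSpace 𝕜)

theorem qnorm_trunc_le (k : ℕ) (x : ℕ → 𝕜) : S.qnorm (trunc k x) ≤ S.qnorm x :=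
  S.lattice _ _ fun n => by unfold trunc; split_ifs <;> simp

/-- The weak Fatou property for the truncations, which are eventually constant in each coordinate.
It lets all upper estimates be proved for finite sums only. -/
theorem exists_qnorm_le_of_trunc : ∃ C : ℝ≥0, ∀ (x : ℕ → 𝕜) (B : ℝ≥0∞),
    (∀ k, S.qnorm (trunc k x) ≤ B) → S.qnorm x ≤ C * B := by
  obtain ⟨C, hC⟩ := S.fatou
  refine ⟨C, fun x B hB => (hC (fun k => trunc k x) x fun n => ?_).trans ?_⟩
  · refine tendsto_const_nhds.congr' ?_
    filter_upwards [eventually_gt_atTop n] with k hk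
    simp [trunc, hk]
  · gcongr
    refine (limsup_le_limsup (Eventually.of_forall hB)).trans ?_
    simp

variable {S}

theorem Subsymmetric.qnorm_single (hS : S.Subsymmetric) (n : ℕ) (a : 𝕜) :
    S.qnorm (Pi.single n a) = ‖a‖ₑ * S.qnorm (Pi.single 0 1) := by
  have h1 : (Pi.single n a : ℕ → 𝕜) = a • Pi.single n 1 := by
    ext m; simp [Pi.single_apply]
  rw [h1, S.smul]
  congr 1
  have h := hS (fun j => j + n) (strictMono_id.add_const n) (Pi.single n 1) (by
    intro m hm
    have : m = n := by
      by_contra hne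
      simp [hne] at hm
    exact ⟨0, by simp [this]⟩)
  rw [← h]
  congr 1
  ext j
  simp [Pi.single_apply]

/-- The point is uniformity in `n`: on a small enough ball of `S` all coordinates are at most `1`.
-/
theorem Subsymmetric.enorm_mul_le (hS : S.Subsymmetric) (x : ℕ → 𝕜) (n : ℕ) :
    ‖x n‖ₑ * S.qnorm (Pi.single 0 1) ≤ S.qnorm x := by
  rw [← hS.qnorm_single n]
  refine S.lattice _ _ fun m => ?_
  rcases eq_or_ne m n with rfl | h
  · simp
  · simp [h]

theorem qnorm_single_pos : 0 < S.qnorm (Pi.single 0 1) := by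
  refine pos_iff_ne_zero.2 fun h => ?_
  simpa using congrFun (S.eq_zero _ h) 0

end SequenceSpace

end SequenceSpaces

/-! ### An equivalent finite measure below `μ`. -/

section FiniteMeasure

variable {Ω : Type*} [MeasurableSpace Ω]

/-- A `σ`-finite measure dominates a finite measure with the same null sets. -/
theorem exists_finite_le (μ : Measure Ω) [SigmaFinite μ] :
    ∃ ν : Measure Ω, IsFiniteMeasure ν ∧ ν ≤ μ ∧ μ ≪ ν := by
  obtain ⟨g, hg0, hgm, hg⟩ := exists_pos_lintegral_lt_of_sigmaFinite μ one_ne_zero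
  have hm : Measurable fun ω => min (g ω : ℝ≥0∞) 1 := by fun_prop
  refine ⟨μ.withDensity fun ω => min (g ω : ℝ≥0∞) 1, ⟨?_⟩, ?_, ?_⟩
  · rw [withDensity_apply _ MeasurableSet.univ, setLIntegral_univ]
    exact ((lintegral_mono fun ω => min_le_left _ _).trans_lt hg).trans ENNReal.one_lt_top
  · refine Measure.le_iff.2 fun s hs => ?_
    rw [withDensity_apply _ hs]
    calc _ ≤ ∫⁻ ω in s, 1 ∂μ := lintegral_mono fun ω => min_le_right _ _
      _ = μ s := by simp
  · refine withDensity_absolutelyContinuous' hm.aemeasurable (ae_of_all _ fun ω => ?_)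
    simpa using (hg0 ω).ne'

end FiniteMeasure

/-! ### The case `S = ℓ_2` of the dichotomy. -/

section Dichotomy

open Finset

variable {𝕜 : Type*} [RCLike 𝕜] {Ω : Type*} [MeasurableSpace Ω] {μ : Measure Ω}

/-- The quasi-norm of `S` is controlled by the square functions of all subsequences of `u`. -/
def SqControl (S : SequenceSpace 𝕜) (μ : Measure Ω) (p : Ω → ℝ) (u : ℕ → Ω → ℝ≥0)
    (δ c D : ℝ≥0) : Prop :=
  ∀ π : ℕ → ℕ, StrictMono π → ∀ (k : ℕ) (x : ℕ → 𝕜),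
    (S.qnorm (trunc k x) < δ → sqMod μ p (fun n => u (π n)) k x ≤ 1) ∧
    (sqMod μ p (fun n => u (π n)) k x ≤ c → S.qnorm (trunc k x) ≤ D)

variable {S : SequenceSpace 𝕜} {p : Ω → ℝ} {u : ℕ → Ω → ℝ≥0} {δ c D : ℝ≥0}

/-- Test the control on multiples of one unit vector, with `π` the shift by `n`. A small multiple
`τ` has modular at most `1`, and `τ ^ p ≥ τ ^ N`; a large multiple `r` has quasi-norm above `D`,
hence modular above `c`, and `r ^ p ≤ r ^ N`. -/
theorem SqControl.exists_bounds (H : SqControl S μ p u δ c D) (hδ : 0 < δ) (hc : 0 < c)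
    {N : ℕ} (hp : ∀ ω, 2 ≤ p ω) (hN : ∀ ω, p ω ≤ N) :
    ∃ α β : ℝ≥0, 0 < α ∧ ∀ n, α ≤ ∫⁻ ω, (u n ω : ℝ≥0∞) ^ (p ω / 2) ∂μ ∧
      ∫⁻ ω, (u n ω : ℝ≥0∞) ^ (p ω / 2) ∂μ ≤ β := by
  set e := (S.qnorm (Pi.single 0 1)).toNNReal with he
  have hee : S.qnorm (Pi.single 0 1) = e := (ENNReal.coe_toNNReal (S.unit_mem 0).ne).symm
  have he0 : 0 < e := by
    have := S.qnorm_single_pos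
    rw [hee] at this
    exact_mod_cast this
  have hq : ∀ τ : ℝ≥0, S.qnorm (trunc 1 fun _ => ((τ : ℝ) : 𝕜)) = (τ * e : ℝ≥0) := by
    intro τ
    have : trunc 1 (fun _ => ((τ : ℝ) : 𝕜)) = ((τ : ℝ) : 𝕜) • Pi.single 0 1 := by
      ext n
      rcases n with _ | n <;> simp [trunc]
    rw [this, S.qnorm_nnreal_smul, hee, ENNReal.coe_mul]
  have hs : ∀ (τ : ℝ≥0) (n : ℕ), sqMod μ p (fun j => u (j + n)) 1 (fun _ => ((τ : ℝ) : 𝕜))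
      = ∫⁻ ω, (τ : ℝ≥0∞) ^ p ω * (u n ω : ℝ≥0∞) ^ (p ω / 2) ∂μ := by
    intro τ n
    refine lintegral_congr fun ω => ?_
    have h0 : 0 ≤ p ω / 2 := by linarith [hp ω]
    have h1 : ‖((τ : ℝ) : 𝕜)‖ₑ = τ := by rw [← ofReal_norm]; simp
    simp only [sum_range_one, zero_add, h1]
    rw [ENNReal.mul_rpow_of_nonneg _ _ h0, ← ENNReal.rpow_two, ← ENNReal.rpow_mul]
    congr 2
    ring
  have hmono : ∀ n, StrictMono fun j : ℕ => j + n := fun n => strictMono_id.add_const n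
  set τ : ℝ≥0 := min 1 (δ / (2 * e)) with hτ
  have hτ0 : 0 < τ := by positivity
  have hτe : τ * e < δ := by
    calc τ * e ≤ δ / (2 * e) * e := by gcongr; exact min_le_right _ _
      _ = δ / 2 := by field_simp
      _ < δ := NNReal.half_lt_self hδ.ne'
  set r : ℝ≥0 := max 1 ((D + 1) / e) with hr
  have hr1 : 1 ≤ r := le_max_left _ _
  have hre : D < r * e := by
    calc D < D + 1 := by simp
      _ = (D + 1) / e * e := by field_simp
      _ ≤ r * e := by gcongr; exact le_max_right _ _
  refine ⟨c / r ^ N, (τ ^ N)⁻¹, by positivity, fun n => ⟨?_, ?_⟩⟩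
  · have h1 : ¬ sqMod μ p (fun j => u (j + n)) 1 (fun _ => ((r : ℝ) : 𝕜)) ≤ c := fun hle => by
      have := (H _ (hmono n) 1 (fun _ => ((r : ℝ) : 𝕜))).2 hle
      rw [hq, ENNReal.coe_le_coe] at this
      exact absurd hre (not_lt.2 this)
    rw [hs, not_le] at h1
    rw [ENNReal.coe_div (by positivity)]
    refine ENNReal.div_le_of_le_mul (h1.le.trans ?_)
    rw [mul_comm, ← lintegral_const_mul' _ _ (by simp)]
    refine lintegral_mono fun ω => ?_
    gcongr
    rw [ENNReal.coe_pow, ← ENNReal.rpow_natCast]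
    exact ENNReal.rpow_le_rpow_of_exponent_le (by exact_mod_cast hr1) (hN ω)
  · have h1 := (H _ (hmono n) 1 (fun _ => ((τ : ℝ) : 𝕜))).1 (by
      rw [hq]; exact_mod_cast hτe)
    rw [hs] at h1
    rw [ENNReal.coe_inv (by positivity), ← one_div, ENNReal.le_div_iff_mul_le
      (Or.inl (by simp [hτ0.ne'])) (Or.inl (by simp)), mul_comm,
      ← lintegral_const_mul' _ _ (by simp)]
    refine (lintegral_mono fun ω => ?_).trans h1
    gcongr
    rw [ENNReal.coe_pow, ← ENNReal.rpow_natCast]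
    exact ENNReal.rpow_le_rpow_of_exponent_ge (by exact_mod_cast min_le_left _ _) (hN ω)

/-- Contractive factors come out squared from the modular of the square function. -/
theorem sqMod_smul_le (hp : ∀ ω, 2 ≤ p ω) {σ : ℝ≥0} (hσ : σ ≤ 1) (k : ℕ) (x : ℕ → 𝕜) :
    sqMod μ p u k (((σ : ℝ) : 𝕜) • x) ≤ σ ^ 2 * sqMod μ p u k x := by
  unfold sqMod
  rw [← lintegral_const_mul' _ _ (by simp)]
  refine lintegral_mono fun ω => ?_
  have h1 : ‖((σ : ℝ) : 𝕜)‖ₑ = σ := by rw [← ofReal_norm]; simp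
  simp only [Pi.smul_apply, enorm_smul, h1, mul_pow, mul_assoc, ← mul_sum]
  rw [ENNReal.mul_rpow_of_nonneg _ _ (by linarith [hp ω])]
  gcongr
  rw [← ENNReal.rpow_two, ← ENNReal.rpow_mul]
  exact ENNReal.rpow_le_rpow_of_exponent_ge (by exact_mod_cast hσ) (by linarith [hp ω])

/-- Jensen's inequality for weights of sum at most one. -/
theorem rpow_sum_mul_le {ι : Type*} {s : Finset ι} {a : ι → ℝ≥0∞} (ha : ∑ i ∈ s, a i ≤ 1)
    (z : ι → ℝ≥0∞) {q : ℝ} (hq : 1 ≤ q) :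
    (∑ i ∈ s, a i * z i) ^ q ≤ ∑ i ∈ s, a i * z i ^ q := by
  set A := ∑ i ∈ s, a i with hA
  rcases eq_or_ne A 0 with h | h
  · have h0 : ∀ i ∈ s, a i = 0 := by simpa [hA] using h
    rw [sum_eq_zero fun i hi => by rw [h0 i hi, zero_mul], ENNReal.zero_rpow_of_pos (by linarith)]
    exact bot_le
  · have hAt : A ≠ ⊤ := (ha.trans_lt ENNReal.one_lt_top).ne
    have hJ := ENNReal.rpow_arith_mean_le_arith_mean_rpow s (fun i => A⁻¹ * a i) z (by
      rw [← mul_sum, ← hA, ENNReal.inv_mul_cancel h hAt]) hq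
    simp only [mul_assoc, ← mul_sum] at hJ
    calc (∑ i ∈ s, a i * z i) ^ q = (A * (A⁻¹ * ∑ i ∈ s, a i * z i)) ^ q := by
          rw [← mul_assoc, ENNReal.mul_inv_cancel h hAt, one_mul]
      _ = A ^ q * (A⁻¹ * ∑ i ∈ s, a i * z i) ^ q := ENNReal.mul_rpow_of_nonneg _ _ (by linarith)
      _ ≤ A ^ (1 : ℝ) * (A⁻¹ * ∑ i ∈ s, a i * z i ^ q) := by
          exact mul_le_mul' (ENNReal.rpow_le_rpow_of_exponent_ge ha hq) hJ
      _ = ∑ i ∈ s, a i * z i ^ q := by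
          rw [ENNReal.rpow_one, ← mul_assoc, ENNReal.mul_inv_cancel h hAt, one_mul]

/-- If `u` does not vanish locally in the mean, then `S = ℓ_2`. -/
theorem SqControl.eqLp_two (H : SqControl S μ p u δ c D) (hδ : 0 < δ) (hc : 0 < c)
    (hu : ∀ n, Measurable (u n))
    {N : ℕ} (hpm : Measurable p) (hp : ∀ ω, 2 ≤ p ω) (hN : ∀ ω, p ω ≤ N) {ν : Measure Ω}
    [IsFiniteMeasure ν] (hν : ν ≤ μ) {ε : ℝ≥0} (hε : 0 < ε)
    (hfr : ∃ᶠ n in atTop, ε ≤ ∫⁻ ω, u n ω ∂ν) : S.EqLp 2 := by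
  -- The lower estimate uses this subsequence, the upper one all of `u`; both are legitimate because
  -- the control holds for every increasing `π`.
  obtain ⟨π, hπ, hπε⟩ := extraction_of_frequently_atTop hfr
  obtain ⟨α, β, -, hαβ⟩ := H.exists_bounds hδ hc hp hN
  obtain ⟨C, hC⟩ := S.exists_qnorm_le_of_trunc
  have hL : ∀ x : ℕ → 𝕜, eLpNorm x 2 Measure.count = (∑' n, ‖x n‖ₑ ^ 2) ^ (1 / 2 : ℝ) := by
    intro x
    rw [eLpNorm_eq_lintegral_rpow_enorm_toReal (by simp) (by simp), lintegral_count]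
    simp
  have hLh : ∀ (t : ℝ≥0) (x : ℕ → 𝕜), eLpNorm (((t : ℝ) : 𝕜) • x) 2 Measure.count
      = t * eLpNorm x 2 Measure.count := by
    intro t x
    rw [eLpNorm_const_smul]
    congr 1
    rw [← ofReal_norm]
    simp
  have lower : ∀ x : ℕ → 𝕜, S.qnorm x < δ → eLpNorm x 2 Measure.count
      ≤ ((((ν Set.univ).toNNReal + 1) / ε) ^ (1 / 2 : ℝ) : ℝ≥0) := by
    intro x hx
    rw [hL, ENNReal.coe_rpow_of_nonneg _ (by norm_num)]
    refine ENNReal.rpow_le_rpow ?_ (by norm_num)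
    refine ENNReal.tsum_le_of_sum_range_le fun k => ?_
    have h1 := (H π hπ k x).1 ((S.qnorm_trunc_le k x).trans_lt hx)
    rw [ENNReal.coe_div hε.ne', ENNReal.le_div_iff_mul_le (Or.inl (by simpa using hε.ne'))
      (Or.inl (by simp))]
    calc (∑ j ∈ range k, ‖x j‖ₑ ^ 2) * ε
        ≤ ∑ j ∈ range k, ‖x j‖ₑ ^ 2 * ∫⁻ ω, u (π j) ω ∂ν := by
          rw [sum_mul]
          gcongr with j _
          exact hπε j
      _ = ∫⁻ ω, ∑ j ∈ range k, ‖x j‖ₑ ^ 2 * u (π j) ω ∂ν := by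
          rw [lintegral_finsetSum _ fun j _ => by have := hu (π j); fun_prop]
          exact sum_congr rfl fun j _ => (lintegral_const_mul' _ _ (by simp)).symm
      _ ≤ ∫⁻ ω, 1 + (∑ j ∈ range k, ‖x j‖ₑ ^ 2 * u (π j) ω) ^ (p ω / 2) ∂ν := by
          -- Pointwise `h ≤ 1 + h ^ (p / 2)`, since `p ≥ 2`; finiteness of `ν` absorbs the `1`.
          refine lintegral_mono fun ω => ?_
          set h := ∑ j ∈ range k, ‖x j‖ₑ ^ 2 * (u (π j) ω : ℝ≥0∞)
          rcases le_total h 1 with h1 | h1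
          · exact h1.trans le_self_add
          · refine le_trans ?_ le_add_self
            calc h = h ^ (1 : ℝ) := (ENNReal.rpow_one h).symm
              _ ≤ _ := ENNReal.rpow_le_rpow_of_exponent_le h1 (by linarith [hp ω])
      _ = ν Set.univ + ∫⁻ ω, (∑ j ∈ range k, ‖x j‖ₑ ^ 2 * u (π j) ω) ^ (p ω / 2) ∂ν := by
          rw [lintegral_add_left measurable_const]
          simp
      _ ≤ ν Set.univ + sqMod μ p (fun n => u (π n)) k x := by
          gcongr
          exact lintegral_mono' hν le_rfl
      _ ≤ ((ν Set.univ).toNNReal + 1 : ℝ≥0) := by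
          rw [ENNReal.coe_add, ENNReal.coe_toNNReal (measure_ne_top _ _)]
          gcongr
          simpa using h1
  -- Jensen's inequality with the weights `|x j| ^ 2`.
  have hJ : ∀ (k : ℕ) (x : ℕ → 𝕜), ∑ j ∈ range k, ‖x j‖ₑ ^ 2 ≤ 1 → sqMod μ p u k x ≤ β := by
    intro k x hx
    unfold sqMod
    calc _ ≤ ∫⁻ ω, ∑ j ∈ range k, ‖x j‖ₑ ^ 2 * (u j ω : ℝ≥0∞) ^ (p ω / 2) ∂μ :=
          lintegral_mono fun ω => rpow_sum_mul_le hx _ (by linarith [hp ω])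
      _ = ∑ j ∈ range k, ‖x j‖ₑ ^ 2 * ∫⁻ ω, (u j ω : ℝ≥0∞) ^ (p ω / 2) ∂μ := by
          rw [lintegral_finsetSum _ fun j _ => by have := hu j; fun_prop]
          exact sum_congr rfl fun j _ => lintegral_const_mul' _ _ (by simp)
      _ ≤ ∑ j ∈ range k, ‖x j‖ₑ ^ 2 * (β : ℝ≥0∞) := by
          gcongr with j _
          exact (hαβ j).2
      _ ≤ 1 * β := by rw [← sum_mul]; gcongr
      _ = β := one_mul _
  set σ : ℝ≥0 := min 1 (c / (β + 1)) with hσ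
  have hσ0 : 0 < σ := by positivity
  have upper : ∀ x : ℕ → 𝕜, eLpNorm x 2 Measure.count < (1 : ℝ≥0) →
      S.qnorm x ≤ (C * (D / σ) : ℝ≥0) := by
    intro x hx
    rw [ENNReal.coe_mul]
    refine hC x _ fun k => ?_
    have h1 : ∑ j ∈ range k, ‖x j‖ₑ ^ 2 ≤ 1 := by
      refine (ENNReal.sum_le_tsum _).trans ?_
      rw [hL] at hx
      by_contra hcon
      exact absurd hx (not_lt.2 (by
        simpa using ENNReal.one_le_rpow (not_le.1 hcon).le (by norm_num : (0 : ℝ) < 1 / 2)))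
    have h2 := (H id strictMono_id k (((σ : ℝ) : 𝕜) • x)).2 (by
      refine (sqMod_smul_le hp (min_le_left _ _) k x).trans ?_
      calc (σ : ℝ≥0∞) ^ 2 * sqMod μ p u k x ≤ (σ : ℝ≥0∞) ^ 2 * (β : ℝ≥0∞) := by
            gcongr; exact hJ k x h1
        _ ≤ (c : ℝ≥0∞) := by
          rw [← ENNReal.coe_pow, ← ENNReal.coe_mul, ENNReal.coe_le_coe]
          calc σ ^ 2 * β ≤ (1 * (c / (β + 1))) * β := by
                rw [sq]; gcongr
                · exact min_le_left _ _
                · exact min_le_right _ _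
            _ ≤ (1 * (c / (β + 1))) * (β + 1) := by gcongr; simp
            _ = c := by field_simp)
    rw [trunc_smul, S.qnorm_nnreal_smul] at h2
    rw [ENNReal.coe_div hσ0.ne', ENNReal.le_div_iff_mul_le (Or.inl (by simpa using hσ0.ne'))
      (Or.inl (by simp)), mul_comm]
    exact h2
  refine ⟨(((((ν Set.univ).toNNReal + 1) / ε) ^ (1 / 2 : ℝ) + 1) / δ)⁻¹, (C * (D / σ) + 1) / 1,
    ?_, ?_, fun x => ⟨?_, le_mul_of_homogeneous hLh S.qnorm_nnreal_smul one_pos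
    upper x⟩⟩
  · positivity
  · positivity
  · have := le_mul_of_homogeneous S.qnorm_nnreal_smul hLh hδ lower x
    rw [ENNReal.coe_inv (by positivity), mul_comm, ← div_eq_mul_inv]
    exact ENNReal.div_le_of_le_mul (by rwa [mul_comm])

end Dichotomy

/-! ### Interaction terms and a Brezis-Lieb lemma. -/

section Cross

/-- The interaction term in the expansion of `(a + b) ^ q`. -/
def cross (q : ℝ) (a b : ℝ≥0∞) : ℝ≥0∞ := min a b * max a b ^ (q - 1)

theorem cross_mono {q : ℝ} (hq : 1 ≤ q) {a a' b b' : ℝ≥0∞} (ha : a ≤ a') (hb : b ≤ b') :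
    cross q a b ≤ cross q a' b' :=
  mul_le_mul' (min_le_min ha hb)
    (ENNReal.rpow_le_rpow (max_le_max ha hb) (by linarith))

theorem cross_comm (q : ℝ) (a b : ℝ≥0∞) : cross q a b = cross q b a := by
  rw [cross, cross, min_comm, max_comm]

/-- By convexity, `t ^ q` lies below its chord on `[1,2]`. -/
theorem one_add_rpow_le {x q : ℝ} (hx : 0 ≤ x) (hx1 : x ≤ 1) (hq : 1 ≤ q) :
    (1 + x) ^ q ≤ 1 + 2 ^ q * x := by
  have h := (convexOn_rpow hq).2 (Set.mem_Ici.2 zero_le_one) (Set.mem_Ici.2 zero_le_two)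
    (by linarith : 0 ≤ 1 - x) hx (by ring)
  simp only [smul_eq_mul, Real.one_rpow] at h
  calc (1 + x) ^ q = ((1 - x) * 1 + x * 2) ^ q := by ring_nf
    _ ≤ _ := h
    _ ≤ _ := by linarith

theorem mul_rpow_sub_one {a : ℝ≥0∞} (ha : a ≠ ⊤) {q : ℝ} (hq : 1 ≤ q) :
    a * a ^ (q - 1) = a ^ q := by
  rcases eq_or_ne a 0 with rfl | h
  · rw [zero_mul, ENNReal.zero_rpow_of_pos (by linarith)]
  · calc a * a ^ (q - 1) = a ^ (1 : ℝ) * a ^ (q - 1) := by rw [ENNReal.rpow_one]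
      _ = a ^ q := by rw [← ENNReal.rpow_add _ _ h ha]; congr 1; ring

/-- Factor out the larger of `a` and `b` and apply `one_add_rpow_le` to their ratio. -/
theorem add_rpow_le_cross {N : ℕ} {q : ℝ} (hq : 1 ≤ q) (hN : q ≤ N) {a b : ℝ≥0∞} (ha : a ≠ ⊤)
    (hb : b ≠ ⊤) : (a + b) ^ q ≤ a ^ q + b ^ q + 2 ^ N * cross q a b := by
  wlog hab : a ≤ b generalizing a b
  · rw [add_comm a, add_comm (a ^ q), cross_comm]
    exact this hb ha (le_of_not_ge hab)
  rcases eq_or_ne b 0 with h0 | h0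
  · have : a = 0 := le_antisymm (h0 ▸ hab) bot_le
    simp [this, h0, ENNReal.zero_rpow_of_pos (by linarith : 0 < q)]
  lift a to ℝ≥0 using ha
  lift b to ℝ≥0 using hb
  have hb0 : 0 < b := pos_iff_ne_zero.2 (by simpa using h0)
  have hab' : a ≤ b := by exact_mod_cast hab
  have key : (a + b) ^ q ≤ b ^ q + 2 ^ q * (a * b ^ (q - 1)) := by
    have h1 := one_add_rpow_le (x := a / b) (by positivity)
      (div_le_one_of_le₀ (by exact_mod_cast hab') b.2) hq
    have h2 : (1 + a / b : ℝ≥0) ^ q ≤ 1 + 2 ^ q * (a / b) := by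
      rw [← NNReal.coe_le_coe]
      push_cast
      exact h1
    calc (a + b) ^ q = (b * (1 + a / b)) ^ q := by
          congr 1
          rw [mul_add, mul_one, mul_div_cancel₀ _ hb0.ne', add_comm]
      _ = b ^ q * (1 + a / b) ^ q := NNReal.mul_rpow ..
      _ ≤ b ^ q * (1 + 2 ^ q * (a / b)) := by gcongr
      _ = b ^ q + 2 ^ q * (a * b ^ (q - 1)) := by
          rw [NNReal.rpow_sub_one hb0.ne']
          ring
  have hq0 : 0 ≤ q := by linarith
  have h3 : (a + b : ℝ≥0∞) ^ q ≤ b ^ q + 2 ^ q * (a * b ^ (q - 1)) := by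
    have h := ENNReal.coe_le_coe.2 key
    simpa only [ENNReal.coe_rpow_of_nonneg _ hq0,
      ENNReal.coe_rpow_of_nonneg _ (by linarith : 0 ≤ q - 1), ENNReal.coe_add,
      ENNReal.coe_mul, ENNReal.coe_ofNat] using h
  refine h3.trans ?_
  rw [cross, min_eq_left hab, max_eq_right hab]
  refine add_le_add le_add_self (mul_le_mul' ?_ le_rfl)
  rw [← ENNReal.rpow_natCast]
  exact ENNReal.rpow_le_rpow_of_exponent_le (by norm_num) hN

variable {Ω : Type*} [MeasurableSpace Ω] {μ : Measure Ω}

/-- A Brezis-Lieb type lemma: the interaction of a fixed function with a bounded sequence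
converging to zero almost everywhere tends to zero. -/
theorem tendsto_lintegral_cross {q : Ω → ℝ} {N : ℕ} (hqm : Measurable q) (hq : ∀ ω, 1 ≤ q ω)
    (hN : ∀ ω, q ω ≤ N) {H : Ω → ℝ≥0} {v : ℕ → Ω → ℝ≥0} (hH : Measurable H)
    (hv : ∀ n, Measurable (v n)) (hHi : ∫⁻ ω, (H ω : ℝ≥0∞) ^ q ω ∂μ < ⊤) {β : ℝ≥0}
    (hβ : ∀ n, ∫⁻ ω, (v n ω : ℝ≥0∞) ^ q ω ∂μ ≤ β)
    (hlim : ∀ᵐ ω ∂μ, Tendsto (fun n => v n ω) atTop (𝓝 0)) :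
    Tendsto (fun n => ∫⁻ ω, cross (q ω) (H ω) (v n ω) ∂μ) atTop (𝓝 0) := by
  rw [ENNReal.tendsto_nhds_zero]
  intro η hη
  obtain ⟨ε, hε0, hε1, hεη⟩ : ∃ ε : ℝ≥0, 0 < ε ∧ ε ≤ 1 ∧ (ε * β : ℝ≥0∞) ≤ η / 2 := by
    have hη2 : 0 < η / 2 := ENNReal.half_pos hη.ne'
    rcases eq_or_ne (η / 2) ⊤ with h | h
    · exact ⟨1, one_pos, le_rfl, by rw [h]; exact le_top⟩
    · refine ⟨min 1 ((η / 2).toNNReal / (β + 1)), ?_, min_le_left _ _, ?_⟩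
      · have : 0 < (η / 2).toNNReal := ENNReal.toNNReal_pos hη2.ne' h
        positivity
      · conv_rhs => rw [← ENNReal.coe_toNNReal h]
        rw [← ENNReal.coe_mul, ENNReal.coe_le_coe]
        calc _ ≤ (η / 2).toNNReal / (β + 1) * (β + 1) := by
              gcongr
              · exact min_le_right _ _
              · simp
          _ = _ := by field_simp
  -- Split at `H = ε * v n`. Where `H ≤ ε * v n`, the interaction is at most `ε * v n ^ q`, of
  -- integral at most `ε * β`. Elsewhere it is at most `ε⁻¹ ^ N * H ^ q`, so dominated convergence
  -- applies.
  let g : ℕ → Ω → ℝ≥0∞ := fun n =>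
    Set.indicator {ω | ε * v n ω < H ω} fun ω => cross (q ω) (H ω) (v n ω)
  have hcm : ∀ n, Measurable fun ω => cross (q ω) (H ω) (v n ω) := fun n => by
    have := hv n
    unfold cross
    fun_prop
  have hgm : ∀ n, Measurable (g n) := fun n =>
    (hcm n).indicator (measurableSet_lt ((hv n).const_mul ε) hH)
  have hsplit : ∀ n ω, cross (q ω) (H ω) (v n ω) ≤ ε * (v n ω : ℝ≥0∞) ^ q ω + g n ω := by
    intro n ω
    by_cases h : ε * v n ω < H ω
    · simp only [g, Set.indicator, Set.mem_ofPred_eq, h, if_true]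
      exact le_add_self
    · refine le_trans ?_ le_self_add
      have h1 : (H ω : ℝ≥0∞) ≤ ε * v n ω := by exact_mod_cast not_lt.1 h
      have h2 : (H ω : ℝ≥0∞) ≤ v n ω :=
        h1.trans (mul_le_of_le_one_left' (by exact_mod_cast hε1))
      rw [cross, min_eq_left h2, max_eq_right h2, ← mul_rpow_sub_one (by simp) (hq ω), ← mul_assoc]
      gcongr
  have hdom : ∀ n ω, g n ω ≤ (ε⁻¹ : ℝ≥0) ^ N * (H ω : ℝ≥0∞) ^ q ω := by
    intro n ω
    by_cases h : ε * v n ω < H ω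
    · simp only [g, Set.indicator, Set.mem_ofPred_eq, h, if_true]
      have hi1 : 1 ≤ ε⁻¹ := (one_le_inv₀ hε0).2 hε1
      have h1 : (max (H ω : ℝ≥0∞) (v n ω)) ≤ (ε⁻¹ : ℝ≥0) * H ω := by
        refine max_le ?_ ?_
        · exact_mod_cast le_mul_of_one_le_left' hi1
        · rw [← ENNReal.coe_mul, ENNReal.coe_le_coe, le_inv_mul_iff₀ hε0]
          exact h.le
      calc cross (q ω) (H ω) (v n ω)
          ≤ H ω * ((ε⁻¹ : ℝ≥0) * H ω) ^ (q ω - 1) :=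
            mul_le_mul' (min_le_left _ _) (ENNReal.rpow_le_rpow h1 (by linarith [hq ω]))
        _ = (ε⁻¹ : ℝ≥0) ^ (q ω - 1) * (H ω * (H ω : ℝ≥0∞) ^ (q ω - 1)) := by
            rw [ENNReal.mul_rpow_of_nonneg _ _ (by linarith [hq ω])]
            ring
        _ ≤ _ := by
            rw [mul_rpow_sub_one (by simp) (hq ω)]
            gcongr
            rw [← ENNReal.rpow_natCast]
            exact ENNReal.rpow_le_rpow_of_exponent_le (by exact_mod_cast hi1)
              (by linarith [hN ω])
    · simp only [g, Set.indicator, Set.mem_ofPred_eq, h, if_false]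
      exact bot_le
  have hg0 : Tendsto (fun n => ∫⁻ ω, g n ω ∂μ) atTop (𝓝 0) := by
    have := tendsto_lintegral_of_dominated_convergence (μ := μ) (f := fun _ => 0) (F := g)
      (fun ω => (ε⁻¹ : ℝ≥0) ^ N * (H ω : ℝ≥0∞) ^ q ω) hgm (fun n => ae_of_all _ (hdom n))
      (by
        rw [lintegral_const_mul' _ _ (by simp)]
        exact (ENNReal.mul_lt_top (by simp) hHi).ne) (by
        filter_upwards [hlim] with ω hω
        have hup : Tendsto (fun n => (v n ω : ℝ≥0∞) * (max (H ω) 1 : ℝ≥0) ^ (q ω - 1)) atTop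
            (𝓝 0) := by
          have h1 : Tendsto (fun n => (v n ω : ℝ≥0∞)) atTop (𝓝 0) :=
            ENNReal.tendsto_coe.2 hω
          have h2 := ENNReal.Tendsto.mul_const (b := ((max (H ω) 1 : ℝ≥0) : ℝ≥0∞) ^ (q ω - 1)) h1
            (Or.inr (ENNReal.rpow_ne_top_of_nonneg (by linarith [hq ω]) (by simp)))
          simpa using h2
        refine tendsto_of_tendsto_of_tendsto_of_le_of_le' tendsto_const_nhds hup
          (Eventually.of_forall fun _ => bot_le) ?_
        filter_upwards [hω.eventually_lt_const one_pos] with n hn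
        refine (Set.indicator_le_self _ _ ω).trans ?_
        refine mul_le_mul' (min_le_right _ _) (ENNReal.rpow_le_rpow ?_ (by linarith [hq ω]))
        have : (max (H ω : ℝ≥0∞) (v n ω)) ≤ max (H ω : ℝ≥0∞) 1 :=
          max_le_max le_rfl (by exact_mod_cast hn.le)
        exact_mod_cast this)
    simpa using this
  have hev := (ENNReal.tendsto_nhds_zero.1 hg0) (η / 2) (ENNReal.half_pos hη.ne')
  filter_upwards [hev] with n hn
  calc ∫⁻ ω, cross (q ω) (H ω) (v n ω) ∂μ
      ≤ ∫⁻ ω, ε * (v n ω : ℝ≥0∞) ^ q ω + g n ω ∂μ := lintegral_mono (hsplit n)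
    _ = ε * ∫⁻ ω, (v n ω : ℝ≥0∞) ^ q ω ∂μ + ∫⁻ ω, g n ω ∂μ := by
        rw [lintegral_add_right _ (hgm n), lintegral_const_mul' _ _ (by simp)]
    _ ≤ ε * β + η / 2 := by gcongr; exact hβ n
    _ ≤ η / 2 + η / 2 := by gcongr
    _ = η := ENNReal.add_halves η

end Cross

/-! ### Modulars as averages of power functions. -/

section Averages

variable {Ω : Type*} [MeasurableSpace Ω] {μ : Measure Ω}

theorem norm_psiPath_le {q : ℝ} (hq : 2 ≤ q) : ‖psiPath q‖ ≤ 1 := by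
  refine (ContinuousMap.norm_le _ zero_le_one).2 fun t => ?_
  have h0 := t.2.1
  rw [psiPath_apply hq, Real.norm_of_nonneg (by positivity)]
  rw [div_le_one (by linarith)]
  exact (Real.rpow_le_one h0 t.2.2 (by linarith)).trans (by linarith)

/-- The modulars of the multiples of a function are given by a member of `𝒦(R)`. -/
theorem exists_KSet_modular {R : Set ℝ≥0∞} {p : Ω → ℝ} {N : ℕ} (hpm : Measurable p)
    (hp : ∀ ω, 2 ≤ p ω) (hN : ∀ ω, p ω ≤ N) (hR : ∀ᵐ ω ∂μ, ENNReal.ofReal (p ω) ∈ R)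
    {v : Ω → ℝ≥0} (hv : Measurable v) {α β : ℝ≥0} (hα0 : 0 < α)
    (hα : α ≤ ∫⁻ ω, (v ω : ℝ≥0∞) ^ (p ω / 2) ∂μ) (hβ : ∫⁻ ω, (v ω : ℝ≥0∞) ^ (p ω / 2) ∂μ ≤ β) :
    ∃ φ ∈ KSet R, ∃ m : ℝ≥0, α ≤ m ∧ m ≤ N * β ∧ ∀ s : ℝ≥0, s ≤ 1 →
      ∫⁻ ω, ((s : ℝ≥0∞) ^ 2 * v ω) ^ (p ω / 2) ∂μ = m * extFun φ s := by
  have hdm : Measurable fun ω => ENNReal.ofReal (p ω) * (v ω : ℝ≥0∞) ^ (p ω / 2) := by fun_prop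
  -- The factor `p` in the density cancels the denominator of `ψ_p`: the modular at `s` becomes the
  -- integral of `ψ_{p ω} (s)` against `θ`, that is, the mass of `θ` times an average.
  set θ := μ.withDensity fun ω => ENNReal.ofReal (p ω) * (v ω : ℝ≥0∞) ^ (p ω / 2) with hθ
  have hθu : θ Set.univ = ∫⁻ ω, ENNReal.ofReal (p ω) * (v ω : ℝ≥0∞) ^ (p ω / 2) ∂μ := by
    rw [hθ, withDensity_apply _ MeasurableSet.univ, setLIntegral_univ]
  have hup : θ Set.univ ≤ (N * β : ℝ≥0) := by
    rw [hθu, ENNReal.coe_mul]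
    calc _ ≤ ∫⁻ ω, ((N : ℝ≥0) : ℝ≥0∞) * (v ω : ℝ≥0∞) ^ (p ω / 2) ∂μ := by
          refine lintegral_mono fun ω => ?_
          gcongr
          rw [ENNReal.coe_natCast, ← ENNReal.ofReal_natCast]
          exact ENNReal.ofReal_le_ofReal (hN ω)
      _ = (N : ℝ≥0) * ∫⁻ ω, (v ω : ℝ≥0∞) ^ (p ω / 2) ∂μ := lintegral_const_mul' _ _ (by simp)
      _ ≤ _ := by gcongr
  have hlow : (α : ℝ≥0∞) ≤ θ Set.univ := by
    rw [hθu]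
    refine hα.trans (lintegral_mono fun ω => le_mul_of_one_le_left' ?_)
    rw [← ENNReal.ofReal_one]
    exact ENNReal.ofReal_le_ofReal (by linarith [hp ω])
  have : IsFiniteMeasure θ := ⟨hup.trans_lt ENNReal.coe_lt_top⟩
  have : NeZero θ := ⟨fun h => by
    rw [h] at hlow
    simp [hα0.ne'] at hlow⟩
  have hsm : StronglyMeasurable fun ω => psiPath (p ω) :=
    psiPath.continuous.stronglyMeasurable.comp_measurable hpm
  have hint : Integrable (fun ω => psiPath (p ω)) θ :=
    Integrable.of_bound hsm.aestronglyMeasurable 1 (ae_of_all _ fun ω => norm_psiPath_le (hp ω))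
  refine ⟨⨍ ω, psiPath (p ω) ∂θ, ?_, (θ Set.univ).toNNReal, ?_, ?_, fun s hs => ?_⟩
  · refine convex_closedConvexHull.average_mem isClosed_closedConvexHull ?_ hint
    filter_upwards [(withDensity_absolutelyContinuous μ _).ae_le hR] with ω hω
    rw [← psi_ofReal (hp ω)]
    exact subset_closedConvexHull ⟨_, hω, rfl⟩
  · rw [← ENNReal.coe_le_coe, ENNReal.coe_toNNReal (measure_ne_top _ _)]
    exact hlow
  · rw [← ENNReal.coe_le_coe, ENNReal.coe_toNNReal (measure_ne_top _ _)]
    exact hup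
  · rw [extFun_of_le _ hs]
    set t : unitInterval := ⟨s, s.coe_nonneg, by exact_mod_cast hs⟩ with ht
    have hev : (⨍ ω, psiPath (p ω) ∂θ) t = (θ.real Set.univ)⁻¹ * ∫ ω, psiPath (p ω) t ∂θ := by
      rw [average_eq, ContinuousMap.smul_apply, smul_eq_mul]
      congr 1
      exact (ContinuousLinearMap.integral_comp_comm (ContinuousMap.evalCLM ℝ t) hint).symm
    have hr0 : θ.real Set.univ ≠ 0 := measureReal_univ_ne_zero
    have hnn : ∀ ω, 0 ≤ psiPath (p ω) t := fun ω => by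
      rw [psiPath_apply (hp ω)]
      have := t.2.1
      have := hp ω
      positivity
    have hmt : Measurable fun ω => psiPath (p ω) t := by
      have h1 : Continuous fun q : ℝ => psiPath q t := by fun_prop
      exact h1.measurable.comp hpm
    have hint' : Integrable (fun ω => psiPath (p ω) t) θ :=
      Integrable.of_bound hmt.aestronglyMeasurable 1 (ae_of_all _ fun ω =>
        (ContinuousMap.norm_coe_le_norm _ _).trans (norm_psiPath_le (hp ω)))
    have h1 : ((θ Set.univ).toNNReal : ℝ≥0∞) * ENNReal.ofReal ((⨍ ω, psiPath (p ω) ∂θ) t)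
        = ∫⁻ ω, ENNReal.ofReal (psiPath (p ω) t) ∂θ := by
      rw [← ofReal_integral_eq_lintegral_ofReal hint' (ae_of_all _ hnn), hev,
        ENNReal.coe_toNNReal (measure_ne_top _ _), ← ofReal_measureReal,
        ← ENNReal.ofReal_mul measureReal_nonneg, ← mul_assoc, mul_inv_cancel₀ hr0, one_mul]
    rw [h1, hθ, lintegral_withDensity_eq_lintegral_mul _ hdm]
    · refine lintegral_congr fun ω => ?_
      have h2 := hp ω
      rw [Pi.mul_apply, psiPath_apply h2, ENNReal.mul_rpow_of_nonneg _ _ (by linarith),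
        ← ENNReal.rpow_two, ← ENNReal.rpow_mul, show (2 : ℝ) * (p ω / 2) = p ω by ring,
        ENNReal.ofReal_div_of_pos (by linarith),
        ← ENNReal.ofReal_rpow_of_nonneg s.coe_nonneg (by linarith), ENNReal.ofReal_coe_nnreal]
      have h3 : ENNReal.ofReal (p ω) ≠ 0 := by
        simpa using (by linarith : 0 < p ω)
      rw [mul_right_comm, ENNReal.mul_div_cancel h3 (by simp)]
    · exact hmt.ennreal_ofReal

end Averages

/-! ### Recognising Orlicz sequence spaces. -/

section OrliczSpaces

variable {𝕜 : Type*} [RCLike 𝕜]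

theorem modular_count (F : ℝ≥0 → ℝ≥0∞) (g : ℕ → ℝ≥0) :
    modular Measure.count (fun _ => F) g = ∑' n, F (g n) := lintegral_count _

/-- A function on `[0,1]`, continued by `∞` to `[0,∞)`. -/
def topExt (φ : C(unitInterval, ℝ)) (s : ℝ≥0) : ℝ≥0∞ := if s ≤ 1 then extFun φ s else ⊤

variable {R : Set ℝ≥0∞} {N : ℕ}
  (hR : ∀ r ∈ R, ∃ s : ℝ, 2 ≤ s ∧ s ≤ N ∧ r = ENNReal.ofReal s)

include hR

theorem isOrlicz_topExt {φ : C(unitInterval, ℝ)} (hφ : φ ∈ KSet R) : IsOrlicz (topExt φ) where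
  mono := by
    intro s t hst
    by_cases ht : t ≤ 1
    · simp only [topExt, ht, hst.trans ht, if_true]
      exact extFun_mono hR hφ hst
    · simp [topExt, ht]
  leftCont := by
    intro t
    by_cases ht : t ≤ 1
    · refine (continuous_extFun φ).continuousWithinAt.congr (fun s hs => ?_) ?_
      · simp [topExt, (Set.mem_Iic.1 hs).trans ht]
      · simp [topExt, ht]
    · refine ContinuousAt.continuousWithinAt ?_
      refine (continuousAt_const (y := (⊤ : ℝ≥0∞))).congr ?_
      filter_upwards [lt_mem_nhds (not_le.1 ht)] with s hs
      simp [topExt, hs]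
  tendsto_zero := by
    have h := (continuous_extFun φ).tendsto 0
    rw [extFun_zero hR hφ] at h
    refine (h.mono_left nhdsWithin_le_nhds).congr' ?_
    filter_upwards [nhdsWithin_le_nhds (gt_mem_nhds one_pos)] with s hs
    simp [topExt, le_of_lt hs]
  pos_infty := ⟨2, by simp [topExt]⟩

theorem topExt_mem_OSet {φ : C(unitInterval, ℝ)} (hφ : φ ∈ KSet R) : topExt φ ∈ OSet R := by
  refine ⟨isOrlicz_topExt hR hφ, 1, one_pos, le_rfl, φ, hφ, 1, 1, one_pos, one_pos, fun t _ => ?_⟩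
  have : Real.toNNReal t ≤ 1 := Real.toNNReal_le_one.2 t.2.2
  simp [topExt, this, extFun_coe]

theorem topExt_mul_le {φ : C(unitInterval, ℝ)} (hφ : φ ∈ KSet R) {σ : ℝ≥0} (hσ0 : 0 < σ)
    (hσ : σ ≤ 1) (s : ℝ≥0) : topExt φ (σ * s) ≤ σ ^ 2 * topExt φ s := by
  by_cases hs : s ≤ 1
  · simp only [topExt, hs, mul_le_one' hσ hs, if_true]
    exact extFun_mul_le hR hφ hσ hs
  · simp only [topExt, hs, if_false]
    rw [ENNReal.mul_top (by simpa using hσ0.ne')]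
    exact le_top

/-- A criterion for `S = ℓ_F` in terms of the modular. -/
theorem SequenceSpace.eqOrlicz_topExt (S : SequenceSpace 𝕜) {φ : C(unitInterval, ℝ)}
    (hφ : φ ∈ KSet R) {δ C D : ℝ≥0} (hδ : 0 < δ)
    (hi : ∀ x : ℕ → 𝕜, S.qnorm x < δ → (∀ n, ‖x n‖₊ ≤ 1) ∧ ∑' n, extFun φ ‖x n‖₊ ≤ C)
    (hii : ∀ x : ℕ → 𝕜, (∀ n, ‖x n‖₊ ≤ 1) → ∑' n, extFun φ ‖x n‖₊ ≤ 1 → S.qnorm x ≤ D) :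
    S.EqOrlicz (topExt φ) := by
  set m : (ℕ → 𝕜) → ℝ≥0∞ := fun x => ∑' n, topExt φ ‖x n‖₊ with hm
  have hmod : ∀ (t : ℝ≥0) (x : ℕ → 𝕜), modular Measure.count (fun _ => topExt φ)
      (fun n => t * ‖x n‖₊) = m (((t : ℝ) : 𝕜) • x) := by
    intro t x
    rw [modular_count]
    simp [hm, nnnorm_smul]
  have hms : ∀ (σ : ℝ≥0) (x : ℕ → 𝕜), 0 < σ → σ ≤ 1 →
      m (((σ : ℝ) : 𝕜) • x) ≤ σ ^ 2 * m x := by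
    intro σ x h0 h1
    simp only [hm]
    rw [← ENNReal.tsum_mul_left]
    refine ENNReal.tsum_le_tsum fun n => ?_
    rw [Pi.smul_apply, nnnorm_smul]
    simpa using topExt_mul_le hR hφ h0 h1 ‖x n‖₊
  have hI : ∀ x, S.qnorm x < δ → m x ≤ C := by
    intro x hx
    obtain ⟨h1, h2⟩ := hi x hx
    simpa [hm, topExt, h1] using h2
  have hII : ∀ x, m x ≤ 1 → S.qnorm x ≤ D := by
    intro x hx
    have h1 : ∀ n, ‖x n‖₊ ≤ 1 := by
      intro n
      by_contra h
      have := (ENNReal.le_tsum n).trans hx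
      simp [topExt, h] at this
    exact hii x h1 (by simpa [hm, topExt, h1] using hx)
  -- The bound `C` becomes an arbitrary `ε`: a contraction by `σ` gains `σ ^ 2`, and the radius `δ *
  -- (σ / t)` makes room for it and for the dilation by `t`.
  have hI' : ∀ t : ℝ≥0, 0 < t → ∀ ε : ℝ≥0∞, 0 < ε → ∃ δ' : ℝ≥0, 0 < δ' ∧
      ∀ x, S.qnorm x < δ' → m (((t : ℝ) : 𝕜) • x) ≤ ε := by
    intro t ht ε hε
    obtain ⟨ε', hε'0, hε'⟩ := ENNReal.lt_iff_exists_nnreal_btwn.1 hε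
    have hε'0 : 0 < ε' := by exact_mod_cast hε'0
    set σ : ℝ≥0 := min 1 (ε' / (C + 1)) with hσ
    have hσ0 : 0 < σ := by positivity
    refine ⟨δ * (σ / t), by positivity, fun x hx => ?_⟩
    have h1 : S.qnorm ((((t / σ : ℝ≥0) : ℝ) : 𝕜) • x) < δ := by
      rw [S.qnorm_nnreal_smul]
      calc _ < ((t / σ : ℝ≥0) : ℝ≥0∞) * (δ * (σ / t) : ℝ≥0) :=
            ENNReal.mul_lt_mul_right (by
              have : t / σ ≠ 0 := by positivity
              exact_mod_cast this) (by simp) hx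
        _ = δ := by
            rw [← ENNReal.coe_mul]
            congr 1
            field_simp
    have h2 := hms σ _ hσ0 (min_le_left _ _) |>.trans (mul_le_mul_right (hI _ h1) _)
    have e : (((σ : ℝ≥0) : ℝ) : 𝕜) • (((t / σ : ℝ≥0) : ℝ) : 𝕜) • x = ((t : ℝ) : 𝕜) • x := by
      rw [smul_smul, ← RCLike.ofReal_mul, ← NNReal.coe_mul, mul_div_cancel₀ _ hσ0.ne']
    rw [e] at h2
    refine h2.trans (le_trans ?_ hε'.le)
    rw [← ENNReal.coe_pow, ← ENNReal.coe_mul, ENNReal.coe_le_coe]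
    calc σ ^ 2 * C ≤ (1 * (ε' / (C + 1))) * (C + 1) := by
          rw [sq]; gcongr
          · exact min_le_left _ _
          · exact min_le_right _ _
          · simp
      _ = ε' := by field_simp
  refine ⟨fun x => ⟨fun hx => ?_, ?_⟩, le_antisymm ?_ ?_⟩
  · obtain ⟨q, hq⟩ : ∃ q : ℝ≥0, S.qnorm x = q := ⟨_, (ENNReal.coe_toNNReal (ne_of_lt hx)).symm⟩
    refine ⟨δ / (2 * (q + 1)), by positivity, ?_⟩
    rw [hmod]
    refine (hI _ ?_).trans_lt ENNReal.coe_lt_top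
    rw [S.qnorm_nnreal_smul, hq, ← ENNReal.coe_mul, ENNReal.coe_lt_coe]
    calc δ / (2 * (q + 1)) * q ≤ δ / (2 * (q + 1)) * (q + 1) := by gcongr; simp
      _ = δ / 2 := by field_simp
      _ < δ := NNReal.half_lt_self hδ.ne'
  · rintro ⟨t, ht, hlt⟩
    rw [hmod] at hlt
    obtain ⟨q, hq⟩ : ∃ q : ℝ≥0, m (((t : ℝ) : 𝕜) • x) = q :=
      ⟨_, (ENNReal.coe_toNNReal hlt.ne).symm⟩
    set σ : ℝ≥0 := min 1 (1 / (q + 1)) with hσ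
    have hσ0 : 0 < σ := by positivity
    have h1 := hII _ ((hms σ _ hσ0 (min_le_left _ _)).trans (by
      rw [hq, ← ENNReal.coe_pow, ← ENNReal.coe_mul, ENNReal.coe_le_one_iff]
      calc σ ^ 2 * q ≤ (1 * (1 / (q + 1))) * (q + 1) := by
            rw [sq]; gcongr
            · exact min_le_left _ _
            · exact min_le_right _ _
            · simp
        _ = 1 := by field_simp))
    rw [S.qnorm_nnreal_smul, S.qnorm_nnreal_smul] at h1
    by_contra hx
    have hx : S.qnorm x = ⊤ := not_lt_top_iff.1 hx
    rw [hx, ENNReal.mul_top (by simpa using ht.ne'), ENNReal.mul_top (by simpa using hσ0.ne')] at h1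
    simp at h1
  · refine le_iInf₂ fun t ht => ?_
    rw [← tendsto_iff_comap, ENNReal.tendsto_nhds_zero]
    intro ε hε
    obtain ⟨δ', hδ', h⟩ := hI' t ht ε hε
    have : ∀ᶠ x in comap S.qnorm (𝓝 0), S.qnorm x < δ' :=
      tendsto_comap.eventually_lt_const (by exact_mod_cast hδ')
    filter_upwards [this] with x hx
    rw [hmod]
    exact h x hx
  · rw [← tendsto_iff_comap, ENNReal.tendsto_nhds_zero]
    intro ε hε
    obtain ⟨ε', hε'0, hε'⟩ := ENNReal.lt_iff_exists_nnreal_btwn.1 hε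
    have hε'0 : 0 < ε' := by exact_mod_cast hε'0
    set t : ℝ≥0 := (D + 1) / ε' with ht
    have ht0 : 0 < t := by positivity
    have h1 : ∀ᶠ x in comap (fun x : ℕ → 𝕜 => modular Measure.count (fun _ => topExt φ)
        (fun n => t * ‖x n‖₊)) (𝓝 0),
        modular Measure.count (fun _ => topExt φ) (fun n => t * ‖x n‖₊) < 1 :=
      tendsto_comap.eventually_lt_const one_pos
    refine (h1.filter_mono (iInf₂_le t ht0)).mono fun x hx => ?_
    rw [hmod] at hx
    have h2 := hII _ hx.le
    rw [S.qnorm_nnreal_smul] at h2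
    refine le_trans ?_ hε'.le
    have h3 : S.qnorm x ≤ D / t := by
      rw [ENNReal.le_div_iff_mul_le (Or.inl (by simpa using ht0.ne')) (Or.inl (by simp)), mul_comm]
      exact h2
    refine h3.trans ?_
    rw [← ENNReal.coe_div ht0.ne', ENNReal.coe_le_coe, div_le_iff₀ ht0, ht]
    calc D ≤ D + 1 := by simp
      _ = ε' * ((D + 1) / ε') := by field_simp

end OrliczSpaces

/-! ### Almost disjoint sequences. -/

section DisjointCase

open Finset

/-- Relations between consecutive indices suffice later, because the relation used there involves
all functions up to the earlier index. -/
theorem exists_strictMono_chain {r : ℕ → ℕ → Prop} (h : ∀ m, ∀ᶠ n in atTop, r m n) :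
    ∃ σ : ℕ → ℕ, StrictMono σ ∧ ∀ k, r (σ k) (σ (k + 1)) := by
  choose f hf using fun m => ((h m).and (eventually_gt_atTop m)).exists
  refine ⟨fun k => f^[k] 0, strictMono_nat_of_lt_succ fun k => ?_, fun k => ?_⟩
  · rw [Function.iterate_succ_apply']
    exact (hf _).2
  · simp only [Function.iterate_succ_apply']
    exact (hf _).1

theorem sum_half_pow_le (k : ℕ) : ∑ j ∈ range k, (2⁻¹ : ℝ≥0∞) ^ j ≤ 2 := by
  refine (ENNReal.sum_le_tsum _).trans ?_
  rw [ENNReal.tsum_geometric, ENNReal.one_sub_inv_two, inv_inv]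

variable {𝕜 : Type*} [RCLike 𝕜] {Ω : Type*} [MeasurableSpace Ω] {μ : Measure Ω}
  {p : Ω → ℝ} {N : ℕ} {v : ℕ → Ω → ℝ≥0}

/-- Superadditivity of `t ^ (p / 2)`, as `p / 2 ≥ 1`; no disjointness is needed in this direction.
-/
theorem sum_modular_le_sqMod (hp : ∀ ω, 2 ≤ p ω) (hpm : Measurable p)
    (hv : ∀ n, Measurable (v n)) (k : ℕ) (x : ℕ → 𝕜) :
    ∑ j ∈ range k, ∫⁻ ω, (‖x j‖ₑ ^ 2 * v j ω) ^ (p ω / 2) ∂μ ≤ sqMod μ p v k x := by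
  induction k with
  | zero => simp
  | succ k ih =>
    rw [sum_range_succ]
    refine (add_le_add_left ih _).trans ?_
    unfold sqMod
    rw [← lintegral_add_left]
    · refine lintegral_mono fun ω => ?_
      rw [sum_range_succ]
      exact ENNReal.add_rpow_le_rpow_add _ _ (by linarith [hp ω])
    · fun_prop

/-- Adding the terms one by one costs an interaction each time. Since `|x j| ≤ 1`, it is at most the
interaction of the `v j` themselves, so the error does not depend on `x`. -/
theorem sqMod_le_sum_modular (hp : ∀ ω, 2 ≤ p ω) (hN : ∀ ω, p ω ≤ N) (hpm : Measurable p)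
    (hv : ∀ n, Measurable (v n))
    (hcr : ∀ k, ∫⁻ ω, cross (p ω / 2) (∑ j ∈ range k, v j ω : ℝ≥0) (v k ω) ∂μ ≤ 2⁻¹ ^ k)
    (k : ℕ) (x : ℕ → 𝕜) (hx : ∀ n, ‖x n‖₊ ≤ 1) :
    sqMod μ p v k x ≤ ∑ j ∈ range k, ∫⁻ ω, (‖x j‖ₑ ^ 2 * v j ω) ^ (p ω / 2) ∂μ
      + 2 ^ N * ∑ j ∈ range k, 2⁻¹ ^ j := by
  induction k with
  | zero =>
    have : ∀ ω, (0 : ℝ≥0∞) ^ (p ω / 2) = 0 := fun ω =>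
      ENNReal.zero_rpow_of_pos (by linarith [hp ω])
    simp [sqMod, this]
  | succ k ih =>
    have hx2 : ∀ j, ‖x j‖ₑ ^ 2 ≤ 1 := fun j => pow_le_one₀ bot_le (by
      rw [enorm_eq_nnnorm]; exact_mod_cast hx j)
    have h1 : sqMod μ p v (k + 1) x ≤ sqMod μ p v k x +
        ∫⁻ ω, (‖x k‖ₑ ^ 2 * v k ω) ^ (p ω / 2) ∂μ + 2 ^ N * 2⁻¹ ^ k := by
      calc sqMod μ p v (k + 1) x ≤ ∫⁻ ω, ((∑ j ∈ range k, ‖x j‖ₑ ^ 2 * v j ω) ^ (p ω / 2) +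
            (‖x k‖ₑ ^ 2 * v k ω) ^ (p ω / 2)) + 2 ^ N *
              cross (p ω / 2) (∑ j ∈ range k, v j ω : ℝ≥0) (v k ω) ∂μ := by
            refine lintegral_mono fun ω => ?_
            rw [sum_range_succ]
            refine (add_rpow_le_cross (N := N) (by linarith [hp ω])
              (by linarith [hp ω, hN ω]) ?_ ?_).trans ?_
            · exact ENNReal.sum_ne_top.2 fun j _ => ENNReal.mul_ne_top (by simp) (by simp)
            · exact ENNReal.mul_ne_top (by simp) (by simp)
            · gcongr
              refine cross_mono (by linarith [hp ω]) ?_ (mul_le_of_le_one_left' (hx2 k))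
              rw [ENNReal.ofNNReal_finsetSum]
              exact sum_le_sum fun j _ => mul_le_of_le_one_left' (hx2 j)
        _ = sqMod μ p v k x + ∫⁻ ω, (‖x k‖ₑ ^ 2 * v k ω) ^ (p ω / 2) ∂μ + 2 ^ N *
            ∫⁻ ω, cross (p ω / 2) (∑ j ∈ range k, v j ω : ℝ≥0) (v k ω) ∂μ := by
            rw [lintegral_add_left (by fun_prop), lintegral_add_left (by fun_prop),
              lintegral_const_mul' _ _ (by simp)]
            rfl
        _ ≤ _ := by gcongr; exact hcr k
    refine h1.trans ?_
    rw [sum_range_succ, sum_range_succ, mul_add]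
    calc _ ≤ (∑ j ∈ range k, ∫⁻ ω, (‖x j‖ₑ ^ 2 * v j ω) ^ (p ω / 2) ∂μ
          + 2 ^ N * ∑ j ∈ range k, 2⁻¹ ^ j) + ∫⁻ ω, (‖x k‖ₑ ^ 2 * v k ω) ^ (p ω / 2) ∂μ
          + 2 ^ N * 2⁻¹ ^ k := by gcongr
      _ = _ := by ring

theorem extFun_le_add (φ φ' : C(unitInterval, ℝ)) (s : ℝ≥0) :
    extFun φ s ≤ extFun φ' s + ENNReal.ofReal ‖φ - φ'‖ := by
  unfold extFun
  set t : unitInterval := Set.projIcc 0 1 zero_le_one (s : ℝ)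
  refine (ENNReal.ofReal_le_ofReal ?_).trans ENNReal.ofReal_add_le
  have := (le_abs_self _).trans (ContinuousMap.norm_coe_le_norm (φ - φ') t)
  rw [ContinuousMap.sub_apply] at this
  linarith

end DisjointCase

/-! ### The Orlicz case of the dichotomy. -/

section DisjointCase

open Finset

variable {𝕜 : Type*} [RCLike 𝕜] {Ω : Type*} [MeasurableSpace Ω] {μ : Measure Ω}
  {p : Ω → ℝ} {N : ℕ}

theorem lintegral_sum_rpow_lt_top (hp : ∀ ω, 2 ≤ p ω) (hN : ∀ ω, p ω ≤ N) (hpm : Measurable p)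
    {u : ℕ → Ω → ℝ≥0} (hu : ∀ n, Measurable (u n))
    (hf : ∀ n, ∫⁻ ω, (u n ω : ℝ≥0∞) ^ (p ω / 2) ∂μ < ⊤) (k : ℕ) :
    ∫⁻ ω, ((∑ j ∈ range k, u j ω : ℝ≥0) : ℝ≥0∞) ^ (p ω / 2) ∂μ < ⊤ := by
  induction k with
  | zero =>
    have : ∀ ω, (0 : ℝ≥0∞) ^ (p ω / 2) = 0 := fun ω =>
      ENNReal.zero_rpow_of_pos (by linarith [hp ω])
    simp [this]
  | succ k ih =>
    calc _ ≤ ∫⁻ ω, 2 ^ N * (((∑ j ∈ range k, u j ω : ℝ≥0) : ℝ≥0∞) ^ (p ω / 2) +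
          (u k ω : ℝ≥0∞) ^ (p ω / 2)) ∂μ := by
          refine lintegral_mono fun ω => ?_
          rw [sum_range_succ, ENNReal.coe_add]
          refine (ENNReal.rpow_add_le_mul_rpow_add_rpow _ _ (by linarith [hp ω])).trans ?_
          gcongr
          rw [← ENNReal.rpow_natCast]
          exact ENNReal.rpow_le_rpow_of_exponent_le (by norm_num) (by linarith [hp ω, hN ω])
      _ = 2 ^ N * (∫⁻ ω, ((∑ j ∈ range k, u j ω : ℝ≥0) : ℝ≥0∞) ^ (p ω / 2) ∂μ +
          ∫⁻ ω, (u k ω : ℝ≥0∞) ^ (p ω / 2) ∂μ) := by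
          rw [lintegral_const_mul' _ _ (by simp), lintegral_add_right _ (by fun_prop)]
      _ < ⊤ := ENNReal.mul_lt_top (by simp) (ENNReal.add_lt_top.2 ⟨ih, hf k⟩)

theorem exists_subseq_ae_tendsto {ν : Measure Ω} {u : ℕ → Ω → ℝ≥0} (hu : ∀ n, Measurable (u n))
    (h : Tendsto (fun n => ∫⁻ ω, u n ω ∂ν) atTop (𝓝 0)) :
    ∃ π : ℕ → ℕ, StrictMono π ∧ ∀ᵐ ω ∂ν, Tendsto (fun n => u (π n) ω) atTop (𝓝 0) := by
  have h1 : TendstoInMeasure ν (fun n ω => (u n ω : ℝ)) atTop (fun _ => 0) := by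
    refine tendstoInMeasure_of_tendsto_eLpNorm (p := 1) one_ne_zero
      (fun n => (hu n).coe_nnreal_real.aestronglyMeasurable) aestronglyMeasurable_const ?_
    refine h.congr fun n => ?_
    rw [eLpNorm_one_eq_lintegral_enorm]
    refine lintegral_congr fun ω => ?_
    simp
  obtain ⟨π, hπ, hl⟩ := h1.exists_seq_tendsto_ae
  refine ⟨π, hπ, hl.mono fun ω hω => ?_⟩
  exact NNReal.tendsto_coe.1 (by simpa using hω)

variable {S : SequenceSpace 𝕜} {u : ℕ → Ω → ℝ≥0} {δ c D : ℝ≥0}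

/-- If `u` vanishes locally in the mean, then `S` is an Orlicz space generated by a member of
`𝒪(R)`. -/
theorem SqControl.eqOrlicz (H : SqControl S μ p u δ c D) (hS : S.Subsymmetric) (hδ : 0 < δ)
    (hc : 0 < c) (hu : ∀ n, Measurable (u n)) (hpm : Measurable p) (hp : ∀ ω, 2 ≤ p ω)
    (hN : ∀ ω, p ω ≤ N) {R : Set ℝ≥0∞}
    (hR : ∀ r ∈ R, ∃ s : ℝ, 2 ≤ s ∧ s ≤ N ∧ r = ENNReal.ofReal s)
    (hpR : ∀ᵐ ω ∂μ, ENNReal.ofReal (p ω) ∈ R) {ν : Measure Ω} (hμν : μ ≪ ν)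
    (hlim : Tendsto (fun n => ∫⁻ ω, u n ω ∂ν) atTop (𝓝 0)) :
    ∃ F ∈ OSet R, S.EqOrlicz F := by
  obtain ⟨π₁, hπ₁, hae⟩ := exists_subseq_ae_tendsto hu hlim
  obtain ⟨α, β, hα, hαβ⟩ := H.exists_bounds hδ hc hp hN
  choose φ hφ m hm1 hm2 hφm using fun n => exists_KSet_modular hpm hp hN hpR (hu (π₁ n)) hα
    (hαβ (π₁ n)).1 (hαβ (π₁ n)).2
  obtain ⟨φ₀, hφ₀, π₂, hπ₂, hφl⟩ := KSet_subseq hR hφ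
  set w : ℕ → Ω → ℝ≥0 := fun n => u (π₁ (π₂ n)) with hw
  have hwm : ∀ n, Measurable (w n) := fun n => hu _
  have hwl : ∀ᵐ ω ∂μ, Tendsto (fun n => w n ω) atTop (𝓝 0) := by
    filter_upwards [hμν.ae_le hae] with ω hω using hω.comp hπ₂.tendsto_atTop
  -- After any index `k`, all late functions interact little with everything up to `k` and have `φ`
  -- close to the limit `φ₀`.
  have hev : ∀ k, ∀ᶠ n in atTop,
      ∫⁻ ω, cross (p ω / 2) (∑ j ∈ range (k + 1), w j ω : ℝ≥0) (w n ω) ∂μ ≤ 2⁻¹ ^ k ∧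
      ENNReal.ofReal ‖φ (π₂ n) - φ₀‖ ≤ 2⁻¹ ^ k := by
    intro k
    have hk : (0 : ℝ≥0∞) < 2⁻¹ ^ k := ENNReal.pow_pos (by simp) k
    have h1 := tendsto_lintegral_cross (μ := μ) (q := fun ω => p ω / 2) (N := N) (β := β)
      (H := fun ω => ∑ j ∈ range (k + 1), w j ω) (v := w) (by fun_prop)
      (fun ω => by linarith [hp ω]) (fun ω => by linarith [hp ω, hN ω]) (by fun_prop) hwm
      (lintegral_sum_rpow_lt_top hp hN hpm hwm
        (fun n => (hαβ _).2.trans_lt ENNReal.coe_lt_top) (k + 1)) (fun n => (hαβ _).2) hwl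
    have h2 : Tendsto (fun n => ENNReal.ofReal ‖φ (π₂ n) - φ₀‖) atTop (𝓝 0) := by
      have := ENNReal.tendsto_ofReal (tendsto_iff_norm_sub_tendsto_zero.1 hφl)
      simpa using this
    exact ((ENNReal.tendsto_nhds_zero.1 h1) _ hk).and ((ENNReal.tendsto_nhds_zero.1 h2) _ hk)
  obtain ⟨σ, hσ, hσr⟩ := exists_strictMono_chain hev
  have hσ' : StrictMono fun k => σ (k + 1) := fun a b hab => hσ (by omega)
  have hhalf : ∀ k, (2⁻¹ : ℝ≥0∞) ^ σ k ≤ 2⁻¹ ^ k := fun k =>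
    pow_le_pow_right_of_le_one' (by simp) (hσ.id_le k)
  -- The shift by one matters: for `j < k` the index `σ (j + 1)` of `v j` is at most `σ k`, so the
  -- sum controlled at stage `σ k` contains all of them.
  set v : ℕ → Ω → ℝ≥0 := fun k => w (σ (k + 1)) with hv
  have hvm : ∀ k, Measurable (v k) := fun k => hwm _
  have hπ : StrictMono fun k => π₁ (π₂ (σ (k + 1))) := hπ₁.comp (hπ₂.comp hσ')
  have Hv : ∀ (k : ℕ) (x : ℕ → 𝕜), (S.qnorm (trunc k x) < δ → sqMod μ p v k x ≤ 1) ∧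
    (sqMod μ p v k x ≤ c → S.qnorm (trunc k x) ≤ D) := H _ hπ
  have hcr : ∀ k, ∫⁻ ω, cross (p ω / 2) (∑ j ∈ range k, v j ω : ℝ≥0) (v k ω) ∂μ ≤ 2⁻¹ ^ k := by
    intro k
    refine le_trans (lintegral_mono fun ω => ?_) ((hσr k).1.trans (hhalf k))
    refine cross_mono (by linarith [hp ω]) ?_ le_rfl
    rw [ENNReal.coe_le_coe]
    calc ∑ j ∈ range k, v j ω = ∑ i ∈ (range k).image (fun j => σ (j + 1)), w i ω := by
          rw [sum_image fun a _ b _ hab => hσ'.injective hab]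
      _ ≤ ∑ i ∈ range (σ k + 1), w i ω := by
          refine sum_le_sum_of_subset fun i hi => ?_
          obtain ⟨j, hj, rfl⟩ := mem_image.1 hi
          have hj := mem_range.1 hj
          exact mem_range.2 (Nat.lt_succ_of_le (hσ.monotone (by omega)))
  have hmod : ∀ (x : ℕ → 𝕜) (j : ℕ), ‖x j‖₊ ≤ 1 → ∫⁻ ω, (‖x j‖ₑ ^ 2 * v j ω) ^ (p ω / 2) ∂μ
      = m (π₂ (σ (j + 1))) * extFun (φ (π₂ (σ (j + 1)))) ‖x j‖₊ := by
    intro x j hj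
    rw [← hφm _ _ hj]
    rfl
  have hup : ∀ (k : ℕ) (x : ℕ → 𝕜), (∀ n, ‖x n‖₊ ≤ 1) →
      sqMod μ p v k x ≤ N * β * ∑' n, extFun φ₀ ‖x n‖₊ + (N * β * 2 + 2 ^ N * 2) := by
    intro k x hx
    refine (sqMod_le_sum_modular hp hN hpm hvm hcr k x hx).trans ?_
    rw [← add_assoc]
    refine add_le_add ?_ (by gcongr; exact sum_half_pow_le k)
    calc _ ≤ ∑ j ∈ range k, (N * β : ℝ≥0∞) * (extFun φ₀ ‖x j‖₊ + 2⁻¹ ^ j) := by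
          refine sum_le_sum fun j _ => ?_
          rw [hmod x j (hx j)]
          refine mul_le_mul' (by exact_mod_cast hm2 _) ?_
          exact (extFun_le_add _ φ₀ _).trans (by gcongr; exact (hσr j).2.trans (hhalf j))
      _ = N * β * ∑ j ∈ range k, extFun φ₀ ‖x j‖₊ + N * β * ∑ j ∈ range k, 2⁻¹ ^ j := by
          rw [← mul_sum, sum_add_distrib, mul_add]
      _ ≤ _ := by
          gcongr
          · exact ENNReal.sum_le_tsum _
          · exact sum_half_pow_le k
  have hlow : ∀ (k : ℕ) (x : ℕ → 𝕜), (∀ n, ‖x n‖₊ ≤ 1) → sqMod μ p v k x ≤ 1 →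
      ∑ j ∈ range k, extFun φ₀ ‖x j‖₊ ≤ (α⁻¹ + 2 : ℝ≥0) := by
    intro k x hx h1
    have h2 := (sum_modular_le_sqMod hp hpm hvm k x).trans h1
    have hα' : (α : ℝ≥0∞) ≠ 0 := by simpa using hα.ne'
    have h3 : α * ∑ j ∈ range k, extFun (φ (π₂ (σ (j + 1)))) ‖x j‖₊ ≤ 1 := by
      refine le_trans ?_ h2
      rw [mul_sum]
      refine sum_le_sum fun j _ => ?_
      rw [hmod x j (hx j)]
      gcongr
      exact hm1 _
    calc _ ≤ ∑ j ∈ range k, (extFun (φ (π₂ (σ (j + 1)))) ‖x j‖₊ + 2⁻¹ ^ j) := by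
          refine sum_le_sum fun j _ => (extFun_le_add _ (φ (π₂ (σ (j + 1)))) _).trans ?_
          gcongr
          rw [norm_sub_rev]
          exact (hσr j).2.trans (hhalf j)
      _ ≤ _ := by
          rw [sum_add_distrib, ENNReal.coe_add, ENNReal.coe_inv hα.ne']
          refine add_le_add ?_ (sum_half_pow_le k)
          rw [← one_div, ENNReal.le_div_iff_mul_le (Or.inl hα') (Or.inl (by simp)), mul_comm]
          exact h3
  set e := (S.qnorm (Pi.single 0 1)).toNNReal with he
  have hee : S.qnorm (Pi.single 0 1) = e := (ENNReal.coe_toNNReal (S.unit_mem 0).ne).symm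
  have he0 : 0 < e := by
    have := S.qnorm_single_pos
    rw [hee] at this
    exact_mod_cast this
  obtain ⟨C, hC⟩ := S.exists_qnorm_le_of_trunc
  set B : ℝ≥0 := N * β * 1 + (N * β * 2 + 2 ^ N * 2) with hB
  set τ : ℝ≥0 := min 1 (c / (B + 1)) with hτ
  have hτ0 : 0 < τ := by positivity
  -- The radius is also kept below the quasi-norm `e` of a unit vector, which forces `|x n| ≤ 1`.
  refine ⟨topExt φ₀, topExt_mem_OSet hR hφ₀, S.eqOrlicz_topExt hR hφ₀ (δ := min δ e)
    (C := α⁻¹ + 2) (D := C * (D / τ)) (by positivity) (fun x hx => ?_) fun x hx1 hx => ?_⟩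
  · have h1 : S.qnorm x < δ := hx.trans_le (by exact_mod_cast min_le_left _ _)
    have h2 : S.qnorm x < e := hx.trans_le (by exact_mod_cast min_le_right _ _)
    have h3 : ∀ n, ‖x n‖₊ ≤ 1 := by
      intro n
      by_contra hcon
      have h4 := (hS.enorm_mul_le x n).trans_lt h2
      rw [hee, enorm_eq_nnnorm, ← ENNReal.coe_mul, ENNReal.coe_lt_coe] at h4
      exact absurd h4 (not_lt.2 (le_mul_of_one_le_left' (not_le.1 hcon).le))
    refine ⟨h3, ENNReal.tsum_le_of_sum_range_le fun k => hlow k x h3 ?_⟩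
    exact (Hv k x).1 ((S.qnorm_trunc_le k x).trans_lt h1)
  · rw [ENNReal.coe_mul]
    refine hC x _ fun k => ?_
    have h1 : sqMod μ p v k x ≤ B := by
      refine (hup k x hx1).trans ?_
      rw [hB]
      push_cast
      gcongr
    have h2 := (Hv k (((τ : ℝ) : 𝕜) • x)).2 (by
      refine (sqMod_smul_le hp (min_le_left _ _) k x).trans ?_
      refine (mul_le_mul_right h1 _).trans ?_
      rw [← ENNReal.coe_pow, ← ENNReal.coe_mul, ENNReal.coe_le_coe]
      calc τ ^ 2 * B ≤ (1 * (c / (B + 1))) * (B + 1) := by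
            rw [sq]; gcongr
            · exact min_le_left _ _
            · exact min_le_right _ _
            · simp
        _ = c := by field_simp)
    rw [trunc_smul, S.qnorm_nnreal_smul] at h2
    rw [ENNReal.coe_div hτ0.ne', ENNReal.le_div_iff_mul_le (Or.inl (by simpa using hτ0.ne'))
      (Or.inl (by simp)), mul_comm]
    exact h2

/-- A subsymmetric sequence space that embeds into `L_P` is `ℓ_2` or an Orlicz space. -/
theorem SequenceSpace.EmbedsInto.eqLp_or_eqOrlicz [SigmaFinite μ] {P : Ω → ℝ≥0∞}
    (hP : Measurable P) (hinf : 2 ≤ expInf μ P) (hsup : expSup μ P < ⊤) (hS : S.Subsymmetric)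
    (h : S.EmbedsInto μ P) : S.EqLp 2 ∨ ∃ F ∈ OSet (essRange μ P), S.EqOrlicz F := by
  obtain ⟨p, N, hpm, hp, hN, hPp, hPR, hR⟩ := exists_real_exponent hP hinf hsup
  obtain ⟨u, δ, c, D, hu, hδ, hc, H⟩ := S.exists_sqMod hS hpm hp hN hPp h
  obtain ⟨ν, hνf, hνμ, hμν⟩ := exists_finite_le μ
  by_cases hlim : Tendsto (fun n => ∫⁻ ω, u n ω ∂ν) atTop (𝓝 0)
  · right
    refine SqControl.eqOrlicz H hS hδ hc hu hpm hp hN hR ?_ hμν hlim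
    filter_upwards [hPp, hPR] with ω h1 h2
    rwa [← h1]
  · left
    rw [ENNReal.tendsto_nhds_zero] at hlim
    push Not at hlim
    obtain ⟨ε, hε, hfr⟩ := hlim
    obtain ⟨ε', hε'0, hε'⟩ := ENNReal.lt_iff_exists_nnreal_btwn.1 hε
    refine SqControl.eqLp_two H hδ hc hu hpm hp hN hνμ (ε := ε') (by exact_mod_cast hε'0) ?_
    exact hfr.mono fun n hn => hε'.le.trans (le_of_lt hn)

end DisjointCase

/-! ### Splitting nonatomic measure spaces. -/

section Nonatomic

variable {Ω : Type*} [MeasurableSpace Ω] {μ : Measure Ω}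

theorem Nonatomic.exists_le_half (hna : Nonatomic μ) {A : Set Ω} (hA : MeasurableSet A)
    (h0 : 0 < μ A) : ∃ B ⊆ A, MeasurableSet B ∧ 0 < μ B ∧ μ B ≤ μ A / 2 := by
  obtain ⟨B, hBA, hB, hB0, hB1⟩ := hna A hA h0
  by_cases h : μ B ≤ μ A / 2
  · exact ⟨B, hBA, hB, hB0, h⟩
  · refine ⟨A \ B, Set.sdiff_subset, hA.diff hB, hB1, ?_⟩
    by_contra h'
    have h1 := ENNReal.add_lt_add (not_le.1 h) (not_le.1 h')
    rw [ENNReal.add_halves, measure_add_sdiff hB.nullMeasurableSet,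
      Set.union_eq_self_of_subset_left hBA] at h1
    exact lt_irrefl _ h1

/-- Repeated halving inside a subset of positive finite measure. -/
theorem Nonatomic.exists_small [SigmaFinite μ] (hna : Nonatomic μ) {A : Set Ω}
    (hA : MeasurableSet A) (h0 : 0 < μ A) {ε : ℝ≥0∞} (hε : 0 < ε) :
    ∃ B ⊆ A, MeasurableSet B ∧ 0 < μ B ∧ μ B < ε := by
  obtain ⟨A', hA', hA'A, h0', hlt⟩ := Measure.exists_subset_measure_lt_top hA h0
  have key : ∀ n : ℕ, ∃ B ⊆ A', MeasurableSet B ∧ 0 < μ B ∧ μ B ≤ 2⁻¹ ^ n * μ A' := by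
    intro n
    induction n with
    | zero => exact ⟨A', subset_rfl, hA', h0', by simp⟩
    | succ n ih =>
      obtain ⟨B, hBA, hB, hB0, hB1⟩ := ih
      obtain ⟨B', hB'B, hB', hB'0, hB'1⟩ := hna.exists_le_half hB hB0
      refine ⟨B', hB'B.trans hBA, hB', hB'0, hB'1.trans ?_⟩
      rw [div_eq_mul_inv, pow_succ, mul_assoc, mul_comm (2⁻¹ : ℝ≥0∞) (μ A'), ← mul_assoc]
      gcongr
  have hlim : Tendsto (fun n : ℕ => (2⁻¹ : ℝ≥0∞) ^ n * μ A') atTop (𝓝 0) := by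
    have := ENNReal.Tendsto.mul_const (b := μ A')
      (ENNReal.tendsto_pow_atTop_nhds_zero_of_lt_one (r := 2⁻¹) (by simp)) (Or.inr hlt.ne)
    simpa using this
  obtain ⟨n, hn⟩ := (hlim.eventually_lt_const hε).exists
  obtain ⟨B, hBA, hB, hB0, hB1⟩ := key n
  exact ⟨B, hBA.trans hA'A, hB, hB0, hB1.trans_lt hn⟩

/-- Sierpiński's theorem: nonatomic measures take all intermediate values. -/
theorem Nonatomic.exists_measure_eq [SigmaFinite μ] (hna : Nonatomic μ) {A : Set Ω}
    (hA : MeasurableSet A) (hAt : μ A ≠ ⊤) {c : ℝ≥0∞} (hc : c ≤ μ A) :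
    ∃ B ⊆ A, MeasurableSet B ∧ μ B = c := by
  have hct : c ≠ ⊤ := (hc.trans_lt hAt.lt_top).ne
  -- Greedy choice: enlarge `B` by an admissible set of at least half the largest possible measure.
  have step : ∀ B : {B : Set Ω // B ⊆ A ∧ MeasurableSet B ∧ μ B ≤ c},
      ∃ B' : {B : Set Ω // B ⊆ A ∧ MeasurableSet B ∧ μ B ≤ c}, B.1 ⊆ B'.1 ∧
        ∀ C ⊆ A \ B.1, MeasurableSet C → μ B.1 + μ C ≤ c → μ B.1 + μ C / 2 ≤ μ B'.1 := by
    rintro ⟨B, hBA, hB, hBc⟩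
    set s := ⨆ C : {C : Set Ω // C ⊆ A \ B ∧ MeasurableSet C ∧ μ B + μ C ≤ c}, μ C.1 with hs
    have hle : ∀ C ⊆ A \ B, MeasurableSet C → μ B + μ C ≤ c → μ C ≤ s := fun C h1 h2 h3 =>
      le_iSup (fun C : {C : Set Ω // C ⊆ A \ B ∧ MeasurableSet C ∧ μ B + μ C ≤ c} => μ C.1)
        ⟨C, h1, h2, h3⟩
    have hsc : s ≤ c := iSup_le fun C => le_add_self.trans C.2.2.2
    obtain ⟨C, h1, h2, h3, h4⟩ : ∃ C ⊆ A \ B, MeasurableSet C ∧ μ B + μ C ≤ c ∧ s / 2 ≤ μ C := by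
      rcases eq_or_ne s 0 with h | h
      · exact ⟨∅, by simp, MeasurableSet.empty, by simpa using hBc, by simp [h]⟩
      · obtain ⟨⟨C, h1, h2, h3⟩, h4⟩ := lt_iSup_iff.1
          (ENNReal.half_lt_self h (hsc.trans_lt hct.lt_top).ne)
        exact ⟨C, h1, h2, h3, h4.le⟩
    have hU : μ (B ∪ C) = μ B + μ C :=
      measure_union (Set.disjoint_sdiff_right.mono_right h1) h2
    refine ⟨⟨B ∪ C, Set.union_subset hBA (h1.trans Set.sdiff_subset), hB.union h2, hU ▸ h3⟩,
      Set.subset_union_left, fun C' h1' h2' h3' => ?_⟩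
    simp only [hU]
    gcongr
    exact le_trans (by gcongr; exact hle C' h1' h2' h3') h4
  choose f hf1 hf2 using step
  let Bs : ℕ → {B : Set Ω // B ⊆ A ∧ MeasurableSet B ∧ μ B ≤ c} := fun n =>
    f^[n] ⟨∅, by simp, MeasurableSet.empty, by simp⟩
  have hsucc : ∀ n, Bs (n + 1) = f (Bs n) := fun n => Function.iterate_succ_apply' f n _
  have hmono : Monotone fun n => (Bs n).1 := monotone_nat_of_le_succ fun n => by
    rw [hsucc]; exact hf1 _
  set B := ⋃ n, (Bs n).1 with hBdef
  have hBm : MeasurableSet B := MeasurableSet.iUnion fun n => (Bs n).2.2.1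
  have hBA : B ⊆ A := Set.iUnion_subset fun n => (Bs n).2.1
  have hBc : μ B ≤ c := by
    rw [hBdef, hmono.measure_iUnion]
    exact iSup_le fun n => (Bs n).2.2.2
  refine ⟨B, hBA, hBm, hBc.antisymm ?_⟩
  by_contra hlt
  have hlt := not_le.1 hlt
  have hBt : μ B ≠ ⊤ := (hlt.trans_le le_top).ne
  have hpos : 0 < μ (A \ B) := by
    rw [measure_sdiff hBA hBm.nullMeasurableSet hBt]
    exact tsub_pos_of_lt (hlt.trans_le hc)
  -- If the union fell short of `c`, this `C` would have been admissible at every stage, so each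
  -- stage would gain at least `μ C / 2`, contradicting the bound `c`.
  obtain ⟨C, hCA, hCm, hC0, hC1⟩ := hna.exists_small (hA.diff hBm) hpos (tsub_pos_of_lt hlt)
  have hstep : ∀ n : ℕ, n * (μ C / 2) ≤ μ (Bs n).1 := by
    intro n
    induction n with
    | zero => simp
    | succ n ih =>
      have hsub : (Bs n).1 ⊆ B := Set.subset_iUnion (fun n => (Bs n).1) n
      have h1 := hf2 (Bs n) C (hCA.trans (Set.sdiff_subset_sdiff_right hsub)) hCm (by
        calc μ (Bs n).1 + μ C ≤ μ B + (c - μ B) := by gcongr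
          _ = c := add_tsub_cancel_of_le hBc)
      rw [← hsucc] at h1
      refine le_trans ?_ h1
      push_cast
      rw [add_mul, one_mul]
      gcongr
  obtain ⟨n, hn⟩ := ENNReal.exists_nat_mul_gt (ENNReal.half_pos hC0.ne').ne' hct
  exact absurd (hn.trans_le ((hstep n).trans (Bs n).2.2.2)) (lt_irrefl _)

/-- Countably many sets of positive measure contain pairwise disjoint sets of positive
measure. -/
theorem Nonatomic.exists_disjoint [SigmaFinite μ] (hna : Nonatomic μ) {E : ℕ → Set Ω}
    (hE : ∀ n, MeasurableSet (E n)) (h0 : ∀ n, 0 < μ (E n)) :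
    ∃ B : ℕ → Set Ω, (∀ n, MeasurableSet (B n)) ∧ (∀ n, B n ⊆ E n) ∧ (∀ n, 0 < μ (B n)) ∧
      Pairwise (Function.onFun Disjoint B) := by
  have hsm : ∀ (n : ℕ) (ε : ℝ≥0∞), ∃ C ⊆ E n, MeasurableSet C ∧
      (0 < ε → 0 < μ C ∧ μ C < ε) := by
    intro n ε
    rcases eq_or_ne ε 0 with rfl | h
    · exact ⟨∅, by simp, MeasurableSet.empty, by simp⟩
    · obtain ⟨C, h1, h2, h3, h4⟩ := hna.exists_small (hE n) (h0 n) (pos_iff_ne_zero.2 h)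
      exact ⟨C, h1, h2, fun _ => ⟨h3, h4⟩⟩
  choose g hgE hgm hg using hsm
  -- Each set has at most a quarter of the measure of its predecessor, so removing all later sets
  -- from `C n` takes away at most half of it.
  let C : ℕ → Set Ω := fun n => Nat.rec (g 0 1) (fun n C => g (n + 1) (μ C / 4)) n
  have hC1 : ∀ n, C (n + 1) = g (n + 1) (μ (C n) / 4) := fun n => rfl
  have hdiv : ∀ a : ℝ≥0∞, 0 < a → 0 < a / 4 := fun a ha => ENNReal.div_pos ha.ne' (by simp)
  have hCpos : ∀ n, 0 < μ (C n) := by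
    intro n
    induction n with
    | zero => exact (hg 0 1 one_pos).1
    | succ n ih => rw [hC1]; exact (hg _ _ (hdiv _ ih)).1
  have hCE : ∀ n, C n ⊆ E n := by
    rintro (_ | n)
    · exact hgE 0 1
    · exact hgE _ _
  have hCm : ∀ n, MeasurableSet (C n) := by
    rintro (_ | n)
    · exact hgm 0 1
    · exact hgm _ _
  have hCt : ∀ n, μ (C n) ≠ ⊤ := by
    intro n
    induction n with
    | zero => exact ((hg 0 1 one_pos).2.trans ENNReal.one_lt_top).ne
    | succ n ih => rw [hC1]; exact ((hg _ _ (hdiv _ (hCpos n))).2.trans_le le_top).ne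
  have hCstep : ∀ n, μ (C (n + 1)) ≤ μ (C n) / 4 := fun n => by
    rw [hC1]; exact (hg _ _ (hdiv _ (hCpos n))).2.le
  have hCgeo : ∀ n i, μ (C (n + 1 + i)) ≤ μ (C n) / 4 * 2⁻¹ ^ i := by
    intro n i
    induction i with
    | zero => simpa using hCstep n
    | succ i ih =>
      calc μ (C (n + 1 + i + 1)) ≤ μ (C (n + 1 + i)) / 4 := hCstep _
        _ ≤ μ (C (n + 1 + i)) / 2 := ENNReal.div_le_div_left (by norm_num) _
        _ ≤ μ (C n) / 4 * 2⁻¹ ^ i / 2 := by gcongr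
        _ = μ (C n) / 4 * 2⁻¹ ^ (i + 1) := by rw [pow_succ, div_eq_mul_inv _ 2, mul_assoc]
  have htail : ∀ n, μ (⋃ i, C (n + 1 + i)) < μ (C n) := by
    intro n
    calc μ (⋃ i, C (n + 1 + i)) ≤ ∑' i, μ (C (n + 1 + i)) := measure_iUnion_le _
      _ ≤ ∑' i, μ (C n) / 4 * 2⁻¹ ^ i := ENNReal.tsum_le_tsum (hCgeo n)
      _ = μ (C n) / 4 * 2 := by
          rw [ENNReal.tsum_mul_left, ENNReal.tsum_geometric, ENNReal.one_sub_inv_two, inv_inv]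
      _ = μ (C n) / 2 := by
          rw [div_eq_mul_inv, div_eq_mul_inv, mul_assoc]
          congr 1
          rw [show (4 : ℝ≥0∞) = 2 * 2 by norm_num,
            ENNReal.mul_inv (Or.inl (by simp)) (Or.inl (by simp)), mul_assoc,
            ENNReal.inv_mul_cancel (by simp) (by simp), mul_one]
      _ < μ (C n) := ENNReal.half_lt_self (hCpos n).ne' (hCt n)
  refine ⟨fun n => C n \ ⋃ i, C (n + 1 + i),
    fun n => (hCm n).diff (MeasurableSet.iUnion fun i => hCm _),
    fun n => Set.sdiff_subset.trans (hCE n), fun n => ?_, ?_⟩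
  · by_contra h
    have h1 : μ (C n \ ⋃ i, C (n + 1 + i)) = 0 := by simpa using h
    have h2 := measure_le_inter_add_sdiff μ (C n) (⋃ i, C (n + 1 + i))
    rw [h1, add_zero] at h2
    exact absurd (h2.trans (measure_mono Set.inter_subset_right)) (not_le.2 (htail n))
  · refine (pairwise_disjoint_on _).2 fun a b hab => Set.disjoint_left.2 fun ω h1 h2 => ?_
    refine h1.2 (Set.mem_iUnion.2 ⟨b - (a + 1), ?_⟩)
    rw [Nat.add_sub_of_le hab]
    exact h2.1

/-- The measure space splits into countably many parts on each of which `P` has the same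
essential range. -/
theorem Nonatomic.exists_label [SigmaFinite μ] (hμ : μ ≠ 0) (hna : Nonatomic μ)
    {P : Ω → ℝ≥0∞} (hP : Measurable P) :
    ∃ Λ : Ω → ℕ, Measurable Λ ∧ ∀ r ∈ essRange μ P, ∀ U ∈ 𝓝 r, ∀ n,
      0 < μ.restrict (Λ ⁻¹' {n}) (P ⁻¹' U) := by
  classical
  -- For every pair of a basic open set `V` and a label `n`, a piece of `P ⁻¹' V` is reserved for
  -- `n`; then each label sees every `V` charged by `P`.
  let ι := {V // V ∈ TopologicalSpace.countableBasis ℝ≥0∞} × ℕ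
  obtain ⟨V₀, hV₀, -⟩ := (TopologicalSpace.isBasis_countableBasis ℝ≥0∞).exists_subset_of_mem_open
    (Set.mem_univ 0) isOpen_univ
  have : Nonempty ι := ⟨⟨V₀, hV₀⟩, 0⟩
  have : Countable {V // V ∈ TopologicalSpace.countableBasis ℝ≥0∞} :=
    (TopologicalSpace.countable_countableBasis ℝ≥0∞).to_subtype
  obtain ⟨f, hf⟩ := exists_surjective_nat ι
  have hVm : ∀ V ∈ TopologicalSpace.countableBasis ℝ≥0∞, MeasurableSet (P ⁻¹' V) := fun V hV =>
    hP ((TopologicalSpace.isBasis_countableBasis ℝ≥0∞).isOpen hV).measurableSet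
  -- If `P ⁻¹' V` is null, the whole space is a harmless substitute, as only sets of positive
  -- measure are asked for.
  let E : ℕ → Set Ω := fun k => if 0 < μ (P ⁻¹' (f k).1.1) then P ⁻¹' (f k).1.1 else Set.univ
  obtain ⟨B, hBm, hBE, hB0, hBd⟩ := hna.exists_disjoint (E := E) (fun k => by
      simp only [E]; split_ifs
      · exact hVm _ (f k).1.2
      · exact MeasurableSet.univ) (fun k => by
      simp only [E]; split_ifs with h
      · exact h
      · simpa using hμ)
  let D : ℕ → Set Ω := fun n => ⋃ k ∈ {k | (f k).2 = n}, B k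
  have hDm : ∀ n, MeasurableSet (D n) := fun n =>
    MeasurableSet.biUnion (Set.to_countable _) fun k _ => hBm k
  have hDd : ∀ m n ω, ω ∈ D m → ω ∈ D n → m = n := by
    intro m n ω hm hn
    obtain ⟨k, hk, hωk⟩ := Set.mem_iUnion₂.1 hm
    obtain ⟨l, hl, hωl⟩ := Set.mem_iUnion₂.1 hn
    have : k = l := by
      by_contra h
      exact Set.disjoint_left.1 (hBd h) hωk hωl
    rw [← (hk : (f k).2 = m), ← (hl : (f l).2 = n), this]
  -- The second alternative gives the label `0` to points outside all pieces.
  have hex : ∀ ω, ∃ n, ω ∈ D n ∨ ω ∉ ⋃ n, D n := by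
    intro ω
    by_cases h : ω ∈ ⋃ n, D n
    · obtain ⟨n, hn⟩ := Set.mem_iUnion.1 h
      exact ⟨n, Or.inl hn⟩
    · exact ⟨0, Or.inr h⟩
  have hΛm : Measurable fun ω => Nat.find (hex ω) := measurable_find hex fun n =>
    (hDm n).union (MeasurableSet.iUnion hDm).compl
  refine ⟨fun ω => Nat.find (hex ω), hΛm, fun r hr U hU n => ?_⟩
  obtain ⟨V, hV, hrV, hVU⟩ :=
    (TopologicalSpace.isBasis_countableBasis ℝ≥0∞).mem_nhds_iff.1 hU
  have hpos : 0 < μ (P ⁻¹' V) := by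
    have hV' := (TopologicalSpace.isBasis_countableBasis ℝ≥0∞).isOpen hV
    have := Measure.mem_support_iff_forall r |>.1 hr V (hV'.mem_nhds hrV)
    rwa [Measure.map_apply hP hV'.measurableSet] at this
  obtain ⟨k, hk⟩ := hf (⟨V, hV⟩, n)
  have hsub : B k ⊆ P ⁻¹' U ∩ (fun ω => Nat.find (hex ω)) ⁻¹' {n} := by
    intro ω hω
    have h1 : ω ∈ P ⁻¹' V := by
      have := hBE k hω
      simp only [E, hk, hpos, if_true] at this
      exact this
    have h2 : ω ∈ D n := Set.mem_iUnion₂.2 ⟨k, by simp [hk], hω⟩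
    refine ⟨hVU h1, ?_⟩
    rcases Nat.find_spec (hex ω) with h3 | h3
    · exact hDd _ _ ω h3 h2
    · exact absurd (Set.mem_iUnion.2 ⟨n, h2⟩) h3
  rw [Measure.restrict_apply' (hΛm (measurableSet_singleton n))]
  exact (hB0 k).trans_le (measure_mono hsub)

end Nonatomic

/-! ### Realising members of `𝒦(R)` by modulars. -/

section Realization

variable {Ω : Type*} [MeasurableSpace Ω] {m : Measure Ω}

theorem extFun_psiPath {q : ℝ} (hq : 2 ≤ q) {s : ℝ≥0} (hs : s ≤ 1) :
    extFun (psiPath q) s = (s : ℝ≥0∞) ^ q * (ENNReal.ofReal q)⁻¹ := by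
  rw [extFun_of_le _ hs, psiPath_apply hq, ENNReal.ofReal_div_of_pos (by linarith),
    ← ENNReal.ofReal_rpow_of_nonneg s.coe_nonneg (by linarith), ENNReal.ofReal_coe_nnreal,
    div_eq_mul_inv]

/-- The functions that are, up to any given error, the modulars of the multiples of a function. -/
def Realizable (m : Measure Ω) (p : Ω → ℝ) : Set C(unitInterval, ℝ) :=
  {φ | (∀ t, 0 ≤ φ t) ∧ ∀ ε : ℝ≥0∞, 0 < ε → ∃ g : Ω → ℝ≥0, Measurable g ∧ ∀ s : ℝ≥0, s ≤ 1 →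
    ∫⁻ ω, (s : ℝ≥0∞) ^ p ω * g ω ∂m ≤ extFun φ s + ε ∧
    extFun φ s ≤ ∫⁻ ω, (s : ℝ≥0∞) ^ p ω * g ω ∂m + ε}

/-- The weight `g` enters the integral linearly, so convex combinations of weights realise those of
the functions. -/
theorem convex_realizable {p : Ω → ℝ} (hpm : Measurable p) : Convex ℝ (Realizable m p) := by
  intro φ₁ h₁ φ₂ h₂ a b ha hb hab
  refine ⟨fun t => ?_, fun ε hε => ?_⟩
  · simp only [ContinuousMap.add_apply, ContinuousMap.smul_apply, smul_eq_mul]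
    have := h₁.1 t
    have := h₂.1 t
    positivity
  · obtain ⟨g₁, hg₁, hs₁⟩ := h₁.2 ε hε
    obtain ⟨g₂, hg₂, hs₂⟩ := h₂.2 ε hε
    lift a to ℝ≥0 using ha
    lift b to ℝ≥0 using hb
    have hab' : (a + b : ℝ≥0∞) = 1 := by exact_mod_cast hab
    refine ⟨fun ω => a * g₁ ω + b * g₂ ω, by fun_prop, fun s hs => ?_⟩
    have hI : ∫⁻ ω, (s : ℝ≥0∞) ^ p ω * ((a * g₁ ω + b * g₂ ω : ℝ≥0) : ℝ≥0∞) ∂m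
        = a * ∫⁻ ω, (s : ℝ≥0∞) ^ p ω * g₁ ω ∂m + b * ∫⁻ ω, (s : ℝ≥0∞) ^ p ω * g₂ ω ∂m := by
      rw [← lintegral_const_mul' _ _ (by simp), ← lintegral_const_mul' _ _ (by simp),
        ← lintegral_add_left (by fun_prop)]
      refine lintegral_congr fun ω => ?_
      push_cast
      ring
    have hE : extFun ((a : ℝ) • φ₁ + (b : ℝ) • φ₂) s = a * extFun φ₁ s + b * extFun φ₂ s := by
      unfold extFun
      rw [ContinuousMap.add_apply, ContinuousMap.smul_apply, ContinuousMap.smul_apply,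
        smul_eq_mul, smul_eq_mul, ENNReal.ofReal_add (mul_nonneg a.coe_nonneg (h₁.1 _))
        (mul_nonneg b.coe_nonneg (h₂.1 _)), ENNReal.ofReal_mul a.coe_nonneg,
        ENNReal.ofReal_mul b.coe_nonneg,
        ENNReal.ofReal_coe_nnreal, ENNReal.ofReal_coe_nnreal]
    have hsplit : ∀ x y : ℝ≥0∞, a * (x + ε) + b * (y + ε) = a * x + b * y + ε := by
      intro x y
      calc _ = a * x + b * y + (a + b) * ε := by ring
        _ = _ := by rw [hab', one_mul]
    rw [hI, hE]
    constructor
    · rw [← hsplit]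
      gcongr
      · exact (hs₁ s hs).1
      · exact (hs₂ s hs).1
    · rw [← hsplit]
      gcongr
      · exact (hs₁ s hs).2
      · exact (hs₂ s hs).2

theorem isClosed_realizable {p : Ω → ℝ} : IsClosed (Realizable m p) := by
  refine isClosed_of_closure_subset fun φ hφ => ⟨fun t => ?_, fun ε hε => ?_⟩
  · have hc : IsClosed {φ : C(unitInterval, ℝ) | 0 ≤ φ t} := isClosed_le (by fun_prop) (by fun_prop)
    exact hc.closure_subset_iff.2 (fun ψ hψ => hψ.1 t) hφ
  · obtain ⟨ε', hε'0, hε'⟩ := ENNReal.lt_iff_exists_nnreal_btwn.1 (ENNReal.half_pos hε.ne')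
    obtain ⟨ψ, hψ, hd⟩ := Metric.mem_closure_iff.1 hφ ε' (by exact_mod_cast hε'0)
    have hd1 : ENNReal.ofReal ‖φ - ψ‖ ≤ ε / 2 := by
      refine le_trans ?_ hε'.le
      rw [← ENNReal.ofReal_coe_nnreal (p := ε')]
      exact ENNReal.ofReal_le_ofReal (by rw [← dist_eq_norm]; exact hd.le)
    have hd2 : ENNReal.ofReal ‖ψ - φ‖ ≤ ε / 2 := by rwa [norm_sub_rev]
    obtain ⟨g, hg, h⟩ := hψ.2 _ (ENNReal.half_pos hε.ne')
    refine ⟨g, hg, fun s hs => ⟨?_, ?_⟩⟩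
    · refine (h s hs).1.trans ?_
      calc _ ≤ extFun φ s + ε / 2 + ε / 2 := by
            gcongr
            exact (extFun_le_add ψ φ s).trans (by gcongr)
        _ = _ := by rw [add_assoc, ENNReal.add_halves]
    · refine (extFun_le_add φ ψ s).trans ?_
      calc _ ≤ (∫⁻ ω, (s : ℝ≥0∞) ^ p ω * g ω ∂m + ε / 2) + ε / 2 := by
            gcongr
            exact (h s hs).2
        _ = _ := by rw [add_assoc, ENNReal.add_halves]

theorem psi_mem_realizable [SigmaFinite m] {P : Ω → ℝ≥0∞} {p : Ω → ℝ} (hP : Measurable P)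
    (hpm : Measurable p) (hp : ∀ ω, 2 ≤ p ω) (hPp : ∀ᵐ ω ∂m, P ω = ENNReal.ofReal (p ω))
    {q : ℝ} (hq : 2 ≤ q) (hpos : ∀ U ∈ 𝓝 (ENNReal.ofReal q), 0 < m (P ⁻¹' U)) :
    psi (ENNReal.ofReal q) ∈ Realizable m p := by
  rw [psi_ofReal hq]
  refine ⟨fun t => ?_, fun ε hε => ?_⟩
  · rw [psiPath_apply hq]
    have := t.2.1
    positivity
  obtain ⟨ε', hε'0, hε'⟩ := ENNReal.lt_iff_exists_nnreal_btwn.1 hε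
  have hε'0 : 0 < ε' := by exact_mod_cast hε'0
  have hcont : ContinuousAt (fun r : ℝ≥0∞ => psiPath r.toReal) (ENNReal.ofReal q) :=
    psiPath.continuous.continuousAt.comp (ENNReal.continuousAt_toReal (by simp))
  have hU := hcont.preimage_mem_nhds (Metric.ball_mem_nhds _ (NNReal.coe_pos.2 hε'0))
  rw [ENNReal.toReal_ofReal (by linarith)] at hU
  obtain ⟨V, hVU, hVo, hqV⟩ := mem_nhds_iff.1 hU
  obtain ⟨B, hB, hBV, hB0, hBt⟩ := Measure.exists_subset_measure_lt_top
    (hP hVo.measurableSet) (hpos V (hVo.mem_nhds hqV))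
  have hBb : ∀ᵐ ω ∂m, ω ∈ B → ‖psiPath (p ω) - psiPath q‖ ≤ ε' := by
    filter_upwards [hPp] with ω hω hωB
    have h1 := hVU (hBV hωB)
    simp only [Set.mem_preimage, hω, ENNReal.toReal_ofReal (zero_le_two.trans (hp ω)),
      mem_ball_iff_norm] at h1
    exact h1.le
  have hBb1 : ∀ᵐ ω ∂m, ω ∈ B → ENNReal.ofReal ‖psiPath (p ω) - psiPath q‖ ≤ ε := by
    filter_upwards [hBb] with ω h1 h2
    refine le_trans ?_ hε'.le
    rw [← ENNReal.ofReal_coe_nnreal (p := ε')]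
    exact ENNReal.ofReal_le_ofReal (h1 h2)
  set M := (m B).toNNReal with hM
  have hMB : (M : ℝ≥0∞) = m B := ENNReal.coe_toNNReal hBt.ne
  have hM0 : M ≠ 0 := by
    intro h
    rw [h] at hMB
    simp [← hMB] at hB0
  -- This weight turns the integral into the mean over `B` of `ψ_{p ω} (s)`, and on `B` every `ψ_{p
  -- ω}` is uniformly close to `ψ_q`.
  refine ⟨B.indicator fun ω => M⁻¹ * (p ω).toNNReal⁻¹, Measurable.indicator (by fun_prop) hB,
    fun s hs => ?_⟩
  have hI : ∫⁻ ω, (s : ℝ≥0∞) ^ p ω * (B.indicator (fun ω => M⁻¹ * (p ω).toNNReal⁻¹) ω : ℝ≥0) ∂m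
      = (M⁻¹ : ℝ≥0) * ∫⁻ ω in B, extFun (psiPath (p ω)) s ∂m := by
    rw [← lintegral_const_mul' _ _ (by simp), ← lintegral_indicator hB]
    refine lintegral_congr fun ω => ?_
    by_cases h : ω ∈ B
    · have h2 : (p ω).toNNReal ≠ 0 := by
        have := hp ω
        simpa using (by linarith : 0 < p ω)
      rw [Set.indicator_of_mem h, Set.indicator_of_mem h, extFun_psiPath (hp ω) hs,
        ENNReal.coe_mul, ENNReal.coe_inv h2]
      rw [show ENNReal.ofReal (p ω) = (p ω).toNNReal from rfl]
      ring
    · simp [h]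
  have hconst : ∀ a : ℝ≥0∞, (M⁻¹ : ℝ≥0) * ∫⁻ _ in B, a ∂m = a := by
    intro a
    rw [setLIntegral_const, ← hMB, mul_comm a, ← mul_assoc, ← ENNReal.coe_mul,
      inv_mul_cancel₀ hM0, ENNReal.coe_one, one_mul]
  have hmeas : Measurable fun ω => extFun (psiPath (p ω)) s := by
    have : Measurable fun ω => (s : ℝ≥0∞) ^ p ω * (ENNReal.ofReal (p ω))⁻¹ := by fun_prop
    simpa only [extFun_psiPath (hp _) hs] using this
  rw [hI]
  constructor
  · calc _ ≤ (M⁻¹ : ℝ≥0) * ∫⁻ _ in B, (extFun (psiPath q) s + ε) ∂m := by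
          refine mul_le_mul_right (setLIntegral_mono_ae' hB ?_) _
          filter_upwards [hBb1] with ω h1 h2
          exact (extFun_le_add _ _ s).trans (by gcongr; exact h1 h2)
      _ = _ := hconst _
  · calc extFun (psiPath q) s = (M⁻¹ : ℝ≥0) * ∫⁻ _ in B, extFun (psiPath q) s ∂m :=
          (hconst _).symm
      _ ≤ (M⁻¹ : ℝ≥0) * ∫⁻ ω in B, (extFun (psiPath (p ω)) s + ε) ∂m := by
          refine mul_le_mul_right (setLIntegral_mono_ae' hB ?_) _
          filter_upwards [hBb1] with ω h1 h2
          refine (extFun_le_add _ (psiPath (p ω)) s).trans (add_le_add le_rfl ?_)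
          rw [norm_sub_rev]
          exact h1 h2
      _ = _ := by
          rw [lintegral_add_left hmeas, mul_add, hconst]

theorem KSet_subset_realizable [SigmaFinite m] {R : Set ℝ≥0∞} {N : ℕ}
    (hR : ∀ r ∈ R, ∃ s : ℝ, 2 ≤ s ∧ s ≤ N ∧ r = ENNReal.ofReal s) {P : Ω → ℝ≥0∞} {p : Ω → ℝ}
    (hP : Measurable P) (hpm : Measurable p) (hp : ∀ ω, 2 ≤ p ω)
    (hPp : ∀ᵐ ω ∂m, P ω = ENNReal.ofReal (p ω))
    (hpos : ∀ r ∈ R, ∀ U ∈ 𝓝 r, 0 < m (P ⁻¹' U)) : KSet R ⊆ Realizable m p := by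
  refine closedConvexHull_min ?_ (convex_realizable hpm) isClosed_realizable
  rintro _ ⟨r, hr, rfl⟩
  obtain ⟨q, hq, -, rfl⟩ := hR r hr
  exact psi_mem_realizable hP hpm hp hPp hq (hpos _ hr)

end Realization

/-! ### Disjointly supported images. -/

section OrliczEmbedding

variable {𝕜 : Type*} [RCLike 𝕜] {Ω : Type*} [MeasurableSpace Ω] {μ : Measure Ω}

/-- A map into `L_0` that sends sequences to disjoint sums. -/
theorem exists_disjoint_map (μ : Measure Ω) {p : Ω → ℝ} (hpm : Measurable p)
    (hp : ∀ ω, 2 ≤ p ω) {Λ : Ω → ℕ} (hΛ : Measurable Λ) {g : ℕ → Ω → ℝ≥0}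
    (hg : ∀ n, Measurable (g n)) :
    ∃ T : (ℕ → 𝕜) →ₗ[𝕜] (Ω →ₘ[μ] 𝕜), ∀ x, ∫⁻ ω, ‖T x ω‖ₑ ^ p ω ∂μ
      = ∑' n, ∫⁻ ω, (‖x n‖₊ : ℝ≥0∞) ^ p ω * g n ω ∂(μ.restrict (Λ ⁻¹' {n})) := by
  have hgΛ : Measurable fun ω => g (Λ ω) ω :=
    (measurable_from_prod_countable_right (f := fun z : ℕ × Ω => g z.1 z.2) hg).comp
      (hΛ.prodMk measurable_id)
  set f : Ω → ℝ≥0 := fun ω => g (Λ ω) ω ^ (p ω)⁻¹ with hf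
  have hfm : Measurable f := hgΛ.pow hpm.inv
  have hm : ∀ x : ℕ → 𝕜, AEStronglyMeasurable (fun ω => x (Λ ω) * ((f ω : ℝ) : 𝕜)) μ := by
    intro x
    have h1 : Measurable fun ω => x (Λ ω) := (measurable_of_countable x).comp hΛ
    have h2 : Measurable fun ω => ((f ω : ℝ) : 𝕜) :=
      RCLike.measurable_ofReal.comp hfm.coe_nnreal_real
    exact (h1.mul h2).aestronglyMeasurable
  refine ⟨{ toFun := fun x => AEEqFun.mk _ (hm x), map_add' := fun x y => ?_,
            map_smul' := fun a x => ?_ }, fun x => ?_⟩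
  · rw [AEEqFun.mk_add_mk]
    congr 1
    ext ω
    simp [add_mul]
  · rw [RingHom.id_apply, AEEqFun.smul_mk]
    congr 1
    ext ω
    simp [mul_assoc]
  · have h1 : ∫⁻ ω, ‖(AEEqFun.mk _ (hm x)) ω‖ₑ ^ p ω ∂μ
        = ∫⁻ ω, (‖x (Λ ω)‖₊ : ℝ≥0∞) ^ p ω * g (Λ ω) ω ∂μ := by
      refine lintegral_congr_ae ?_
      filter_upwards [AEEqFun.coeFn_mk _ (hm x)] with ω hω
      have h2 := hp ω
      rw [hω, enorm_mul, ENNReal.mul_rpow_of_nonneg _ _ (by linarith)]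
      have h3 : ‖((f ω : ℝ) : 𝕜)‖ₑ = f ω := by rw [← ofReal_norm]; simp
      rw [h3, enorm_eq_nnnorm, ← ENNReal.coe_rpow_of_nonneg (f ω) (by linarith)]
      simp only [hf]
      rw [NNReal.rpow_inv_rpow (by linarith)]
    change ∫⁻ ω, ‖(AEEqFun.mk _ (hm x)) ω‖ₑ ^ p ω ∂μ = _
    rw [h1, ← setLIntegral_univ]
    have hu : (Set.univ : Set Ω) = ⋃ n, Λ ⁻¹' {n} := by
      ext ω; simp
    rw [hu, lintegral_iUnion (fun n => hΛ (measurableSet_singleton n))]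
    · refine tsum_congr fun n => ?_
      refine setLIntegral_congr_fun (hΛ (measurableSet_singleton n)) fun ω hω => ?_
      have : Λ ω = n := hω
      simp only [this]
    · intro i j hij
      refine Set.disjoint_left.2 fun ω h2 h3 => hij ?_
      rw [← (h2 : Λ ω = i), ← (h3 : Λ ω = j)]

end OrliczEmbedding

/-! ### Embedding Orlicz sequence spaces. -/

section OrliczEmbedding

variable {𝕜 : Type*} [RCLike 𝕜] {S : SequenceSpace 𝕜}

theorem SequenceSpace.EqOrlicz.exists_modular_lt {F : ℝ≥0 → ℝ≥0∞} (h : S.EqOrlicz F) {ε : ℝ≥0∞}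
    (hε : 0 < ε) : ∃ δ : ℝ≥0, 0 < δ ∧ ∀ x : ℕ → 𝕜, S.qnorm x < δ → ∑' n, F ‖x n‖₊ < ε := by
  have h1 : comap S.qnorm (𝓝 0) ≤ comap (fun x : ℕ → 𝕜 =>
      modular Measure.count (fun _ => F) (fun n => (1 : ℝ≥0) * ‖x n‖₊)) (𝓝 0) := by
    rw [h.2]
    exact iInf₂_le (1 : ℝ≥0) (Set.mem_Ioi.2 one_pos)
  have h2 : ∀ᶠ x in comap S.qnorm (𝓝 0), modular Measure.count (fun _ => F)
      (fun n => (1 : ℝ≥0) * ‖x n‖₊) < ε :=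
    (tendsto_comap.eventually_lt_const hε).filter_mono h1
  obtain ⟨δ, hδ, hδx⟩ := ((ENNReal.nhds_zero_basis.comap S.qnorm).eventually_iff).1 h2
  obtain ⟨δ', hδ'0, hδ'⟩ := ENNReal.lt_iff_exists_nnreal_btwn.1 hδ
  refine ⟨δ', by exact_mod_cast hδ'0, fun x hx => ?_⟩
  have h3 : x ∈ S.qnorm ⁻¹' Set.Iio δ := hx.trans hδ'
  have := hδx h3
  rw [modular_count] at this
  simpa using this

theorem SequenceSpace.EqOrlicz.exists_qnorm_lt {F : ℝ≥0 → ℝ≥0∞} (hF : Monotone F)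
    (h : S.EqOrlicz F) : ∃ t ε : ℝ≥0, 0 < t ∧ 0 < ε ∧
      ∀ x : ℕ → 𝕜, ∑' n, F (t * ‖x n‖₊) < ε → S.qnorm x < 1 := by
  have h1 : {x | S.qnorm x < 1} ∈ comap S.qnorm (𝓝 0) :=
    (tendsto_comap.eventually_lt_const one_pos : ∀ᶠ x in comap S.qnorm (𝓝 0), S.qnorm x < 1)
  rw [h.2, mem_biInf_of_directed] at h1
  · obtain ⟨t, ht, h2⟩ := h1
    obtain ⟨ε, hε, hx⟩ := ((ENNReal.nhds_zero_basis.comap _).mem_iff).1 h2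
    obtain ⟨ε', hε'0, hε'⟩ := ENNReal.lt_iff_exists_nnreal_btwn.1 hε
    refine ⟨t, ε', ht, by exact_mod_cast hε'0, fun x hxε => ?_⟩
    refine hx ?_
    change modular _ _ _ < ε
    rw [modular_count]
    exact hxε.trans hε'
  · intro t₁ ht₁ t₂ ht₂
    -- As `F` is monotone, the filters decrease in `t`; hence the infimum is directed and a single
    -- `t` suffices.
    have key : ∀ t t' : ℝ≥0, t ≤ t' → comap (fun x : ℕ → 𝕜 =>
        modular Measure.count (fun _ => F) (fun n => t' * ‖x n‖₊)) (𝓝 0) ≤ comap (fun x : ℕ → 𝕜 =>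
        modular Measure.count (fun _ => F) (fun n => t * ‖x n‖₊)) (𝓝 0) := by
      intro t t' htt
      rw [← tendsto_iff_comap]
      refine tendsto_of_tendsto_of_tendsto_of_le_of_le tendsto_const_nhds tendsto_comap
        (fun _ => bot_le) fun x => ?_
      exact lintegral_mono fun n => hF (mul_le_mul_left htt _)
    exact ⟨max t₁ t₂, Set.mem_Ioi.2 (lt_max_of_lt_left (Set.mem_Ioi.1 ht₁)), key _ _ (le_max_left _ _), key _ _ (le_max_right _ _)⟩
  · exact ⟨1, Set.mem_Ioi.2 one_pos⟩

variable {Ω : Type*} [MeasurableSpace Ω] {μ : Measure Ω}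

theorem OSet_equiv {R : Set ℝ≥0∞} {F : ℝ≥0 → ℝ≥0∞} (hF : F ∈ OSet R) :
    ∃ φ ∈ KSet R, ∃ c a b : ℝ≥0, 0 < c ∧ c ≤ 1 ∧ 0 < a ∧ ∀ s ≤ c,
      a * extFun φ s ≤ F s ∧ F s ≤ b * extFun φ s := by
  obtain ⟨-, c, hc0, hc1, φ, hφ, a, b, ha, hb, h⟩ := hF
  lift c to ℝ≥0 using hc0.le
  lift a to ℝ≥0 using ha.le
  lift b to ℝ≥0 using hb.le
  have hc1' : c ≤ 1 := by exact_mod_cast hc1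
  refine ⟨φ, hφ, c, a, b, by exact_mod_cast hc0, hc1', by exact_mod_cast ha, fun s hs => ?_⟩
  have h1 := h ⟨s, s.coe_nonneg, by exact_mod_cast hs.trans hc1'⟩ (by exact_mod_cast hs)
  rw [extFun_of_le _ (hs.trans hc1')]
  simpa only [ENNReal.ofReal_mul a.coe_nonneg, ENNReal.ofReal_mul b.coe_nonneg,
    ENNReal.ofReal_coe_nnreal, Real.toNNReal_coe] using h1

/-- Orlicz sequence spaces generated by members of `𝒪(R(P))` embed into `L_P`. -/
theorem SequenceSpace.EqOrlicz.embedsInto [SigmaFinite μ] (hμ : μ ≠ 0) (hna : Nonatomic μ)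
    {P : Ω → ℝ≥0∞} (hP : Measurable P) (hinf : 2 ≤ expInf μ P) (hsup : expSup μ P < ⊤)
    {F : ℝ≥0 → ℝ≥0∞} (hF : F ∈ OSet (essRange μ P)) (h : S.EqOrlicz F) : S.EmbedsInto μ P := by
  obtain ⟨p, N, hpm, hp, hN, hPp, -, hR⟩ := exists_real_exponent hP hinf hsup
  obtain ⟨Λ, hΛ, hΛpos⟩ := hna.exists_label hμ hP
  obtain ⟨φ, hφ, c, a, b, hc0, hc1, ha, hFφ⟩ := OSet_equiv hF
  have hFmono : Monotone F := hF.1.mono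
  have hN0 : 0 < N := by
    obtain ⟨ω⟩ : Nonempty Ω := by
      by_contra hemp
      rw [not_nonempty_iff] at hemp
      exact hμ (Measure.eq_zero_of_isEmpty μ)
    have := (hp ω).trans (hN ω)
    have : (2 : ℕ) ≤ N := by exact_mod_cast this
    omega
  have htop : ∀ s, extFun φ s ≠ ⊤ := fun s => ENNReal.ofReal_ne_top
  -- Errors `α * 2⁻¹ ^ n` with `α = φ(1) / 2` are summable and leave `I n 1 ≥ α` for every `n`.
  obtain ⟨α, hα⟩ : ∃ α : ℝ≥0, (α : ℝ≥0∞) = extFun φ 1 / 2 :=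
    ⟨_, ENNReal.coe_toNNReal (ENNReal.div_ne_top (htop 1) two_ne_zero)⟩
  have hα0 : 0 < α := by
    have := ENNReal.half_pos (extFun_pos hR hφ hN0 one_pos).ne'
    rw [← hα] at this
    exact_mod_cast this
  have hα2 : extFun φ 1 = α + α := by rw [hα, ENNReal.add_halves]
  have herr : ∀ n : ℕ, (0 : ℝ≥0∞) < α * 2⁻¹ ^ n := fun n =>
    ENNReal.mul_pos (by simpa using hα0.ne') (ENNReal.pow_pos (by simp) n).ne'
  have herr1 : ∀ n : ℕ, (α * 2⁻¹ ^ n : ℝ≥0∞) ≤ α := fun n =>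
    mul_le_of_le_one_right' (pow_le_one₀ bot_le (by simp))
  have herrsum : ∑' n : ℕ, (α * 2⁻¹ ^ n : ℝ≥0∞) = α * 2 := by
    rw [ENNReal.tsum_mul_left, ENNReal.tsum_geometric, ENNReal.one_sub_inv_two, inv_inv]
  choose g hg hgs using fun n => (KSet_subset_realizable (m := μ.restrict (Λ ⁻¹' {n})) hR hP hpm hp
    (ae_restrict_of_ae hPp) (fun r hr U hU => hΛpos r hr U hU n) hφ).2 _ (herr n)
  obtain ⟨T, hT⟩ := exists_disjoint_map (𝕜 := 𝕜) μ hpm hp hΛ hg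
  set I : ℕ → ℝ≥0 → ℝ≥0∞ := fun n s =>
    ∫⁻ ω, (s : ℝ≥0∞) ^ p ω * g n ω ∂(μ.restrict (Λ ⁻¹' {n})) with hI
  have hTI : ∀ x, ∫⁻ ω, ‖T x ω‖ₑ ^ p ω ∂μ = ∑' n, I n ‖x n‖₊ := hT
  have hImono : ∀ n, Monotone (I n) := by
    intro n s t hst
    refine lintegral_mono fun ω => ?_
    have := hp ω
    gcongr
  -- The threshold `a * φ(c)` forces every coordinate into `[0,c]`, where `F` and `φ` are
  -- comparable.
  obtain ⟨δ, hδ0, hδ⟩ := h.exists_modular_lt (ε := a * extFun φ c)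
    (ENNReal.mul_pos (by simpa using ha.ne') (extFun_pos hR hφ hN0 hc0).ne')
  obtain ⟨t, ε, ht0, hε0, htε⟩ := h.exists_qnorm_lt hFmono
  obtain ⟨C, hC⟩ : ∃ C : ℝ≥0, (C : ℝ≥0∞) = extFun φ c + α * 2 :=
    ⟨_, ENNReal.coe_toNNReal (ENNReal.add_ne_top.2
      ⟨htop c, ENNReal.mul_ne_top (by simp) (by simp)⟩)⟩
  -- A coordinate above `M` would contribute at least `M ^ 2 * α ≥ 1` to the modular of `T x`.
  set M : ℝ≥0 := 1 + α⁻¹ with hM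
  have hM1 : 1 ≤ M := by simp [hM]
  have hM0 : 0 < M := by positivity
  have hMα : 1 ≤ M ^ 2 * α := by
    calc 1 = α⁻¹ * α := (inv_mul_cancel₀ hα0.ne').symm
      _ ≤ M * α := by gcongr; simp [hM]
      _ ≤ M ^ 2 * α := by gcongr; exact le_self_pow₀ hM1 two_ne_zero
  set K : ℝ≥0 := b * (1 + 2 * α) + 1 with hK
  -- The factor `c` brings arguments into the range where `F ≤ b * φ`; the other bound makes `b * σ
  -- ^ 2 * (1 + 2 * α)` smaller than `ε`.
  set σ : ℝ≥0 := min c (ε / (2 * K)) with hσ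
  have hK0 : 0 < K := by positivity
  have hσ0 : 0 < σ := by positivity
  have hσ1 : σ ≤ 1 := (min_le_left _ _).trans hc1
  refine S.embedsInto_of_modular hp hPp (T.comp S.carrier.subtype) (δ := δ) (C := C)
    (D := t * M / σ) hδ0 (fun x hx => ?_) fun x hx => ?_
  · change ∫⁻ ω, ‖T (x : ℕ → 𝕜) ω‖ₑ ^ p ω ∂μ ≤ C
    have h1 := hδ x hx
    have hle : ∀ n, ‖(x : ℕ → 𝕜) n‖₊ ≤ c := by
      intro n
      by_contra hcon
      have h2 := (hFφ c le_rfl).1.trans (hFmono (not_le.1 hcon).le)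
      exact absurd ((h2.trans (ENNReal.le_tsum n)).trans_lt h1) (lt_irrefl _)
    have h2 : ∑' n, extFun φ ‖(x : ℕ → 𝕜) n‖₊ ≤ extFun φ c := by
      have h3 : a * ∑' n, extFun φ ‖(x : ℕ → 𝕜) n‖₊ ≤ a * extFun φ c := by
        rw [← ENNReal.tsum_mul_left]
        exact (ENNReal.tsum_le_tsum fun n => (hFφ _ (hle n)).1).trans h1.le
      exact (ENNReal.mul_le_mul_iff_right (by simpa using ha.ne') (by simp)).1 h3
    rw [hTI, hC, ← herrsum]
    calc ∑' n, I n ‖(x : ℕ → 𝕜) n‖₊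
        ≤ ∑' n, (extFun φ ‖(x : ℕ → 𝕜) n‖₊ + α * 2⁻¹ ^ n) :=
          ENNReal.tsum_le_tsum fun n => (hgs n _ ((hle n).trans hc1)).1
      _ = ∑' n, extFun φ ‖(x : ℕ → 𝕜) n‖₊ + ∑' n : ℕ, (α * 2⁻¹ ^ n : ℝ≥0∞) := ENNReal.tsum_add
      _ ≤ _ := by gcongr
  · change ∫⁻ ω, ‖T (x : ℕ → 𝕜) ω‖ₑ ^ p ω ∂μ < 1 at hx
    rw [hTI] at hx
    have hI1 : ∀ n, (α : ℝ≥0∞) ≤ I n 1 := by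
      intro n
      have h1 := ((hgs n 1 le_rfl).2).trans (add_le_add_right (herr1 n) _)
      rw [hα2] at h1
      exact (ENNReal.add_le_add_iff_right (by simp)).1 h1
    have hle : ∀ n, ‖(x : ℕ → 𝕜) n‖₊ ≤ M := by
      intro n
      by_contra hcon
      have h1 : (1 : ℝ≥0∞) ≤ I n M := by
        calc (1 : ℝ≥0∞) ≤ ((M ^ 2 * α : ℝ≥0) : ℝ≥0∞) := by exact_mod_cast hMα
          _ = M ^ 2 * α := by push_cast; rfl
          _ ≤ M ^ 2 * I n 1 := by gcongr; exact hI1 n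
          _ ≤ I n M := by
            simp only [hI]
            rw [← lintegral_const_mul' _ _ (by simp)]
            refine lintegral_mono fun ω => ?_
            rw [ENNReal.coe_one, ENNReal.one_rpow, one_mul, ← ENNReal.rpow_two]
            gcongr
            · exact_mod_cast hM1
            · exact hp ω
      have h2 := h1.trans ((hImono n (not_le.1 hcon).le).trans 
        (ENNReal.le_tsum (f := fun n => I n ‖(x : ℕ → 𝕜) n‖₊) n))
      exact absurd hx (not_lt.2 h2)
    have hy1 : ∀ n, ‖(x : ℕ → 𝕜) n‖₊ / M ≤ 1 := fun n => div_le_one_of_le₀ (hle n) bot_le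
    have h1 : ∑' n, extFun φ (‖(x : ℕ → 𝕜) n‖₊ / M) ≤ (1 + 2 * α : ℝ≥0) := by
      calc _ ≤ ∑' n, (I n ‖(x : ℕ → 𝕜) n‖₊ + α * 2⁻¹ ^ n) := by
            refine ENNReal.tsum_le_tsum fun n => ((hgs n _ (hy1 n)).2).trans ?_
            gcongr
            exact hImono n (div_le_self bot_le hM1)
        _ = ∑' n, I n ‖(x : ℕ → 𝕜) n‖₊ + ∑' n : ℕ, (α * 2⁻¹ ^ n : ℝ≥0∞) := ENNReal.tsum_add
        _ ≤ _ := by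
            rw [herrsum]
            push_cast
            rw [mul_comm (2 : ℝ≥0∞)]
            gcongr
    have h2 := htε ((((σ / (t * M) : ℝ≥0) : ℝ) : 𝕜) • (x : ℕ → 𝕜)) (by
      have e : ∀ n, t * ‖((((σ / (t * M) : ℝ≥0) : ℝ) : 𝕜) • (x : ℕ → 𝕜)) n‖₊
          = σ * (‖(x : ℕ → 𝕜) n‖₊ / M) := by
        intro n
        rw [Pi.smul_apply, nnnorm_smul]
        have : ‖(((σ / (t * M) : ℝ≥0) : ℝ) : 𝕜)‖₊ = σ / (t * M) := by
          ext
          rw [coe_nnnorm, RCLike.norm_ofReal, abs_of_nonneg (NNReal.coe_nonneg _)]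
        rw [this]
        field_simp
      simp only [e]
      calc ∑' n, F (σ * (‖(x : ℕ → 𝕜) n‖₊ / M))
          ≤ ∑' n, (b * σ ^ 2 : ℝ≥0∞) * extFun φ (‖(x : ℕ → 𝕜) n‖₊ / M) := by
            refine ENNReal.tsum_le_tsum fun n => ?_
            refine ((hFφ _ ((mul_le_of_le_one_right' (hy1 n)).trans (min_le_left _ _))).2).trans ?_
            rw [mul_assoc]
            gcongr
            exact extFun_mul_le hR hφ hσ1 (hy1 n)
        _ ≤ (b * σ ^ 2 : ℝ≥0∞) * (1 + 2 * α : ℝ≥0) := by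
            rw [ENNReal.tsum_mul_left]
            gcongr
        _ = ((b * σ ^ 2 * (1 + 2 * α) : ℝ≥0) : ℝ≥0∞) := by push_cast; rfl
        _ < ε := by
            rw [ENNReal.coe_lt_coe]
            calc b * σ ^ 2 * (1 + 2 * α) = σ * σ * (b * (1 + 2 * α)) := by ring
              _ ≤ 1 * (ε / (2 * K)) * K := by
                  gcongr
                  · exact min_le_right _ _
                  · simp [hK]
              _ = ε / 2 := by field_simp
              _ < ε := NNReal.half_lt_self hε0.ne')
    rw [S.qnorm_nnreal_smul] at h2
    have h3 : S.qnorm (x : ℕ → 𝕜) = (t * M / σ : ℝ≥0) *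
        (((σ / (t * M) : ℝ≥0) : ℝ≥0∞) * S.qnorm (x : ℕ → 𝕜)) := by
      rw [← mul_assoc, ← ENNReal.coe_mul]
      have : t * M / σ * (σ / (t * M)) = 1 := by field_simp
      rw [this, ENNReal.coe_one, one_mul]
    rw [h3]
    exact mul_le_of_le_one_right' h2.le

end OrliczEmbedding

/-! ### Rademacher functions on nonatomic spaces. -/

section Rademacher

open Finset

variable {Ω : Type*} [MeasurableSpace Ω] {μ : Measure Ω}

/-- A set of finite measure in a nonatomic measure space carries an independent sequence of
sets of relative measure `1/2`. -/
theorem Nonatomic.exists_independent_halves [SigmaFinite μ] (hna : Nonatomic μ) {A : Set Ω}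
    (hA : MeasurableSet A) (hAt : μ A ≠ ⊤) :
    ∃ B : ℕ → Set Ω, (∀ n, MeasurableSet (B n)) ∧ ∀ k, ∀ t ⊆ range k,
      μ (A ∩ {ω | ∀ n < k, ω ∈ B n ↔ n ∈ t}) = 2⁻¹ ^ k * μ A := by
  have hsm : ∀ E : Set Ω, ∃ H ⊆ E, MeasurableSet H ∧
      (MeasurableSet E → μ E ≠ ⊤ → μ H = μ E / 2) := by
    intro E
    by_cases h : MeasurableSet E ∧ μ E ≠ ⊤
    · obtain ⟨H, h1, h2, h3⟩ := hna.exists_measure_eq h.1 h.2 (ENNReal.half_le_self (a := μ E))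
      exact ⟨H, h1, h2, fun _ _ => h3⟩
    · exact ⟨∅, by simp, MeasurableSet.empty, fun h1 h2 => absurd ⟨h1, h2⟩ h⟩
  choose half hsub hmeas hhalf using hsm
  -- A dyadic tree: `t` records at which levels below `k` the chosen half was taken, so only `t`
  -- below `k` matters.
  let cell : ℕ → Finset ℕ → Set Ω := fun k => Nat.rec (fun _ => A) (fun k c t =>
    if k ∈ t then half (c (t.erase k)) else c (t.erase k) \ half (c (t.erase k))) k
  have hsucc : ∀ k t, cell (k + 1) t = if k ∈ t then half (cell k (t.erase k))
      else cell k (t.erase k) \ half (cell k (t.erase k)) := fun k t => rfl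
  have hcm : ∀ k t, MeasurableSet (cell k t) := by
    intro k
    induction k with
    | zero => exact fun _ => hA
    | succ k ih =>
      intro t
      rw [hsucc]
      split_ifs
      · exact hmeas _
      · exact (ih _).diff (hmeas _)
  have hcμ : ∀ k t, μ (cell k t) = 2⁻¹ ^ k * μ A := by
    intro k
    induction k with
    | zero => intro t; simp [cell]
    | succ k ih =>
      intro t
      have hfin : μ (cell k (t.erase k)) ≠ ⊤ := by
        rw [ih]; exact ENNReal.mul_ne_top (by simp) hAt
      have h1 := hhalf _ (hcm k (t.erase k)) hfin
      have h2 : μ (cell k (t.erase k)) / 2 = 2⁻¹ ^ (k + 1) * μ A := by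
        rw [ih, pow_succ, div_eq_mul_inv]; ring
      rw [hsucc]
      split_ifs
      · rw [h1, h2]
      · rw [measure_sdiff (hsub _) (hmeas _).nullMeasurableSet
          (h1 ▸ ENNReal.div_ne_top hfin two_ne_zero), h1, ENNReal.sub_half hfin, h2]
  let B : ℕ → Set Ω := fun k => ⋃ t ∈ (range k).powerset, half (cell k t)
  have hcell : ∀ k, ∀ t ⊆ range k, cell k t = A ∩ {ω | ∀ n < k, ω ∈ B n ↔ n ∈ t} := by
    intro k
    induction k with
    | zero => intro t _; simp [cell]
    | succ k ih =>
      intro t ht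
      have ht' : t.erase k ⊆ range k := by
        intro n hn
        have h1 := mem_range.1 (ht (mem_of_mem_erase hn))
        have h2 := ne_of_mem_erase hn
        exact mem_range.2 (by omega)
      have hB : ∀ ω ∈ cell k (t.erase k), ω ∈ B k ↔ ω ∈ half (cell k (t.erase k)) := by
        intro ω hω
        constructor
        · intro h
          obtain ⟨t', ht'm, h'⟩ := Set.mem_iUnion₂.1 h
          have ht'' := mem_powerset.1 ht'm
          have hω' := hsub _ h'
          rw [ih _ ht''] at hω'
          rw [ih _ ht'] at hω
          have : t' = t.erase k := by
            ext n
            constructor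
            · intro hn
              have hnk := mem_range.1 (ht'' hn)
              exact (hω.2 n hnk).1 ((hω'.2 n hnk).2 hn)
            · intro hn
              have hnk := mem_range.1 (ht' hn)
              exact (hω'.2 n hnk).1 ((hω.2 n hnk).2 hn)
          rwa [← this]
        · intro h
          exact Set.mem_iUnion₂.2 ⟨_, mem_powerset.2 ht', h⟩
      have hagree : ∀ ω, (∀ n < k + 1, ω ∈ B n ↔ n ∈ t) ↔
          (∀ n < k, ω ∈ B n ↔ n ∈ t.erase k) ∧ (ω ∈ B k ↔ k ∈ t) := by
        intro ω
        constructor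
        · intro h
          refine ⟨fun n hn => ?_, h k (Nat.lt_succ_self k)⟩
          rw [h n (by omega), mem_erase]
          exact ⟨fun h => ⟨by omega, h⟩, fun h => h.2⟩
        · rintro ⟨h1, h2⟩ n hn
          rcases Nat.lt_succ_iff_lt_or_eq.1 hn with h | rfl
          · rw [h1 n h, mem_erase]
            exact ⟨fun h => h.2, fun h' => ⟨by omega, h'⟩⟩
          · exact h2
      have hmem : ∀ ω, ω ∈ A ∩ {ω | ∀ n < k + 1, ω ∈ B n ↔ n ∈ t} ↔
          ω ∈ cell k (t.erase k) ∧ (ω ∈ half (cell k (t.erase k)) ↔ k ∈ t) := by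
        intro ω
        simp only [Set.mem_inter_iff, Set.mem_ofPred_eq, hagree ω]
        constructor
        · rintro ⟨h1, h2, h3⟩
          have h4 : ω ∈ cell k (t.erase k) := by rw [ih _ ht']; exact ⟨h1, h2⟩
          exact ⟨h4, (hB ω h4).symm.trans h3⟩
        · rintro ⟨h1, h2⟩
          have h3 := (hB ω h1).trans h2
          rw [ih _ ht'] at h1
          exact ⟨h1.1, h1.2, h3⟩
      ext ω
      rw [hmem, hsucc]
      split_ifs with hk
      · simp only [hk, iff_true]
        exact ⟨fun h => ⟨hsub _ h, h⟩, fun h => h.2⟩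
      · simp only [hk, iff_false, Set.mem_sdiff]
  refine ⟨B, fun k => ?_, fun k t ht => ?_⟩
  · exact Finset.measurableSet_biUnion _ fun t _ => hmeas _
  · rw [← hcell k t ht, hcμ]

variable {𝕜 : Type*} [RCLike 𝕜]

/-- Integrals over `A` of functions of the first `k` signs are averages over all signs. -/
theorem lintegral_signs {A : Set Ω} (hA : MeasurableSet A) {B : ℕ → Set Ω}
    (hB : ∀ n, MeasurableSet (B n)) {k : ℕ} (hBk : ∀ t ⊆ range k,
      μ (A ∩ {ω | ∀ n < k, ω ∈ B n ↔ n ∈ t}) = 2⁻¹ ^ k * μ A) (G : Finset ℕ → ℝ≥0∞)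
    {f : Ω → ℝ≥0∞} (hf : ∀ t ⊆ range k, ∀ ω, (∀ n < k, ω ∈ B n ↔ n ∈ t) → f ω = G t) :
    ∫⁻ ω in A, f ω ∂μ = 2⁻¹ ^ k * μ A * ∑ t ∈ (range k).powerset, G t := by
  classical
  have hm : ∀ t : Finset ℕ, MeasurableSet (A ∩ {ω | ∀ n < k, ω ∈ B n ↔ n ∈ t}) := by
    intro t
    refine hA.inter ?_
    have : {ω | ∀ n < k, ω ∈ B n ↔ n ∈ t} = ⋂ n ∈ range k, {ω | ω ∈ B n ↔ n ∈ t} := by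
      ext ω; simp
    rw [this]
    refine Finset.measurableSet_biInter _ fun n _ => ?_
    by_cases h : n ∈ t
    · have : {ω | ω ∈ B n ↔ n ∈ t} = B n := by ext ω; simp [h]
      rw [this]; exact hB n
    · have : {ω | ω ∈ B n ↔ n ∈ t} = (B n)ᶜ := by ext ω; simp [h]
      rw [this]; exact (hB n).compl
  have hU : A = ⋃ t ∈ (range k).powerset, A ∩ {ω | ∀ n < k, ω ∈ B n ↔ n ∈ t} := by
    ext ω
    simp only [Set.mem_iUnion, mem_powerset, exists_prop]
    constructor
    · intro h
      refine ⟨(range k).filter fun n => ω ∈ B n, filter_subset _ _, h, fun n hn => ?_⟩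
      simp [hn]
    · rintro ⟨t, -, h⟩
      exact h.1
  conv_lhs => rw [hU]
  rw [lintegral_biUnion_finset]
  · rw [mul_sum]
    refine sum_congr rfl fun t ht => ?_
    rw [← hBk t (mem_powerset.1 ht), mul_comm, ← setLIntegral_const]
    exact setLIntegral_congr_fun (hm t) fun ω hω => hf t (mem_powerset.1 ht) ω hω.2
  · intro t ht t' ht' hne
    refine Set.disjoint_left.2 fun ω h h' => hne ?_
    ext n
    constructor
    · intro hn
      have hnk := mem_range.1 (mem_powerset.1 ht hn)
      exact (h'.2 n hnk).1 ((h.2 n hnk).2 hn)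
    · intro hn
      have hnk := mem_range.1 (mem_powerset.1 ht' hn)
      exact (h.2 n hnk).1 ((h'.2 n hnk).2 hn)
  · exact fun t _ => hm t

/-- A Rademacher type sequence: orthonormal in `L_2`, with square summable combinations bounded
in the modular. -/
theorem Nonatomic.exists_rademacher (𝕜 : Type*) [RCLike 𝕜] [SigmaFinite μ] (hna : Nonatomic μ)
    {A : Set Ω}
    (hA : MeasurableSet A) (hA0 : μ A ≠ 0) (hAt : μ A ≠ ⊤) {p : Ω → ℝ} {N : ℕ}
    (hp : ∀ ω, 2 ≤ p ω) (hN : ∀ ω, p ω ≤ N) :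
    ∃ (r : ℕ → Ω → 𝕜) (C : ℝ≥0), (∀ n, Measurable (r n)) ∧ (∀ n, ∀ ω ∉ A, r n ω = 0) ∧
      (∀ (k : ℕ) (b : ℕ → 𝕜), ∫⁻ ω, ‖∑ n ∈ range k, b n * r n ω‖ₑ ^ 2 ∂μ
        = ∑ n ∈ range k, ‖b n‖ₑ ^ 2) ∧
      ∀ (k : ℕ) (b : ℕ → 𝕜), ∑ n ∈ range k, ‖b n‖ ^ 2 ≤ 1 →
        ∫⁻ ω, ‖∑ n ∈ range k, b n * r n ω‖ₑ ^ p ω ∂μ ≤ C := by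
  classical
  obtain ⟨B, hB, hBk⟩ := hna.exists_independent_halves hA hAt
  set M := (μ A).toReal with hM
  have hM0 : 0 < M := ENNReal.toReal_pos hA0 hAt
  have hMA : ENNReal.ofReal M = μ A := ENNReal.ofReal_toReal hAt
  -- Normalises the signs on `A` in `L_2`.
  set κ : ℝ := (√M)⁻¹ with hκ
  have hκ0 : 0 < κ := by positivity
  have hκ2 : κ ^ 2 * M = 1 := by
    rw [hκ, inv_pow, Real.sq_sqrt hM0.le, inv_mul_cancel₀ hM0.ne']
  set r : ℕ → Ω → 𝕜 := fun n => A.indicator fun ω => (κ : 𝕜) * if ω ∈ B n then 1 else -1 with hr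
  have hrA : ∀ n, ∀ ω ∉ A, r n ω = 0 := fun n ω hω => Set.indicator_of_notMem hω _
  have hsum : ∀ (k : ℕ) (b : ℕ → 𝕜), ∀ ω ∈ A, ∀ t : Finset ℕ, (∀ n < k, ω ∈ B n ↔ n ∈ t) →
      ∑ n ∈ range k, b n * r n ω = ∑ n ∈ range k, sgn 𝕜 t n * ((κ : 𝕜) * b n) := by
    intro k b ω hω t ht
    refine sum_congr rfl fun n hn => ?_
    simp only [hr, Set.indicator_of_mem hω, sgn, ht n (mem_range.1 hn)]
    ring
  have hzero : ∀ (k : ℕ) (b : ℕ → 𝕜) (q : Ω → ℝ), (∀ ω, 0 < q ω) →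
      ∫⁻ ω, ‖∑ n ∈ range k, b n * r n ω‖ₑ ^ q ω ∂μ
        = ∫⁻ ω in A, ‖∑ n ∈ range k, b n * r n ω‖ₑ ^ q ω ∂μ := by
    intro k b q hq
    rw [← lintegral_indicator hA]
    refine lintegral_congr fun ω => ?_
    by_cases h : ω ∈ A
    · rw [Set.indicator_of_mem h]
    · rw [Set.indicator_of_notMem h, sum_eq_zero fun n _ => by rw [hrA n ω h, mul_zero], enorm_zero,
        ENNReal.zero_rpow_of_pos (hq ω)]
  have hκn : ∀ z : 𝕜, ‖(κ : 𝕜) * z‖ ^ 2 = κ ^ 2 * ‖z‖ ^ 2 := by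
    intro z
    rw [norm_mul, RCLike.norm_ofReal, abs_of_pos hκ0, mul_pow]
  have hpow2 : ∀ k : ℕ, (2⁻¹ : ℝ≥0∞) ^ k = ENNReal.ofReal (2⁻¹ ^ k) := by
    intro k
    rw [ENNReal.ofReal_pow (by norm_num), ENNReal.ofReal_inv_of_pos (by norm_num)]
    simp
  have h22 : ∀ k : ℕ, (2⁻¹ : ℝ) ^ k * 2 ^ k = 1 := fun k => by
    rw [← mul_pow]; norm_num
  refine ⟨r, Real.toNNReal (M * (N.factorial * (4 * Real.exp (κ ^ 2)))), fun n => ?_, hrA, ?_, ?_⟩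
  · refine Measurable.indicator (Measurable.const_mul ?_ _) hA
    exact Measurable.ite (hB n) measurable_const measurable_const
  · intro k b
    have h1 := hzero k b (fun _ => 2) (fun _ => two_pos)
    simp only [ENNReal.rpow_two] at h1
    rw [h1, lintegral_congr_ae (g := fun ω =>
      ‖∑ n ∈ range k, sgn 𝕜 ((range k).filter fun n => ω ∈ B n) n * ((κ : 𝕜) * b n)‖ₑ ^ 2)
      ((ae_restrict_iff' hA).2 (ae_of_all _ fun ω hω => by
        rw [hsum k b ω hω ((range k).filter fun n => ω ∈ B n) fun n hn => by simp [hn]]))]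
    rw [lintegral_signs hA hB (hBk k) (fun t =>
      ‖∑ n ∈ range k, sgn 𝕜 t n * ((κ : 𝕜) * b n)‖ₑ ^ 2) (fun t ht ω hω => by
        have : (range k).filter (fun n => ω ∈ B n) = t := by
          ext n
          simp only [mem_filter, mem_range]
          exact ⟨fun h => (hω n h.1).1 h.2, fun h => ⟨mem_range.1 (ht h),
            (hω n (mem_range.1 (ht h))).2 h⟩⟩
        rw [this])]
    have h2 := sum_powerset_sq (range k) (fun n => (κ : 𝕜) * b n)
    rw [card_range] at h2
    have h3 : ∀ z : 𝕜, ‖z‖ₑ ^ 2 = ENNReal.ofReal (‖z‖ ^ 2) := fun z => by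
      rw [ENNReal.ofReal_pow (norm_nonneg _), ofReal_norm]
    simp only [h3]
    rw [← ENNReal.ofReal_sum_of_nonneg fun _ _ => by positivity,
      ← ENNReal.ofReal_sum_of_nonneg fun _ _ => by positivity, h2, ← hMA, hpow2,
      ← ENNReal.ofReal_mul (by positivity), ← ENNReal.ofReal_mul (by positivity)]
    congr 1
    simp only [hκn, ← mul_sum]
    calc _ = (2⁻¹ ^ k * 2 ^ k) * (κ ^ 2 * M) * ∑ n ∈ range k, ‖b n‖ ^ 2 := by ring
      _ = _ := by rw [h22, hκ2]; ring
  · intro k b hb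
    rw [hzero k b p (fun ω => by linarith [hp ω])]
    -- The exponent `p ω` varies together with the signs, so it is eliminated by the exponential
    -- bound before averaging.
    calc _ ≤ ∫⁻ ω in A, ENNReal.ofReal (N.factorial * Real.exp ‖∑ n ∈ range k,
          sgn 𝕜 ((range k).filter fun n => ω ∈ B n) n * ((κ : 𝕜) * b n)‖) ∂μ := by
          refine setLIntegral_mono_ae' hA (ae_of_all _ fun ω hω => ?_)
          have h0 : 0 ≤ p ω := by linarith [hp ω]
          rw [hsum k b ω hω ((range k).filter fun n => ω ∈ B n) fun n hn => by simp [hn],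
            ← ofReal_norm, ENNReal.ofReal_rpow_of_nonneg (norm_nonneg _) h0]
          exact ENNReal.ofReal_le_ofReal (rpow_le_factorial_mul_exp (norm_nonneg _) h0 (hN ω))
      _ = 2⁻¹ ^ k * μ A * ∑ t ∈ (range k).powerset, ENNReal.ofReal (N.factorial *
            Real.exp ‖∑ n ∈ range k, sgn 𝕜 t n * ((κ : 𝕜) * b n)‖) := by
          refine lintegral_signs hA hB (hBk k) _ fun t ht ω hω => ?_
          have : (range k).filter (fun n => ω ∈ B n) = t := by
            ext n
            simp only [mem_filter, mem_range]
            exact ⟨fun h => (hω n h.1).1 h.2, fun h => ⟨mem_range.1 (ht h),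
              (hω n (mem_range.1 (ht h))).2 h⟩⟩
          rw [this]
      _ ≤ ENNReal.ofReal (M * (N.factorial * (4 * Real.exp (κ ^ 2)))) := by
          rw [← ENNReal.ofReal_sum_of_nonneg fun _ _ => by positivity, ← hMA, hpow2,
            ← ENNReal.ofReal_mul (by positivity), ← ENNReal.ofReal_mul (by positivity)]
          refine ENNReal.ofReal_le_ofReal ?_
          rw [← mul_sum]
          have h1 := sum_powerset_exp_norm (range k) (fun n => (κ : 𝕜) * b n)
          rw [card_range] at h1
          simp only [hκn, ← mul_sum] at h1
          calc _ ≤ 2⁻¹ ^ k * M * (N.factorial * (2 ^ k *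
                (4 * Real.exp (κ ^ 2 * ∑ n ∈ range k, ‖b n‖ ^ 2)))) := by gcongr
            _ ≤ 2⁻¹ ^ k * M * (N.factorial * (2 ^ k * (4 * Real.exp (κ ^ 2 * 1)))) := by gcongr
            _ = (2⁻¹ ^ k * 2 ^ k) * (M * (N.factorial * (4 * Real.exp (κ ^ 2)))) := by
              rw [mul_one]; ring
            _ = _ := by rw [h22, one_mul]

end Rademacher

/-! ### Embedding `ℓ_2` -/

section HilbertEmbedding

open Finset

variable {Ω : Type*} [MeasurableSpace Ω] {μ : Measure Ω} {𝕜 : Type*} [RCLike 𝕜]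

theorem eLpNorm_two_sq (f : Ω → 𝕜) : eLpNorm f 2 μ ^ 2 = ∫⁻ ω, ‖f ω‖ₑ ^ 2 ∂μ := by
  rw [eLpNorm_eq_lintegral_rpow_enorm_toReal (by simp) (by simp), ← ENNReal.rpow_two,
    ← ENNReal.rpow_mul]
  simp

/-- An orthonormal sequence of functions induces an isometry of `ℓ_2` into `L_2`. -/
theorem exists_linearIsometry_of_lintegral_sq {r : ℕ → Ω → 𝕜} (hr : ∀ n, Measurable (r n))
    (h : ∀ (k : ℕ) (b : ℕ → 𝕜), ∫⁻ ω, ‖∑ n ∈ range k, b n * r n ω‖ₑ ^ 2 ∂μ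
      = ∑ n ∈ range k, ‖b n‖ₑ ^ 2) :
    ∃ Φ : lp (fun _ : ℕ => 𝕜) 2 →ₗᵢ[𝕜] Lp 𝕜 2 μ, ∀ f, ∃ ns : ℕ → ℕ, StrictMono ns ∧
      ∀ᵐ ω ∂μ, Tendsto (fun i => ∑ n ∈ range (ns i), f n * r n ω) atTop (𝓝 (Φ f ω)) := by
  have hmem : ∀ n, MemLp (r n) 2 μ := by
    refine fun n => ⟨(hr n).aestronglyMeasurable, ?_⟩
    have h1 := h (n + 1) (fun m => if m = n then 1 else 0)
    have e : ∀ ω, ∑ m ∈ range (n + 1), (if m = n then (1 : 𝕜) else 0) * r m ω = r n ω := by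
      intro ω; simp
    simp only [e, ← eLpNorm_two_sq] at h1
    by_contra hcon
    rw [not_lt, top_le_iff] at hcon
    rw [hcon] at h1
    refine absurd h1.symm (ne_of_lt ?_)
    refine (ENNReal.sum_lt_top.2 fun m _ => ?_).trans_eq (by simp)
    exact ENNReal.pow_lt_top enorm_lt_top
  set v : ℕ → Lp 𝕜 2 μ := fun n => (hmem n).toLp (r n) with hv
  have hcoe : ∀ (k : ℕ) (b : ℕ → 𝕜),
      ⇑(∑ n ∈ range k, b n • v n) =ᵐ[μ] fun ω => ∑ n ∈ range k, b n * r n ω := by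
    intro k b
    induction k with
    | zero => simpa [Pi.zero_def] using Lp.coeFn_zero 𝕜 2 μ
    | succ k ih =>
      rw [sum_range_succ]
      filter_upwards [Lp.coeFn_add (∑ n ∈ range k, b n • v n) (b k • v k), ih,
        Lp.coeFn_smul (b k) (v k), (hmem k).coeFn_toLp] with ω h1 h2 h3 h4
      rw [h1, Pi.add_apply, h2, h3, Pi.smul_apply, h4, sum_range_succ, smul_eq_mul]
  have hnorm : ∀ (k : ℕ) (b : ℕ → 𝕜), ‖∑ n ∈ range k, b n • v n‖ ^ 2
      = ∑ n ∈ range k, ‖b n‖ ^ 2 := by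
    intro k b
    rw [Lp.norm_def, ← ENNReal.toReal_pow, eLpNorm_congr_ae (hcoe k b), eLpNorm_two_sq, h,
      ENNReal.toReal_sum fun n _ => by simp]
    simp
  have hone : ∀ n, ‖v n‖ = 1 := by
    intro n
    have h1 := hnorm (n + 1) (fun m => if m = n then 1 else 0)
    have h2 : ‖v n‖ ^ 2 = 1 := by simpa [apply_ite, ite_pow] using h1
    exact (pow_eq_one_iff_of_nonneg (norm_nonneg _) two_ne_zero).1 h2
  have horth : ∀ i j, i ≠ j → inner 𝕜 (v i) (v j) = 0 := by
    intro i j hij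
    -- With this `c` the cross term of `‖v i + c • v j‖ ^ 2` is `2 * ‖c‖ ^ 2`, which the assumed
    -- identity forces to vanish.
    set c := (starRingEnd 𝕜) (inner 𝕜 (v i) (v j)) with hc
    have h1 := hnorm (i + j + 1) (fun m => (if m = i then 1 else 0) + if m = j then c else 0)
    have h2 : ∑ m ∈ range (i + j + 1),
        ((if m = i then (1 : 𝕜) else 0) + if m = j then c else 0) • v m = v i + c • v j := by
      simp only [add_smul, sum_add_distrib, ite_smul, one_smul, zero_smul, sum_ite_eq']
      simp
    have h3 : ∀ m, ‖(if m = i then (1 : 𝕜) else 0) + if m = j then c else 0‖ ^ 2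
        = (if m = i then 1 else 0) + if m = j then ‖c‖ ^ 2 else 0 := by
      intro m
      by_cases hi : m = i
      · have hj : m ≠ j := fun h => hij (hi.symm.trans h)
        simp [hi, hij]
      · by_cases hj : m = j <;> simp [hi, hj]
        simp [hij.symm]
    simp only [h3] at h1
    rw [h2, norm_add_sq (𝕜 := 𝕜), inner_smul_right, norm_smul, hone, hone, sum_add_distrib,
      sum_ite_eq', sum_ite_eq', if_pos (by simp), if_pos (by simp), hc, RCLike.conj_mul] at h1
    have h4 : ‖inner 𝕜 (v i) (v j)‖ ^ 2 = 0 := by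
      have : RCLike.re ((‖inner 𝕜 (v i) (v j)‖ : 𝕜) ^ 2) = ‖inner 𝕜 (v i) (v j)‖ ^ 2 := by
        rw [← RCLike.ofReal_pow, RCLike.ofReal_re]
      rw [this] at h1
      linarith
    simpa using h4
  have hO : Orthonormal 𝕜 v := ⟨hone, fun i j hij => horth i j hij⟩
  refine ⟨hO.orthogonalFamily.linearIsometry, fun f => ?_⟩
  have h1 := (hO.orthogonalFamily.hasSum_linearIsometry f).tendsto_sum_nat
  simp only [LinearIsometry.toSpanSingleton_apply] at h1
  obtain ⟨ns, hns, h2⟩ := (tendstoInMeasure_of_tendsto_Lp h1).exists_seq_tendsto_ae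
  refine ⟨ns, hns, ?_⟩
  filter_upwards [h2, ae_all_iff.2 fun i => hcoe (ns i) f] with ω h3 h4
  simpa only [h4] using h3

/-- `ℓ_2` embeds into `L_P(μ)` if `μ` is nonatomic. -/
theorem SequenceSpace.EqLp.embedsInto [SigmaFinite μ] (hμ : μ ≠ 0) (hna : Nonatomic μ)
    {P : Ω → ℝ≥0∞} (hP : Measurable P) (hinf : 2 ≤ expInf μ P) (hsup : expSup μ P < ⊤)
    {S : SequenceSpace 𝕜} (hS : S.EqLp 2) : S.EmbedsInto μ P := by
  obtain ⟨p, N, hpm, hp, hN, hPp, -⟩ := exists_real_exponent hP hinf hsup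
  obtain ⟨A, hA, -, hA0, hAt⟩ := Measure.exists_subset_measure_lt_top (μ := μ) (r := 0)
    MeasurableSet.univ (pos_iff_ne_zero.2 (Measure.measure_univ_ne_zero.2 hμ))
  obtain ⟨r, C, hr, hrA, hr2, hrp⟩ := hna.exists_rademacher 𝕜 hA hA0.ne' hAt.ne hp hN
  obtain ⟨Φ, hΦ⟩ := exists_linearIsometry_of_lintegral_sq hr hr2
  obtain ⟨a, b, ha, hb, hab⟩ := hS
  have hsq : ∀ x : ℕ → 𝕜, eLpNorm x 2 Measure.count ^ 2 = ∑' n, ‖x n‖ₑ ^ 2 := fun x => by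
    rw [eLpNorm_two_sq, lintegral_count]
  have hlt : ∀ x : S.carrier, eLpNorm (x : ℕ → 𝕜) 2 Measure.count < ⊤ := by
    intro x
    by_contra hcon
    have h1 := (hab x).1
    rw [not_lt, top_le_iff] at hcon
    rw [hcon, ENNReal.mul_top (by simpa using ha.ne'), top_le_iff] at h1
    exact absurd h1 x.2.ne
  have hmem : ∀ x : S.carrier, Memℓp (x : ℕ → 𝕜) 2 := by
    intro x
    rw [memℓp_gen_iff (by simp)]
    have h1 : ∑' n, ‖(x : ℕ → 𝕜) n‖ₑ ^ 2 ≠ ⊤ := by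
      rw [← hsq]
      exact (ENNReal.pow_lt_top (hlt x)).ne
    simpa using ENNReal.summable_toReal h1
  let J : S.carrier →ₗ[𝕜] lp (fun _ : ℕ => 𝕜) 2 :=
    { toFun := fun x => ⟨(x : ℕ → 𝕜), hmem x⟩
      map_add' := fun _ _ => rfl
      map_smul' := fun _ _ => rfl }
  let ι : Lp 𝕜 2 μ →ₗ[𝕜] (Ω →ₘ[μ] 𝕜) :=
    { toFun := fun f => f
      map_add' := fun _ _ => rfl
      map_smul' := fun _ _ => rfl }
  let T : S.carrier →ₗ[𝕜] (Ω →ₘ[μ] 𝕜) := ι ∘ₗ Φ.toLinearMap ∘ₗ J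
  have hT : ∀ x, ⇑(T x) = ⇑(Φ (J x)) := fun _ => rfl
  have hTsq : ∀ x, ∫⁻ ω, ‖T x ω‖ₑ ^ 2 ∂μ = eLpNorm (x : ℕ → 𝕜) 2 Measure.count ^ 2 := by
    intro x
    have h1 : ‖Φ (J x)‖ ^ 2 = ∑' n, ‖(x : ℕ → 𝕜) n‖ ^ 2 := by
      rw [Φ.norm_map]
      have h2 := lp.norm_rpow_eq_tsum (p := 2) (by simp) (J x)
      simp only [ENNReal.toReal_ofNat, Real.rpow_two] at h2
      exact h2
    rw [hT, hsq, ← eLpNorm_two_sq, ← ENNReal.toReal_eq_toReal_iff'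
      (ENNReal.pow_lt_top (Lp.eLpNorm_lt_top _)).ne
      (by rw [← hsq]; exact (ENNReal.pow_lt_top (hlt x)).ne),
      ENNReal.toReal_pow, ← Lp.norm_def, h1, ENNReal.tsum_toReal_eq fun n => by simp]
    simp
  -- Off `A` all partial sums vanish, hence so does their limit; the constant `1` in the comparison
  -- of powers is then needed only on a set of finite measure.
  have hTA : ∀ x, ∀ᵐ ω ∂μ, ω ∉ A → T x ω = 0 := by
    intro x
    obtain ⟨ns, -, h⟩ := hΦ (J x)
    filter_upwards [h] with ω h hω
    refine tendsto_nhds_unique h ?_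
    simp [hrA _ ω hω]
  refine S.embedsInto_of_modular hp hPp T (δ := a) (C := C)
    (D := b * ((μ A).toNNReal + 1)) ha (fun x hx => ?_) fun x hx => ?_
  · obtain ⟨ns, -, h⟩ := hΦ (J x)
    have h1 : eLpNorm (x : ℕ → 𝕜) 2 Measure.count ≤ 1 := by
      have h2 := (hab x).1.trans hx.le
      by_contra hcon
      refine absurd h2 (not_le.2 ?_)
      calc (a : ℝ≥0∞) = a * 1 := (mul_one _).symm
        _ < _ := ENNReal.mul_lt_mul_right (by simpa using ha.ne') (by simp) (not_le.1 hcon)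
    have h2 : ∀ k, ∑ n ∈ range k, ‖(x : ℕ → 𝕜) n‖ ^ 2 ≤ 1 := by
      intro k
      have h3 : ∑ n ∈ range k, ‖(x : ℕ → 𝕜) n‖ₑ ^ 2 ≤ 1 :=
        (ENNReal.sum_le_tsum _).trans ((hsq x).symm.trans_le (pow_le_one₀ bot_le h1))
      have h4 := ENNReal.toReal_mono (by simp) h3
      rw [ENNReal.toReal_sum fun n _ => by simp] at h4
      simpa using h4
    -- Fatou's lemma carries the modular bound from the partial sums to `T x`.
    calc ∫⁻ ω, ‖T x ω‖ₑ ^ p ω ∂μ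
        = ∫⁻ ω, liminf (fun i => ‖∑ n ∈ range (ns i), J x n * r n ω‖ₑ ^ p ω) atTop ∂μ := by
          refine lintegral_congr_ae ?_
          filter_upwards [h] with ω h
          exact (((ENNReal.continuous_rpow_const.comp continuous_enorm).tendsto _).comp
            h).liminf_eq.symm
      _ ≤ liminf (fun i => ∫⁻ ω, ‖∑ n ∈ range (ns i), J x n * r n ω‖ₑ ^ p ω ∂μ) atTop :=
          lintegral_liminf_le fun i => by fun_prop
      _ ≤ C := liminf_le_of_le (by isBoundedDefault) fun c hc => by
          obtain ⟨i, hi⟩ := hc.exists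
          exact hi.trans (hrp (ns i) _ (h2 _))
  · have h1 : eLpNorm (x : ℕ → 𝕜) 2 Measure.count ^ 2 ≤ μ A + 1 := by
      rw [← hTsq]
      calc ∫⁻ ω, ‖T x ω‖ₑ ^ 2 ∂μ ≤ ∫⁻ ω, A.indicator 1 ω + ‖T x ω‖ₑ ^ p ω ∂μ := by
            -- On `A`, `y ^ 2 ≤ 1 + y ^ p` because `p ≥ 2`.
            refine lintegral_mono_ae ?_
            filter_upwards [hTA x] with ω hω
            by_cases hωA : ω ∈ A
            · rw [Set.indicator_of_mem hωA, Pi.one_apply, ← ENNReal.rpow_two]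
              rcases le_total ‖T x ω‖ₑ 1 with h | h
              · exact (ENNReal.rpow_le_one h two_pos.le).trans le_self_add
              · exact (ENNReal.rpow_le_rpow_of_exponent_le h (hp ω)).trans le_add_self
            · simp [hω hωA]
        _ = μ A + ∫⁻ ω, ‖T x ω‖ₑ ^ p ω ∂μ := by
            rw [lintegral_add_left (measurable_one.indicator hA), lintegral_indicator_one hA]
        _ ≤ _ := by gcongr
    refine (hab x).2.trans ?_
    push_cast
    rw [ENNReal.coe_toNNReal hAt.ne]
    gcongr
    refine (ENNReal.pow_le_pow_left_iff two_ne_zero).1 (h1.trans ?_)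
    rw [sq]
    exact le_mul_of_one_le_right' le_add_self

end HilbertEmbedding

end VarExp

end

theorem mainTheorem2 {𝕜 : Type*} [RCLike 𝕜] {Ω : Type*} [MeasurableSpace Ω]
    (μ : Measure Ω) [SigmaFinite μ] (hμ : μ ≠ 0) (hna : VarExp.Nonatomic μ)
    (P : Ω → ℝ≥0∞) (hP : Measurable P) (hpos : ∀ ω, 0 < P ω)
    (hinf : 2 ≤ VarExp.expInf μ P) (hsup : VarExp.expSup μ P < ⊤)
    (S : VarExp.SequenceSpace 𝕜) (hS : S.Subsymmetric) :
    S.EmbedsInto μ P ↔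
      (S.EqLp 2 ∨ ∃ F ∈ VarExp.OSet (VarExp.essRange μ P), S.EqOrlicz F) := by
  refine ⟨fun h => h.eqLp_or_eqOrlicz hP hinf hsup hS, ?_⟩
  rintro (h | ⟨F, hF, h⟩)
  · exact h.embedsInto hμ hna hP hinf hsup
  · exact h.embedsInto hμ hna hP hinf hsup hF
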